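/- The following is provable in intuitionistic higher-order logic with a type of natural numbers (the internal logic of toposes with a natural numbers object: full comprehension, extensionality and Peano axioms, but neither excluded middle nor any choice axiom). Let $\mathbb N_\infty$ be the set of sequences $p\in 2^{\mathbb N}$ that contain at most one $1$; write $\underline n=0^n10^\omega$, $\underline{\mathbb N}=\{\underline n\mid n\in\mathbb N\}$ and $\infty=0^\omega$. For a truth value $p$, let $\bigcirc_{\mathrm{LPO}}\,p$ be the truth value $$\exists w\in\mathbb N_\infty.\ \bigl((w\in\underline{\mathbb N}\ \vee\ w=\infty)\Rightarrow p\bigr).$$ **Theorem.** Assume Markov's principle: for every $p\in2^{\mathbb N}$, if $p\neq 0^\omega$ then $p_n=1$ for some $n\in\mathbb N$. Then $\mathbb N_\infty$ has the $\bigcirc_{\mathrm{LPO}}$ strong Myhill property: for all injections $f,g:\mathbb N_\infty\to\mathbb N_\infty$ there is a bijection $h:\mathbb N_\infty\to\mathbb N_\infty$ such that for every $x\in\mathbb N_\infty$, $$\bigcirc_{\mathrm{LPO}}\Bigl((x,h(x))\in\bigcup_{m\in\mathbb Z} f\circ(g\circ f)^m\Bigr),$$ where for $m=k\ge 0$ the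 relation $f\circ(g\circ f)^m$ is the graph of that composite, and for $m=-(k+1)<0$ it is the converse $\{(x,y)\mid x=(g\circ(f\circ g)^{k})(y)\}$ of the graph of $g\circ(f\circ g)^k$. That is, $\bigcirc_{\mathrm{LPO}}$ is applied to: there is $k\in\mathbb N$ with $h(x)=(f\circ(g\circ f)^k)(x)$ or $x=(g\circ(f\circ g)^k)(h(x))$. -/

import Mathlib

/-!
Intuitionistic higher-order logic with natural numbers (the pure type theory whose models are
the elementary toposes with a natural numbers object): types, terms, formulas and provability.
Formulas are the terms of type `prop`, sets are the terms of type `pow A`.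
Variables are de Bruijn indices, and contexts list the types of the free variables.
After that, conatural numbers, Markov's principle, the mindchange modality and the modal strong
Myhill property are written as terms and formulas of this language.
-/

namespace IHOL

/-- Types: the one-point type, the natural numbers, truth values, products and powersets. -/
inductive Ty : Type
  | one : Ty
  | nat : Ty
  | prop : Ty
  | prod : Ty → Ty → Ty
  | pow : Ty → Ty

/-- A context: the types of the free variables, the most recently bound one first. -/
abbrev Ctx : Type := List Ty

/-- Variables of type `A` in a context. -/
inductive Var : Ctx → Ty → Type
  | zero {Γ : Ctx} {A : Ty} : Var (A :: Γ) A
  | succ {Γ : Ctx} {A B : Ty} : Var Γ A → Var (B :: Γ) A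

/-- Terms of type `A` in a context. `mem t u` is `t ∈ u`, `compr A φ` is `{x : A | φ}`, and
`compr`, `all`, `ex` bind the variable with index zero. -/
inductive Tm : Ctx → Ty → Type
  | var {Γ : Ctx} {A : Ty} : Var Γ A → Tm Γ A
  | star {Γ : Ctx} : Tm Γ Ty.one
  | zero {Γ : Ctx} : Tm Γ Ty.nat
  | succ {Γ : Ctx} : Tm Γ Ty.nat → Tm Γ Ty.nat
  | pair {Γ : Ctx} {A B : Ty} : Tm Γ A → Tm Γ B → Tm Γ (Ty.prod A B)
  | mem {Γ : Ctx} {A : Ty} : Tm Γ A → Tm Γ (Ty.pow A) → Tm Γ Ty.prop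
  | compr {Γ : Ctx} (A : Ty) : Tm (A :: Γ) Ty.prop → Tm Γ (Ty.pow A)
  | eq {Γ : Ctx} {A : Ty} : Tm Γ A → Tm Γ A → Tm Γ Ty.prop
  | top {Γ : Ctx} : Tm Γ Ty.prop
  | bot {Γ : Ctx} : Tm Γ Ty.prop
  | and {Γ : Ctx} : Tm Γ Ty.prop → Tm Γ Ty.prop → Tm Γ Ty.prop
  | or {Γ : Ctx} : Tm Γ Ty.prop → Tm Γ Ty.prop → Tm Γ Ty.prop
  | imp {Γ : Ctx} : Tm Γ Ty.prop → Tm Γ Ty.prop → Tm Γ Ty.prop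
  | all {Γ : Ctx} (A : Ty) : Tm (A :: Γ) Ty.prop → Tm Γ Ty.prop
  | ex {Γ : Ctx} (A : Ty) : Tm (A :: Γ) Ty.prop → Tm Γ Ty.prop

/-- A formula in context `Γ`. -/
abbrev Fm (Γ : Ctx) : Type := Tm Γ Ty.prop

/-! ### Renaming and substitution -/

/-- Renamings of variables. -/
abbrev Ren (Γ Γ' : Ctx) : Type := (A : Ty) → Var Γ A → Var Γ' A

/-- Simultaneous substitutions. -/
abbrev Sub (Γ Γ' : Ctx) : Type := (A : Ty) → Var Γ A → Tm Γ' A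

/-- A renaming pushed under a binder. -/
def Ren.lift {Γ Γ' : Ctx} (ρ : Ren Γ Γ') (B : Ty) : Ren (B :: Γ) (B :: Γ')
  | _, Var.zero => Var.zero
  | _, Var.succ x => Var.succ (ρ _ x)

/-- Renaming the free variables of a term. -/
def Tm.ren {Γ : Ctx} {A : Ty} (t : Tm Γ A) {Γ' : Ctx} (ρ : Ren Γ Γ') : Tm Γ' A :=
  match t with
  | .var x => .var (ρ _ x)
  | .star => .star
  | .zero => .zero
  | .succ t => .succ (t.ren ρ)
  | .pair s t => .pair (s.ren ρ) (t.ren ρ)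
  | .mem s t => .mem (s.ren ρ) (t.ren ρ)
  | .compr B φ => .compr B (φ.ren (ρ.lift B))
  | .eq s t => .eq (s.ren ρ) (t.ren ρ)
  | .top => .top
  | .bot => .bot
  | .and φ ψ => .and (φ.ren ρ) (ψ.ren ρ)
  | .or φ ψ => .or (φ.ren ρ) (ψ.ren ρ)
  | .imp φ ψ => .imp (φ.ren ρ) (ψ.ren ρ)
  | .all B φ => .all B (φ.ren (ρ.lift B))
  | .ex B φ => .ex B (φ.ren (ρ.lift B))

/-- Weakening of a term by one fresh variable (with index zero). -/
def Tm.wk {Γ : Ctx} {A B : Ty} (t : Tm Γ A) : Tm (B :: Γ) A :=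
  t.ren (fun _ x => Var.succ x)

/-- A substitution pushed under a binder. -/
def Sub.lift {Γ Γ' : Ctx} (σ : Sub Γ Γ') (B : Ty) : Sub (B :: Γ) (B :: Γ')
  | _, Var.zero => Tm.var Var.zero
  | _, Var.succ x => (σ _ x).wk

/-- Capture-avoiding simultaneous substitution. -/
def Tm.sub {Γ : Ctx} {A : Ty} (t : Tm Γ A) {Γ' : Ctx} (σ : Sub Γ Γ') : Tm Γ' A :=
  match t with
  | .var x => σ _ x
  | .star => .star
  | .zero => .zero
  | .succ t => .succ (t.sub σ)
  | .pair s t => .pair (s.sub σ) (t.sub σ)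
  | .mem s t => .mem (s.sub σ) (t.sub σ)
  | .compr B φ => .compr B (φ.sub (σ.lift B))
  | .eq s t => .eq (s.sub σ) (t.sub σ)
  | .top => .top
  | .bot => .bot
  | .and φ ψ => .and (φ.sub σ) (ψ.sub σ)
  | .or φ ψ => .or (φ.sub σ) (ψ.sub σ)
  | .imp φ ψ => .imp (φ.sub σ) (ψ.sub σ)
  | .all B φ => .all B (φ.sub (σ.lift B))
  | .ex B φ => .ex B (φ.sub (σ.lift B))

/-- The substitution of `t` for the variable with index zero. -/
def Sub.one {Γ : Ctx} {B : Ty} (t : Tm Γ B) : Sub (B :: Γ) Γ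
  | _, Var.zero => t
  | _, Var.succ x => Tm.var x

/-- `φ.inst t` is `φ[t]`: the variable with index zero is replaced by `t`. -/
def Tm.inst {Γ : Ctx} {A B : Ty} (φ : Tm (B :: Γ) A) (t : Tm Γ B) : Tm Γ A :=
  φ.sub (Sub.one t)

section Syntax_notation

local infix:52 " ≐ " => Tm.eq
local infix:52 " ∊ " => Tm.mem
local infixr:38 " ⋏ " => Tm.and
local infixr:36 " ⋎ " => Tm.or
local infixr:34 " ⟹ " => Tm.imp
local postfix:max "↟" => Tm.wk

/-- The variables with index 0, 1, 2, … -/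
abbrev v0 {Γ : Ctx} {A : Ty} : Tm (A :: Γ) A := .var .zero
abbrev v1 {Γ : Ctx} {A B : Ty} : Tm (B :: A :: Γ) A := .var (.succ .zero)
abbrev v2 {Γ : Ctx} {A B C : Ty} : Tm (C :: B :: A :: Γ) A := .var (.succ (.succ .zero))
abbrev v3 {Γ : Ctx} {A B C D : Ty} : Tm (D :: C :: B :: A :: Γ) A :=
  .var (.succ (.succ (.succ .zero)))

/-! ### Provability -/

/-- `Entails Δ φ`: in the context `Γ`, the formula `φ` is provable from the hypotheses `Δ` in
intuitionistic higher-order logic with natural numbers. Neither excluded middle nor any form of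
choice is among the rules. -/
inductive Entails : {Γ : Ctx} → List (Fm Γ) → Fm Γ → Prop
  /- structural rules -/
  | hyp {Γ : Ctx} {Δ : List (Fm Γ)} {φ : Fm Γ} : φ ∈ Δ → Entails Δ φ
  | weaken {Γ : Ctx} {Δ Δ' : List (Fm Γ)} {φ : Fm Γ} : Δ ⊆ Δ' → Entails Δ φ → Entails Δ' φ
  | cut {Γ : Ctx} {Δ : List (Fm Γ)} {φ ψ : Fm Γ} :
      Entails Δ φ → Entails (φ :: Δ) ψ → Entails Δ ψ
  | subst {Γ Γ' : Ctx} {Δ : List (Fm Γ)} {φ : Fm Γ} (σ : Sub Γ Γ') :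
      Entails Δ φ → Entails (Δ.map (fun χ => χ.sub σ)) (φ.sub σ)
  /- intuitionistic predicate logic -/
  | topI {Γ : Ctx} {Δ : List (Fm Γ)} : Entails Δ .top
  | botE {Γ : Ctx} {Δ : List (Fm Γ)} {φ : Fm Γ} : Entails Δ .bot → Entails Δ φ
  | andI {Γ : Ctx} {Δ : List (Fm Γ)} {φ ψ : Fm Γ} :
      Entails Δ φ → Entails Δ ψ → Entails Δ (φ ⋏ ψ)
  | andE₁ {Γ : Ctx} {Δ : List (Fm Γ)} {φ ψ : Fm Γ} : Entails Δ (φ ⋏ ψ) → Entails Δ φ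
  | andE₂ {Γ : Ctx} {Δ : List (Fm Γ)} {φ ψ : Fm Γ} : Entails Δ (φ ⋏ ψ) → Entails Δ ψ
  | orI₁ {Γ : Ctx} {Δ : List (Fm Γ)} {φ ψ : Fm Γ} : Entails Δ φ → Entails Δ (φ ⋎ ψ)
  | orI₂ {Γ : Ctx} {Δ : List (Fm Γ)} {φ ψ : Fm Γ} : Entails Δ ψ → Entails Δ (φ ⋎ ψ)
  | orE {Γ : Ctx} {Δ : List (Fm Γ)} {φ ψ χ : Fm Γ} :
      Entails Δ (φ ⋎ ψ) → Entails (φ :: Δ) χ → Entails (ψ :: Δ) χ → Entails Δ χ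
  | impI {Γ : Ctx} {Δ : List (Fm Γ)} {φ ψ : Fm Γ} :
      Entails (φ :: Δ) ψ → Entails Δ (φ ⟹ ψ)
  | impE {Γ : Ctx} {Δ : List (Fm Γ)} {φ ψ : Fm Γ} :
      Entails Δ (φ ⟹ ψ) → Entails Δ φ → Entails Δ ψ
  | allI {Γ : Ctx} {Δ : List (Fm Γ)} {A : Ty} {φ : Fm (A :: Γ)} :
      Entails (Δ.map (fun χ => χ↟)) φ → Entails Δ (.all A φ)
  | allE {Γ : Ctx} {Δ : List (Fm Γ)} {A : Ty} {φ : Fm (A :: Γ)} (t : Tm Γ A) :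
      Entails Δ (.all A φ) → Entails Δ (φ.inst t)
  | exI {Γ : Ctx} {Δ : List (Fm Γ)} {A : Ty} {φ : Fm (A :: Γ)} (t : Tm Γ A) :
      Entails Δ (φ.inst t) → Entails Δ (.ex A φ)
  | exE {Γ : Ctx} {Δ : List (Fm Γ)} {A : Ty} {φ : Fm (A :: Γ)} {ψ : Fm Γ} :
      Entails Δ (.ex A φ) → Entails (φ :: Δ.map (fun χ => χ↟)) ψ↟ → Entails Δ ψ
  /- equality -/
  | eqI {Γ : Ctx} {Δ : List (Fm Γ)} {A : Ty} (t : Tm Γ A) : Entails Δ (t ≐ t)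
  | eqE {Γ : Ctx} {Δ : List (Fm Γ)} {A : Ty} (φ : Fm (A :: Γ)) {s t : Tm Γ A} :
      Entails Δ (s ≐ t) → Entails Δ (φ.inst s) → Entails Δ (φ.inst t)
  /- comprehension and extensionality -/
  | comprI {Γ : Ctx} {Δ : List (Fm Γ)} {A : Ty} {φ : Fm (A :: Γ)} {t : Tm Γ A} :
      Entails Δ (φ.inst t) → Entails Δ (t ∊ .compr A φ)
  | comprE {Γ : Ctx} {Δ : List (Fm Γ)} {A : Ty} {φ : Fm (A :: Γ)} {t : Tm Γ A} :
      Entails Δ (t ∊ .compr A φ) → Entails Δ (φ.inst t)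
  | setExt {Γ : Ctx} {Δ : List (Fm Γ)} {A : Ty} {u v : Tm Γ (.pow A)} :
      Entails Δ (.all A ((v0 ∊ u↟ ⟹ v0 ∊ v↟) ⋏ (v0 ∊ v↟ ⟹ v0 ∊ u↟))) → Entails Δ (u ≐ v)
  | propExt {Γ : Ctx} {Δ : List (Fm Γ)} {φ ψ : Fm Γ} :
      Entails Δ (φ ⟹ ψ) → Entails Δ (ψ ⟹ φ) → Entails Δ (φ ≐ ψ)
  /- the one-point type and products -/
  | oneEta {Γ : Ctx} {Δ : List (Fm Γ)} (t : Tm Γ .one) : Entails Δ (t ≐ .star)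
  | pairEta {Γ : Ctx} {Δ : List (Fm Γ)} {A B : Ty} (t : Tm Γ (.prod A B)) :
      Entails Δ (.ex A (.ex B (t↟↟ ≐ .pair v1 v0)))
  | pairInj₁ {Γ : Ctx} {Δ : List (Fm Γ)} {A B : Ty} {s s' : Tm Γ A} {t t' : Tm Γ B} :
      Entails Δ (.pair s t ≐ .pair s' t') → Entails Δ (s ≐ s')
  | pairInj₂ {Γ : Ctx} {Δ : List (Fm Γ)} {A B : Ty} {s s' : Tm Γ A} {t t' : Tm Γ B} :
      Entails Δ (.pair s t ≐ .pair s' t') → Entails Δ (t ≐ t')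
  /- natural numbers -/
  | succNeZero {Γ : Ctx} {Δ : List (Fm Γ)} {t : Tm Γ .nat} :
      Entails Δ (.succ t ≐ .zero) → Entails Δ .bot
  | succInj {Γ : Ctx} {Δ : List (Fm Γ)} {s t : Tm Γ .nat} :
      Entails Δ (.succ s ≐ .succ t) → Entails Δ (s ≐ t)
  | natInd {Γ : Ctx} {Δ : List (Fm Γ)} {u : Tm Γ (.pow .nat)} (t : Tm Γ .nat) :
      Entails Δ (.zero ∊ u) → Entails Δ (.all .nat (v0 ∊ u↟ ⟹ .succ v0 ∊ u↟)) →
      Entails Δ (t ∊ u)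

/-! ### Sets, relations and functions -/

/-- `¬ φ`. -/
def neg {Γ : Ctx} (φ : Fm Γ) : Fm Γ := φ ⟹ .bot

/-- `∀ x ∈ X, φ`. -/
def allIn {Γ : Ctx} {A : Ty} (X : Tm Γ (.pow A)) (φ : Fm (A :: Γ)) : Fm Γ :=
  .all A (v0 ∊ X↟ ⟹ φ)

/-- `∃ x ∈ X, φ`. -/
def exIn {Γ : Ctx} {A : Ty} (X : Tm Γ (.pow A)) (φ : Fm (A :: Γ)) : Fm Γ :=
  .ex A (v0 ∊ X↟ ⋏ φ)

/-- Relations between elements of `A` and elements of `B`. -/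
abbrev Ty.rel (A B : Ty) : Ty := .pow (.prod A B)

/-- `F` is (the graph of) a function from `X` to `Y`. -/
def isFun {Γ : Ctx} {A B : Ty} (X : Tm Γ (.pow A)) (Y : Tm Γ (.pow B)) (F : Tm Γ (.rel A B)) :
    Fm Γ :=
  .all A (.all B (.pair v1 v0 ∊ F↟↟ ⟹ v1 ∊ X↟↟ ⋏ v0 ∊ Y↟↟)) ⋏
  allIn X (.ex B (.pair v1 v0 ∊ F↟↟)) ⋏
  .all A (.all B (.all B (.pair v2 v1 ∊ F↟↟↟ ⟹ .pair v2 v0 ∊ F↟↟↟ ⟹ v1 ≐ v0)))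

/-- `F` is an injective function from `X` to `X`. -/
def isInj {Γ : Ctx} {A : Ty} (X : Tm Γ (.pow A)) (F : Tm Γ (.rel A A)) : Fm Γ :=
  isFun X X F ⋏
  .all A (.all A (.all A (.pair v2 v0 ∊ F↟↟↟ ⟹ .pair v1 v0 ∊ F↟↟↟ ⟹ v2 ≐ v1)))

/-- `F` is a bijective function from `X` to `X`. -/
def isBij {Γ : Ctx} {A : Ty} (X : Tm Γ (.pow A)) (F : Tm Γ (.rel A A)) : Fm Γ :=
  isInj X F ⋏ allIn X (.ex A (.pair v0 v1 ∊ F↟↟))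

/-- The composite `S ∘ R` (first `R`, then `S`): `(x, z)` such that `(x, y) ∈ R` and
`(y, z) ∈ S` for some `y`. -/
def comp {Γ : Ctx} {A B C : Ty} (S : Tm Γ (.rel B C)) (R : Tm Γ (.rel A B)) : Tm Γ (.rel A C) :=
  .compr (.prod A C) (.ex A (.ex B (.ex C
    (v3 ≐ .pair v2 v0 ⋏ .pair v2 v1 ∊ R↟↟↟↟ ⋏ .pair v1 v0 ∊ S↟↟↟↟))))

/-- The converse of a relation. -/
def converse {Γ : Ctx} {A B : Ty} (R : Tm Γ (.rel A B)) : Tm Γ (.rel B A) :=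
  .compr (.prod B A) (.ex B (.ex A (v2 ≐ .pair v1 v0 ⋏ .pair v0 v1 ∊ R↟↟↟)))

/-- The `k`-th iterate `R ^ k` of a relation `R` on the set `X`: the set of `z` with `(k, z) ∈ W`
for every `W` that contains all `(0, (x, x))`, `x ∈ X`, and that contains `(n + 1, (x, y'))`
whenever it contains `(n, (x, y))` and `(y, y') ∈ R`. -/
def iter {Γ : Ctx} {A : Ty} (X : Tm Γ (.pow A)) (R : Tm Γ (.rel A A)) (k : Tm Γ .nat) :
    Tm Γ (.rel A A) :=
  .compr (.prod A A) (.all (.rel .nat (.prod A A))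
    (allIn X↟↟ (.pair .zero (.pair v0 v0) ∊ v1) ⟹
     .all .nat (.all A (.all A (.all A
       (.pair v3 (.pair v2 v1) ∊ (.var (.succ (.succ (.succ (.succ .zero))))) ⟹
        .pair v1 v0 ∊ R↟↟↟↟↟↟ ⟹
        .pair (.succ v3) (.pair v2 v0) ∊ (.var (.succ (.succ (.succ (.succ .zero))))))))) ⟹
     .pair k↟↟ v1 ∊ v0))

/-- The union over all integers `m` of `f ∘ (g ∘ f) ^ m`, for injections `f`, `g` on `X`.
For `m = k ≥ 0` this is `f ∘ (g ∘ f) ^ k`. For `m = -(k + 1)` it is the partial function inverse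
to `g ∘ (f ∘ g) ^ k`. So it relates `x` to the `y` that the path through `x` in the bipartite
graph of `f` and `g` visits in the second copy of `X`, forwards or backwards. -/
def path {Γ : Ctx} {A : Ty} (X : Tm Γ (.pow A)) (f g : Tm Γ (.rel A A)) : Tm Γ (.rel A A) :=
  .compr (.prod A A) (.ex .nat
    (v1 ∊ comp f↟↟ (iter X↟↟ (comp g↟↟ f↟↟) v0) ⋎
     v1 ∊ converse (comp g↟↟ (iter X↟↟ (comp f↟↟ g↟↟) v0))))

/-! ### Conatural numbers -/

/-- The set of all natural numbers. -/
def natSet {Γ : Ctx} : Tm Γ (.pow .nat) := .compr .nat .top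

/-- The numeral `1`. -/
def one {Γ : Ctx} : Tm Γ .nat := .succ .zero

/-- The set `2 = {0, 1}`. -/
def two {Γ : Ctx} : Tm Γ (.pow .nat) := .compr .nat (v0 ≐ .zero ⋎ v0 ≐ one)

/-- Sequences are sets of pairs (index, value). -/
abbrev Ty.seq : Ty := .rel .nat .nat

/-- The set `2^ℕ` of bit sequences. -/
def cantor {Γ : Ctx} : Tm Γ (.pow .seq) := .compr .seq (isFun natSet two v0)

/-- The set `ℕ∞` of conatural numbers: bit sequences with at most one `1`. -/
def conat {Γ : Ctx} : Tm Γ (.pow .seq) :=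
  .compr .seq (v0 ∊ cantor ⋏
    .all .nat (.all .nat (.pair v1 one ∊ v2 ⟹ .pair v0 one ∊ v2 ⟹ v1 ≐ v0)))

/-- The constant sequence `0^ω`, which is the point `∞` of `ℕ∞`. -/
def infty {Γ : Ctx} : Tm Γ .seq := .compr (.prod .nat .nat) (.ex .nat (v1 ≐ .pair v0 .zero))

/-- The sequence `0^n 1 0^ω`, which is the natural number `n` as an element of `ℕ∞`. -/
def ofNat {Γ : Ctx} (n : Tm Γ .nat) : Tm Γ .seq :=
  .compr (.prod .nat .nat)
    (v0 ≐ .pair n↟ one ⋎ .ex .nat (neg (v0 ≐ n↟↟) ⋏ v1 ≐ .pair v0 .zero))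

/-- The image of `ℕ` in `ℕ∞`. -/
def finConat {Γ : Ctx} : Tm Γ (.pow .seq) := .compr .seq (.ex .nat (v1 ≐ ofNat v0))

/-! ### Markov's principle, the mindchange modality and the modal strong Myhill property -/

/-- Markov's principle: a bit sequence different from `0^ω` takes the value `1`. -/
def markov {Γ : Ctx} : Fm Γ :=
  allIn cantor (neg (v0 ≐ infty) ⟹ .ex .nat (.pair v0 one ∊ v1))

/-- The mindchange modality, as the set of truth values `p` such that for some `x ∈ ℕ∞`,
if `x` is a natural number or `x = ∞`, then `p`. -/
def modLPO {Γ : Ctx} : Tm Γ (.pow .prop) :=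
  .compr .prop (exIn conat ((v0 ∊ finConat ⋎ v0 ≐ infty) ⟹ v1))

/-- The strong Myhill property of the set `X` relative to the modality given by the set `M` of
truth values: for all injections `f`, `g : X → X` there is a bijection `h : X → X` such that for
every `x ∈ X` and `y = h(x)`, the truth value of `y ∈ (⋃ m, f ∘ (g ∘ f) ^ m) (x)` is in `M`. -/
def strongMyhill {Γ : Ctx} {A : Ty} (M : Tm Γ (.pow .prop)) (X : Tm Γ (.pow A)) : Fm Γ :=
  .all (.rel A A) (.all (.rel A A) (isInj X↟↟ v1 ⟹ isInj X↟↟ v0 ⟹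
    .ex (.rel A A) (isBij X↟↟↟ v0 ⋏
      allIn X↟↟↟ (.all A (.pair v1 v0 ∊ v2 ⟹
        (.pair v1 v0 ∊ path X↟↟↟↟↟ (.var (.succ (.succ (.succ (.succ .zero))))) v3) ∊
          M↟↟↟↟↟)))))

end Syntax_notation

end IHOL

/-!
The proof is carried out in *worlds*, which are the prime theories with witnesses of
intuitionistic higher-order logic that contain Markov's principle, and it is transferred to
provability by a completeness theorem, `World.complete`. In a world, conjunction, disjunction,
existence and equality are those of Lean, while implications and universal statements are proved
by arguing in an arbitrary world that satisfies a formula `κ` which collects the hypotheses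
(`World.imp_intro`, `World.all_intro`, `World.nat_ind`). A negation may even be proved in
classical worlds, in which each formula or its negation is true (`World.neg_neg_intro`). The same
holds for an equation between conatural numbers (`World.eq_intro`), as these equations are stable.

A point `u` of `ℕ∞` is called decidable if `z = u` or `z ≠ u` for each `z`. Natural numbers are
decidable points. By Markov's principle, an injection maps decidable points to decidable points,
and a point is decidable if its image is (`World.Inj.decPt_right`, `World.Inj.decPt_left`). A
stable property of conatural numbers that has exactly one witness classically has a witness as
soon as one can decide of each natural number whether it is the witness (`World.exists_intro`):
the digits of the witness are these decisions.

Given injections `f` and `g`, let `g'` be the composite of `g` and the transposition of `u` and `g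
(f u)`. Then `g' (f u) = u`, and whenever `f a = b` and `g b = a`, this stays true for `g'`. The
transposition is a total function because `u` is decidable if and only if `g (f u)` is
(`World.exists_swap`), so `g'` is again an injection. The same is then done with the roles of `f`
and `g'` exchanged. This is repeated for `u = ∞, 0, 1, 2, …`, and it yields a sequence of pairs
`(F, G)` of injections. The points `a` and `b` are matched at some stage if `F a = b` and `G b =
a` there. Each natural number is matched on both sides after finitely many steps, and `∞` is
matched with `f ∞` at the initial stage. The bijection `h` relates the points that are not not
matched (`myhill`). It is total and surjective by `World.exists_intro`: the stage after `k`
decides which point is matched with `k` (`World.exists_linked_left`, `World.exists_linked_right`).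

The union `V` of the second-side points on the path of `x` and the set `U` of the points that `f`
maps into `V` correspond under `f` and `g`, and so they do under all their modifications
(`World.Stage.color`). Hence `h x` is not not on the path of `x`
(`World.Classical.onPath_of_matched`). The witness for the modality is `x` itself. If `x` is a
natural number, then `x` and `h x` are decidable points, so that the number `k` with `h x = f ((g
f)^k x)` or `x = g ((f g)^k (h x))` is found by Markov's principle. If `x = ∞`, then `h x = f x`.
-/

deriving instance Countable for IHOL.Ty
deriving instance Countable for IHOL.Var
deriving instance Countable for IHOL.Tm

namespace IHOL

/-! ### Renaming and substitution -/

theorem Ren.lift_comp {Γ Γ' Γ'' : Ctx} (ρ : Ren Γ Γ') (ρ' : Ren Γ' Γ'') (B : Ty) :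
    (fun A x => ρ'.lift B A (ρ.lift B A x)) = Ren.lift (fun A x => ρ' A (ρ A x)) B := by
  funext A x
  cases x <;> rfl

theorem Tm.ren_ren {Γ : Ctx} {A : Ty} (t : Tm Γ A) {Γ' Γ'' : Ctx} (ρ : Ren Γ Γ')
    (ρ' : Ren Γ' Γ'') : (t.ren ρ).ren ρ' = t.ren (fun A x => ρ' A (ρ A x)) := by
  induction t generalizing Γ' Γ'' <;> simp only [Tm.ren, Ren.lift_comp, *]

theorem Sub.lift_ren {Γ Γ' Γ'' : Ctx} (ρ : Ren Γ Γ') (σ : Sub Γ' Γ'') (B : Ty) :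
    (fun A x => σ.lift B A (ρ.lift B A x)) = Sub.lift (fun A x => σ A (ρ A x)) B := by
  funext A x
  cases x <;> rfl

theorem Tm.sub_ren {Γ : Ctx} {A : Ty} (t : Tm Γ A) {Γ' Γ'' : Ctx} (ρ : Ren Γ Γ')
    (σ : Sub Γ' Γ'') : (t.ren ρ).sub σ = t.sub (fun A x => σ A (ρ A x)) := by
  induction t generalizing Γ' Γ'' <;> simp only [Tm.ren, Tm.sub, Sub.lift_ren, *]

theorem Sub.ren_lift {Γ Γ' Γ'' : Ctx} (σ : Sub Γ Γ') (ρ : Ren Γ' Γ'') (B : Ty) :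
    (fun A x => (σ.lift B A x).ren (ρ.lift B)) = Sub.lift (fun A x => (σ A x).ren ρ) B := by
  funext A x
  cases x with
  | zero => rfl
  | succ x => simp [Sub.lift, Tm.wk, Tm.ren_ren, Ren.lift]

theorem Tm.ren_sub {Γ : Ctx} {A : Ty} (t : Tm Γ A) {Γ' Γ'' : Ctx} (σ : Sub Γ Γ')
    (ρ : Ren Γ' Γ'') : (t.sub σ).ren ρ = t.sub (fun A x => (σ A x).ren ρ) := by
  induction t generalizing Γ' Γ'' <;> simp only [Tm.ren, Tm.sub, Sub.ren_lift, *]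

theorem Tm.wk_sub_lift {Γ Γ' : Ctx} {A B : Ty} (t : Tm Γ A) (σ : Sub Γ Γ') :
    (t.wk (B := B)).sub (σ.lift B) = (t.sub σ).wk := by
  simp [Tm.wk, Tm.sub_ren, Tm.ren_sub, Sub.lift]

theorem Sub.lift_comp {Γ Γ' Γ'' : Ctx} (σ : Sub Γ Γ') (τ : Sub Γ' Γ'') (B : Ty) :
    (fun A x => (σ.lift B A x).sub (τ.lift B)) = Sub.lift (fun A x => (σ A x).sub τ) B := by
  funext A x
  cases x with
  | zero => rfl
  | succ x => simp [Sub.lift, Tm.wk_sub_lift]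

theorem Tm.sub_sub {Γ : Ctx} {A : Ty} (t : Tm Γ A) {Γ' Γ'' : Ctx} (σ : Sub Γ Γ')
    (τ : Sub Γ' Γ'') : (t.sub σ).sub τ = t.sub (fun A x => (σ A x).sub τ) := by
  induction t generalizing Γ' Γ'' <;> simp only [Tm.sub, Sub.lift_comp, *]

theorem Sub.lift_var {Γ : Ctx} (B : Ty) :
    Sub.lift (fun _ x => Tm.var x : Sub Γ Γ) B = fun _ x => Tm.var x := by
  funext A x
  cases x <;> rfl

theorem Tm.sub_var {Γ : Ctx} {A : Ty} (t : Tm Γ A) : t.sub (fun _ x => Tm.var x) = t := by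
  induction t <;> simp only [Tm.sub, Sub.lift_var, *]

theorem Tm.ren_eq_sub {Γ Γ' : Ctx} {A : Ty} (t : Tm Γ A) (ρ : Ren Γ Γ') :
    t.ren ρ = t.sub (fun _ x => Tm.var (ρ _ x)) := by
  rw [← Tm.sub_var (t.ren ρ), Tm.sub_ren]

theorem Tm.wk_inst {Γ : Ctx} {A B : Ty} (t : Tm Γ A) (s : Tm Γ B) : t.wk.inst s = t := by
  rw [Tm.inst, Tm.wk, Tm.sub_ren]
  exact t.sub_var

/-- The substitution of `t` for the variable with index zero and of `σ` for the others. -/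
def Sub.cons {Γ Γ' : Ctx} {B : Ty} (t : Tm Γ' B) (σ : Sub Γ Γ') : Sub (B :: Γ) Γ'
  | _, Var.zero => t
  | _, Var.succ x => σ _ x

theorem Tm.sub_lift_inst {Γ Γ' : Ctx} {A B : Ty} (φ : Tm (B :: Γ) A) (σ : Sub Γ Γ')
    (t : Tm Γ' B) : (φ.sub (σ.lift B)).inst t = φ.sub (Sub.cons t σ) := by
  rw [Tm.inst, Tm.sub_sub]
  congr 1
  funext A x
  cases x with
  | zero => rfl
  | succ x => exact Tm.wk_inst _ t

theorem Tm.ren_lift_inst {Γ Γ' : Ctx} {A B : Ty} (φ : Tm (B :: Γ) A) (ρ : Ren Γ Γ')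
    (t : Tm Γ' B) :
    (φ.ren (ρ.lift B)).inst t = φ.sub (Sub.cons t (fun _ x => Tm.var (ρ _ x))) := by
  rw [Tm.inst, Tm.sub_ren]
  congr 1
  funext A x
  cases x <;> rfl

theorem Tm.wk_lift_inst {Γ : Ctx} {A B : Ty} (φ : Tm (B :: Γ) A) :
    (φ.ren (Ren.lift (fun _ x => Var.succ x) B)).inst (.var .zero) = φ := by
  rw [Tm.ren_lift_inst]
  conv_rhs => rw [← φ.sub_var]
  congr 1
  funext A x
  cases x <;> rfl

/-! ### Derived rules -/

namespace Entails

variable {Γ : Ctx} {Δ : List (Fm Γ)}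

theorem head {φ : Fm Γ} : Entails (φ :: Δ) φ := hyp List.mem_cons_self

theorem tail {φ ψ : Fm Γ} (h : Entails Δ φ) : Entails (ψ :: Δ) φ :=
  weaken (List.subset_cons_self _ _) h

/-- The cut rule for several formulas. -/
theorem cuts {Δ' : List (Fm Γ)} {φ : Fm Γ} (h : Entails Δ φ) (hΔ : ∀ ψ ∈ Δ, Entails Δ' ψ) :
    Entails Δ' φ := by
  induction Δ generalizing φ with
  | nil => exact weaken (List.nil_subset _) h
  | cons ψ Δ ih =>
    exact impE (ih (impI h) fun χ hχ => hΔ χ (List.mem_cons_of_mem _ hχ))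
      (hΔ ψ List.mem_cons_self)

theorem wk {φ : Fm Γ} (h : Entails Δ φ) (B : Ty) :
    Entails (Δ.map fun χ => χ.wk (B := B)) φ.wk := by
  have := h.subst (fun _ x => Tm.var (Var.succ x) : Sub Γ (B :: Γ))
  simpa only [Tm.wk, Tm.ren_eq_sub] using this

/-- A fresh variable may be dropped if there is a term of its type. -/
theorem unwk {φ : Fm Γ} {B : Ty} (t : Tm Γ B)
    (h : Entails (Δ.map fun χ => χ.wk (B := B)) φ.wk) : Entails Δ φ := by
  have := h.subst (Sub.one t)
  change Entails _ (φ.wk.inst t) at this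
  rw [Tm.wk_inst, List.map_map] at this
  convert this
  refine (List.map_id Δ).symm.trans (List.map_congr_left fun χ _ => ?_)
  exact (Tm.wk_inst χ t).symm

/-- Replacing equals by equals in a term. -/
theorem congr {A B : Ty} (C : Tm (A :: Γ) B) {s t : Tm Γ A} (h : Entails Δ (s.eq t)) :
    Entails Δ ((C.inst s).eq (C.inst t)) := by
  have := eqE (φ := ((C.inst s).wk).eq C) h
  simp only [Tm.inst, Tm.sub] at this
  change Entails Δ (Tm.eq (Tm.inst (Tm.wk _) s) _) → Entails Δ (Tm.eq (Tm.inst (Tm.wk _) t) _)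
    at this
  rw [Tm.wk_inst, Tm.wk_inst] at this
  exact this (eqI _)

theorem symm {A : Ty} {s t : Tm Γ A} (h : Entails Δ (s.eq t)) : Entails Δ (t.eq s) := by
  have := eqE (φ := (Tm.var Var.zero).eq s.wk) h
  simp only [Tm.inst, Tm.sub] at this
  change Entails Δ (Tm.eq _ (Tm.inst (Tm.wk _) s)) → Entails Δ (Tm.eq _ (Tm.inst (Tm.wk _) t))
    at this
  rw [Tm.wk_inst, Tm.wk_inst] at this
  exact this (eqI _)

theorem trans {A : Ty} {s t u : Tm Γ A} (h : Entails Δ (s.eq t)) (h' : Entails Δ (t.eq u)) :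
    Entails Δ (s.eq u) := by
  have := eqE (φ := s.wk.eq (Tm.var Var.zero)) h'
  simp only [Tm.inst, Tm.sub] at this
  change Entails Δ (Tm.eq (Tm.inst (Tm.wk _) t) _) → Entails Δ (Tm.eq (Tm.inst (Tm.wk _) u) _)
    at this
  rw [Tm.wk_inst, Tm.wk_inst] at this
  exact this h

theorem eqMp {φ ψ : Fm Γ} (h : Entails Δ (φ.eq ψ)) (h' : Entails Δ φ) : Entails Δ ψ :=
  eqE (φ := Tm.var Var.zero) h h'

/-- Replacing equals by equals below a binary operation, one argument after the other. -/
theorem congr₂ {A B C : Ty} (op : ∀ {Γ}, Tm Γ A → Tm Γ B → Tm Γ C)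
    (hop : ∀ {Γ Γ'} (s : Tm Γ A) (t : Tm Γ B) (σ : Sub Γ Γ'),
      (op s t).sub σ = op (s.sub σ) (t.sub σ))
    {s s' : Tm Γ A} {t t' : Tm Γ B} (hs : Entails Δ (s.eq s')) (ht : Entails Δ (t.eq t')) :
    Entails Δ ((op s t).eq (op s' t')) := by
  have h1 := congr (op (Tm.var Var.zero) t.wk) hs
  have h2 := congr (op s'.wk (Tm.var Var.zero)) ht
  simp only [Tm.inst, hop] at h1 h2
  change Entails Δ (Tm.eq (op s (Tm.inst (Tm.wk _) _)) (op s' (Tm.inst (Tm.wk _) _))) at h1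
  change Entails Δ (Tm.eq (op (Tm.inst (Tm.wk _) _) t) (op (Tm.inst (Tm.wk _) _) t')) at h2
  simp only [Tm.wk_inst] at h1 h2
  exact h1.trans h2

/-- A universal statement is specialized to a fresh variable. -/
theorem all_sub_var {A : Ty} {φ : Fm (A :: Γ)} (h : Entails Δ (.all A φ)) :
    Entails (Δ.map fun χ => χ.wk) φ := by
  have := allE (.var .zero) (h.wk A)
  rwa [Tm.wk_lift_inst] at this

theorem all_mono {A : Ty} {φ ψ : Fm (A :: Γ)}
    (h : Entails (Δ.map fun χ => χ.wk) (φ.eq ψ)) : Entails (.all A φ :: Δ) (.all A ψ) :=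
  allI (eqMp (weaken (by simp) h) (all_sub_var head))

theorem ex_mono {A : Ty} {φ ψ : Fm (A :: Γ)}
    (h : Entails (Δ.map fun χ => χ.wk) (φ.eq ψ)) : Entails (.ex A φ :: Δ) (.ex A ψ) := by
  refine exE head ?_
  refine exI (φ := ψ.ren (Ren.lift (fun _ x => Var.succ x) A)) (.var .zero) ?_
  rw [Tm.wk_lift_inst]
  refine eqMp (φ := φ) (weaken ?_ h) head
  intro χ hχ
  simp only [List.map_cons, List.mem_cons]
  exact .inr (.inr hχ)

/-- Substituting provably equal terms yields provably equal terms. -/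
theorem sub_congr {A : Ty} (t : Tm Γ A) {Γ' : Ctx} {Δ : List (Fm Γ')} {σ τ : Sub Γ Γ'}
    (h : ∀ B (x : Var Γ B), Entails Δ ((σ B x).eq (τ B x))) :
    Entails Δ ((t.sub σ).eq (t.sub τ)) := by
  have lift : ∀ {Γ Γ' : Ctx} {Δ : List (Fm Γ')} {σ τ : Sub Γ Γ'} (C : Ty),
      (∀ B (x : Var Γ B), Entails Δ ((σ B x).eq (τ B x))) →
      ∀ B (x : Var (C :: Γ) B),
        Entails (Δ.map fun χ => χ.wk) ((σ.lift C B x).eq (τ.lift C B x)) := by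
    intro Γ Γ' Δ σ τ C h B x
    cases x with
    | zero => exact eqI _
    | succ x => exact (h B x).wk C
  induction t generalizing Γ' with
  | var x => exact h _ x
  | star => exact eqI _
  | zero => exact eqI _
  | top => exact eqI _
  | bot => exact eqI _
  | succ t ih => exact congr (.succ (.var .zero)) (ih h)
  | pair s t ihs iht => exact congr₂ .pair (fun _ _ _ => rfl) (ihs h) (iht h)
  | mem s t ihs iht => exact congr₂ .mem (fun _ _ _ => rfl) (ihs h) (iht h)
  | eq s t ihs iht => exact congr₂ .eq (fun _ _ _ => rfl) (ihs h) (iht h)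
  | and s t ihs iht => exact congr₂ .and (fun _ _ _ => rfl) (ihs h) (iht h)
  | or s t ihs iht => exact congr₂ .or (fun _ _ _ => rfl) (ihs h) (iht h)
  | imp s t ihs iht => exact congr₂ .imp (fun _ _ _ => rfl) (ihs h) (iht h)
  | all B φ ih =>
    have := ih (lift B h)
    exact propExt (impI (all_mono this)) (impI (all_mono this.symm))
  | ex B φ ih =>
    have := ih (lift B h)
    exact propExt (impI (ex_mono this)) (impI (ex_mono this.symm))
  | compr B φ ih =>
    have := ih (lift B h)
    refine setExt (allI (andI (impI ?_) (impI ?_)))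
    · refine comprI ?_
      have h' := comprE (φ := (φ.sub (σ.lift B)).ren (Ren.lift (fun _ x => Var.succ x) B))
        (t := .var .zero) (head (Δ := Δ.map fun χ => χ.wk))
      rw [Tm.wk_lift_inst] at h' ⊢
      exact eqMp (tail this) h'
    · refine comprI ?_
      have h' := comprE (φ := (φ.sub (τ.lift B)).ren (Ren.lift (fun _ x => Var.succ x) B))
        (t := .var .zero) (head (Δ := Δ.map fun χ => χ.wk))
      rw [Tm.wk_lift_inst] at h' ⊢
      exact eqMp (tail this.symm) h'

end Entails


/-! ### Worlds -/

/-- Environments: an element of the carrier for each variable. -/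
abbrev Env (D : Ty → Type) (Γ : Ctx) : Type := (A : Ty) → Var Γ A → D A

/-- The environment of the empty context. -/
def Env.nil {D : Ty → Type} : Env D [] := fun _ x => nomatch x

/-- The environment that has the value `a` at the variable with index zero. -/
def Env.cons {D : Ty → Type} {Γ : Ctx} {A : Ty} (a : D A) (ρ : Env D Γ) : Env D (A :: Γ)
  | _, Var.zero => a
  | _, Var.succ x => ρ _ x

infixr:67 " ∷ " => Env.cons

/-- A world is a prime theory with witnesses that contains Markov's principle, presented by its
elements: `D A` consists of the elements of type `A`, up to provable equality, `ev` evaluates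
terms and `tr` tells which truth values belong to the theory. Conjunctions, disjunctions,
existential statements and equations are true exactly when they are true in the sense of Lean.
Implications and universal statements can only be eliminated in this way. -/
structure World where
  D : Ty → Type
  ev : {Γ : Ctx} → {A : Ty} → Tm Γ A → Env D Γ → D A
  tr : D Ty.prop → Prop
  ev_var {Γ : Ctx} {A : Ty} (x : Var Γ A) (ρ : Env D Γ) : ev (.var x) ρ = ρ A x
  ev_sub {Γ Γ' : Ctx} {A : Ty} (t : Tm Γ A) (σ : Sub Γ Γ') (ρ : Env D Γ') :
    ev (t.sub σ) ρ = ev t (fun _ x => ev (σ _ x) ρ)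
  sound {Γ : Ctx} {Δ : List (Fm Γ)} {φ : Fm Γ} (ρ : Env D Γ) :
    Entails Δ φ → (∀ ψ ∈ Δ, tr (ev ψ ρ)) → tr (ev φ ρ)
  of_or {Γ : Ctx} {φ ψ : Fm Γ} {ρ : Env D Γ} : tr (ev (φ.or ψ) ρ) → tr (ev φ ρ) ∨ tr (ev ψ ρ)
  of_ex {Γ : Ctx} {A : Ty} {φ : Fm (A :: Γ)} {ρ : Env D Γ} :
    tr (ev (.ex A φ) ρ) → ∃ a, tr (ev φ (a ∷ ρ))
  of_eq {Γ : Ctx} {A : Ty} {s t : Tm Γ A} {ρ : Env D Γ} : tr (ev (s.eq t) ρ) → ev s ρ = ev t ρ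
  not_bot {Γ : Ctx} {ρ : Env D Γ} : ¬ tr (ev .bot ρ)
  of_markov : tr (ev markov (Env.nil))

/-- Truth of a formula in an environment. -/
def World.sat (W : World) {Γ : Ctx} (φ : Fm Γ) (ρ : Env W.D Γ) : Prop := W.tr (W.ev φ ρ)

/-- In a classical world, each truth value or its negation is true, so that implications and
negations are those of Lean. Universal statements still can only be eliminated. -/
def World.Classical (W : World) : Prop :=
  ∀ {Γ : Ctx} (φ : Fm Γ) (ρ : Env W.D Γ), W.sat φ ρ ∨ W.sat (neg φ) ρ

/-! ### The completeness theorem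

A sequence of contexts is fixed in which each type occurs infinitely often among the types of the
added variables. Beginning with hypotheses that do not prove `χ`, a formula is added at each step,
if `χ` stays unprovable. It may contain the new variable, which becomes its witness. -/

namespace Henkin

open Filter

/-- A closed term of each type. -/
def dflt {Γ : Ctx} : (A : Ty) → Tm Γ A
  | .one => .star
  | .nat => .zero
  | .prop => .top
  | .prod A B => .pair (dflt A) (dflt B)
  | .pow A => .compr A .top

theorem exists_enumTy : ∃ e : ℕ → Ty, Function.Surjective e :=
  haveI : Nonempty Ty := ⟨.one⟩
  exists_surjective_nat Ty

/-- The type of the variable that is added at step `n`. -/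
noncomputable def ty (n : ℕ) : Ty := exists_enumTy.choose n.unpair.1

variable (Γ : Ctx)

/-- The context at step `n`. -/
@[reducible] noncomputable def ctx : ℕ → Ctx
  | 0 => Γ
  | n + 1 => ty n :: ctx n

variable {Γ}

/-- The inclusion of the context at step `m` in the context at step `n`. -/
noncomputable def up {m n : ℕ} (h : m ≤ n) : Ren (ctx Γ m) (ctx Γ n) :=
  Nat.leRec (motive := fun n _ => Ren (ctx Γ m) (ctx Γ n)) (fun _ x => x)
    (fun _ _ r _ x => Var.succ (r _ x)) h

theorem up_refl (m : ℕ) : up (Γ := Γ) (le_refl m) = fun _ x => x := Nat.leRec_self ..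

theorem up_succ {m n : ℕ} (h : m ≤ n) :
    up (Γ := Γ) (Nat.le_succ_of_le h) = fun _ x => Var.succ (up h _ x) := Nat.leRec_succ ..

variable (Γ) in
theorem exists_enumFm (A : Ty) :
    ∃ e : ℕ → Σ m, Fm (A :: ctx Γ m), Function.Surjective e :=
  haveI : Nonempty (Σ m, Fm (A :: ctx Γ m)) := ⟨⟨0, .top⟩⟩
  exists_surjective_nat _

variable (Γ) in
/-- The formula that is considered at step `n`. -/
noncomputable def cand (n : ℕ) : Fm (ty n :: ctx Γ n) :=
  let p := (exists_enumFm Γ (ty n)).choose n.unpair.2.unpair.1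
  if h : p.1 ≤ n then p.2.ren ((up h).lift _) else .top

/-- Each formula is considered again and again. -/
theorem exists_cand {m : ℕ} {A : Ty} (ψ : Fm (A :: ctx Γ m)) (N : ℕ) :
    ∃ n, ∃ h : m ≤ n, N ≤ n ∧
      (⟨ty n, cand Γ n⟩ : Σ A, Fm (A :: ctx Γ n)) = ⟨A, ψ.ren ((up h).lift A)⟩ := by
  obtain ⟨i, hi⟩ := exists_enumTy.choose_spec A
  obtain ⟨j, hj⟩ := (exists_enumFm Γ A).choose_spec ⟨m, ψ⟩
  obtain ⟨n, hn⟩ : ∃ n, n = Nat.pair i (Nat.pair j (max m N)) := ⟨_, rfl⟩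
  have hle : max m N ≤ n := hn ▸ (Nat.right_le_pair j _).trans (Nat.right_le_pair i _)
  have hm : m ≤ n := (le_max_left _ _).trans hle
  have hA : ty n = A := by rw [ty, hn, Nat.unpair_pair, hi]
  refine ⟨n, hm, (le_max_right _ _).trans hle, ?_⟩
  have key : ∀ B, B = A → ∀ p : Σ m, Fm (B :: ctx Γ m),
      p = (exists_enumFm Γ B).choose j →
      (⟨B, if h : p.1 ≤ n then p.2.ren ((up h).lift _) else .top⟩ :
        Σ A, Fm (A :: ctx Γ n)) = ⟨A, ψ.ren ((up hm).lift A)⟩ := by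
    rintro B rfl p rfl
    rw [hj]
    simp only [hm, dite_true]
  refine key _ hA _ ?_
  rw [hn, Nat.unpair_pair, Nat.unpair_pair]

variable (Δ : List (Fm Γ)) (χ : Fm Γ)

/-- The formula `χ` in the context at step `n`. -/
noncomputable def goal (n : ℕ) : Fm (ctx Γ n) := χ.ren (up n.zero_le)

open Classical in
/-- The hypotheses at step `n`. -/
noncomputable def hyps : (n : ℕ) → List (Fm (ctx Γ n))
  | 0 => Δ
  | n + 1 =>
    if Entails (cand Γ n :: (hyps n).map fun ψ => ψ.wk) (goal χ (n + 1))
    then (hyps n).map fun ψ => ψ.wk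
    else cand Γ n :: (hyps n).map fun ψ => ψ.wk

theorem goal_succ (n : ℕ) : goal χ (n + 1) = (goal χ n).wk := by
  rw [goal, goal, Tm.wk, Tm.ren_ren, up_succ]

theorem wk_mem_hyps {n : ℕ} {φ : Fm (ctx Γ n)} (h : φ ∈ hyps Δ χ n) :
    φ.wk ∈ hyps Δ χ (n + 1) := by
  rw [hyps]
  split_ifs
  · exact List.mem_map_of_mem h
  · exact List.mem_cons_of_mem _ (List.mem_map_of_mem h)

theorem map_wk_subset (n : ℕ) :
    ((hyps Δ χ n).map fun ψ => ψ.wk) ⊆ hyps Δ χ (n + 1) := by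
  intro φ hφ
  obtain ⟨ψ, hψ, rfl⟩ := List.mem_map.1 hφ
  exact wk_mem_hyps Δ χ hψ

variable {Δ χ}

/-- The formula `χ` stays unprovable. -/
theorem not_goal (h : ¬ Entails Δ χ) (n : ℕ) : ¬ Entails (hyps Δ χ n) (goal χ n) := by
  induction n with
  | zero =>
    rw [goal, up_refl]
    rwa [hyps, Tm.ren_eq_sub, Tm.sub_var]
  | succ n ih =>
    rw [hyps]
    split_ifs with h'
    · rw [goal_succ]
      exact fun h => ih (h.unwk (dflt _))
    · exact h'

theorem hyps_step {n : ℕ} {φ : Fm (ctx Γ n)} (h : Entails (hyps Δ χ n) φ) :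
    Entails (hyps Δ χ (n + 1)) φ.wk :=
  (h.wk _).weaken (map_wk_subset Δ χ n)

/-- An existential statement is given a witness when its matrix is considered. -/
theorem cand_witness (hχ : ¬ Entails Δ χ) {n : ℕ}
    (h : Entails (hyps Δ χ n) (.ex _ (cand Γ n))) : Entails (hyps Δ χ (n + 1)) (cand Γ n) := by
  rw [hyps]
  split_ifs with h'
  · rw [goal_succ] at h'
    exact absurd (h.exE h') (not_goal hχ n)
  · exact Entails.head

/-- A formula that is considered and not added implies `χ`. -/
theorem cand_or (n : ℕ) : Entails (hyps Δ χ (n + 1)) (cand Γ n) ∨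
    Entails (hyps Δ χ (n + 1)) ((cand Γ n).imp (goal χ (n + 1))) := by
  by_cases h : Entails (cand Γ n :: (hyps Δ χ n).map fun ψ => ψ.wk) (goal χ (n + 1))
  · exact .inr ((Entails.impI h).weaken (map_wk_subset Δ χ n))
  · refine .inl ?_
    rw [hyps, if_neg h]
    exact Entails.head

/-- Eventually coherent families of terms. They are the terms in the limit of the contexts. -/
@[ext] structure Fam (Γ : Ctx) (A : Ty) where
  val : ∀ n, Tm (ctx Γ n) A
  coh : ∀ᶠ n in atTop, val (n + 1) = (val n).wk

/-- The family of a term at step `m`. -/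
noncomputable def Fam.of {m : ℕ} {A : Ty} (t : Tm (ctx Γ m) A) : Fam Γ A where
  val n := if h : m ≤ n then t.ren (up h) else dflt A
  coh := by
    filter_upwards [eventually_ge_atTop m] with n hn
    rw [dif_pos hn, dif_pos (Nat.le_succ_of_le hn), up_succ hn, Tm.wk, Tm.ren_ren]

theorem Fam.of_val {m : ℕ} {A : Ty} (t : Tm (ctx Γ m) A) : (Fam.of t).val m = t := by
  rw [Fam.of]
  simp only [le_refl, dite_true]
  rw [up_refl, Tm.ren_eq_sub, Tm.sub_var]

theorem coh_up {B : Ty} (p : ∀ n, Tm (B :: ctx Γ n) Ty.prop) {N : ℕ}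
    (hp : ∀ n, N ≤ n → p (n + 1) = (p n).ren (Ren.lift (fun _ x => Var.succ x) B)) {n : ℕ}
    (h : N ≤ n) : p n = (p N).ren ((up h).lift B) := by
  induction n, h using Nat.le_induction with
  | base =>
    rw [up_refl]
    conv_lhs => rw [← (p N).sub_var]
    rw [Tm.ren_eq_sub]
    congr 1
    funext A x
    cases x <;> rfl
  | succ n h ih => rw [hp n h, ih, Tm.ren_ren, Ren.lift_comp, up_succ h]

variable (Δ χ)

/-- A family of formulas that becomes provable. -/
def Holds (p : Fam Γ .prop) : Prop := ∀ᶠ n in atTop, Entails (hyps Δ χ n) (p.val n)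

variable {Δ χ}

theorem Holds.of_frequently {p : Fam Γ .prop}
    (h : ∃ᶠ n in atTop, Entails (hyps Δ χ n) (p.val n)) : Holds Δ χ p := by
  obtain ⟨N, hN⟩ := eventually_atTop.1 p.coh
  obtain ⟨n, hn, h⟩ := frequently_atTop.1 h N
  refine eventually_atTop.2 ⟨n, fun k hk => ?_⟩
  induction k, hk using Nat.le_induction with
  | base => exact h
  | succ k hk ih =>
    rw [hN k (hn.trans hk)]
    exact hyps_step ih

theorem eventually_var {Γ' : Ctx} {P : ∀ A, Var Γ' A → ℕ → Prop}
    (h : ∀ A x, ∀ᶠ n in atTop, P A x n) : ∀ᶠ n in atTop, ∀ A x, P A x n := by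
  induction Γ' with
  | nil => exact Eventually.of_forall fun n A x => nomatch x
  | cons B Γ' ih =>
    filter_upwards [h B .zero, ih fun A x => h A x.succ] with n h0 h1 A x
    cases x with
    | zero => exact h0
    | succ x => exact h1 A x

/-- Substitution of families. -/
noncomputable def Fam.sub {Γ' : Ctx} {A : Ty} (t : Tm Γ' A) (r : ∀ A, Var Γ' A → Fam Γ A) :
    Fam Γ A where
  val n := t.sub fun A x => (r A x).val n
  coh := by
    filter_upwards [eventually_var fun A x => (r A x).coh] with n hn
    rw [Tm.wk, Tm.ren_sub]
    congr 1
    funext A x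
    exact hn A x

variable (Δ χ)

/-- Families are identified if they become provably equal. -/
def setoid (A : Ty) : Setoid (Fam Γ A) where
  r s t := ∀ᶠ n in atTop, Entails (hyps Δ χ n) ((s.val n).eq (t.val n))
  iseqv :=
    { refl := fun _ => Eventually.of_forall fun _ => .eqI _
      symm := fun h => h.mono fun _ h => h.symm
      trans := fun h h' => (h.and h').mono fun _ h => h.1.trans h.2 }

/-- The elements of type `A`. -/
def D (A : Ty) : Type := Quotient (setoid Δ χ A)

variable {Δ χ}

/-- A family that represents an element. -/
noncomputable def D.rep {A : Ty} (d : D Δ χ A) : Fam Γ A := d.out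

/-- The element represented by a family. -/
def D.mk {A : Ty} (s : Fam Γ A) : D Δ χ A := Quotient.mk (setoid Δ χ A) s

theorem D.mk_rep {A : Ty} (d : D Δ χ A) : D.mk d.rep = d := Quotient.out_eq d

theorem D.mk_eq {A : Ty} {s t : Fam Γ A} : (D.mk s : D Δ χ A) = D.mk t ↔
    ∀ᶠ n in atTop, Entails (hyps Δ χ n) ((s.val n).eq (t.val n)) :=
  Quotient.eq (r := setoid Δ χ A)

/-- Evaluation of terms. -/
noncomputable def eval {Γ' : Ctx} {A : Ty} (t : Tm Γ' A) (ρ : Env (D Δ χ) Γ') : D Δ χ A :=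
  D.mk (Fam.sub t fun A x => (ρ A x).rep)

/-- The truth values that become provable. -/
def tr (d : D Δ χ .prop) : Prop := Holds Δ χ d.rep

theorem eval_eq {Γ' : Ctx} {A : Ty} (t : Tm Γ' A) (r : ∀ A, Var Γ' A → Fam Γ A) :
    eval t (fun A x => D.mk (r A x)) = (D.mk (Fam.sub t r) : D Δ χ A) := by
  refine D.mk_eq.2 ?_
  have : ∀ A x, ∀ᶠ n in atTop,
      Entails (hyps Δ χ n) (((D.mk (r A x) : D Δ χ A).rep.val n).eq ((r A x).val n)) :=
    fun A x => D.mk_eq.1 (D.mk_rep _)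
  filter_upwards [eventually_var this] with n hn
  exact Entails.sub_congr t hn

theorem tr_mk (p : Fam Γ .prop) : tr (D.mk p : D Δ χ .prop) ↔ Holds Δ χ p := by
  have h := D.mk_eq.1 (D.mk_rep (D.mk p : D Δ χ .prop))
  constructor <;> intro h'
  · filter_upwards [h, h'] with n h h'
    exact h.eqMp h'
  · filter_upwards [h, h'] with n h h'
    exact h.symm.eqMp h'

theorem tr_eval {Γ' : Ctx} (φ : Fm Γ') (ρ : Env (D Δ χ) Γ') : tr (eval φ ρ) ↔
    ∀ᶠ n in atTop, Entails (hyps Δ χ n) (φ.sub fun A x => (ρ A x).rep.val n) :=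
  tr_mk _

/-- A formula becomes provable, or it becomes provable that it implies `χ`. -/
theorem tr_or_imp (p : Fam Γ .prop) : Holds Δ χ p ∨
    ∀ᶠ n in atTop, Entails (hyps Δ χ n) ((p.val n).imp (goal χ n)) := by
  obtain ⟨N, hN⟩ := eventually_atTop.1 p.coh
  have hp : ∀ n, N ≤ n → p.val (n + 1) = (p.val n).wk := hN
  obtain ⟨n, h, -, e⟩ := exists_cand (A := .one) ((p.val N).wk) 0
  have e' : (p.val n).wk = ((p.val N).wk (B := .one)).ren ((up h).lift .one) :=
    coh_up (fun n => (p.val n).wk) (fun n h => by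
      simp only [hp n h, Tm.wk, Tm.ren_ren]
      rfl) h
  rw [← e'] at e
  -- The type of the new variable is only propositionally `one`, so the equation is transported.
  have key : ∀ q : Σ A, Fm (A :: ctx Γ n), q = ⟨.one, (p.val n).wk⟩ →
      q.2 = (p.val n).wk := by
    rintro q rfl
    rfl
  have e1 : cand Γ n = (p.val n).wk := key ⟨ty n, cand Γ n⟩ e
  have := cand_or (Δ := Δ) (χ := χ) n
  rw [e1] at this
  rcases this with h1 | h1
  · refine .inl (eventually_atTop.2 ⟨n + 1, fun k hk => ?_⟩)
    induction k, hk using Nat.le_induction with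
    | base => rw [hp n h]; exact h1
    | succ k hk ih => rw [hp k (h.trans (Nat.le_of_succ_le hk))]; exact hyps_step ih
  · refine .inr (eventually_atTop.2 ⟨n + 1, fun k hk => ?_⟩)
    induction k, hk using Nat.le_induction with
    | base => rw [hp n h]; exact h1
    | succ k hk ih =>
      rw [hp k (h.trans (Nat.le_of_succ_le hk)), goal_succ]
      exact hyps_step ih

/-- An existential statement that becomes provable has a witness, which is the variable that is
added when the matrix is considered. -/
theorem exists_witness (hχ : ¬ Entails Δ χ) {Γ' : Ctx} {A : Ty} (φ : Fm (A :: Γ'))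
    (r : ∀ A, Var Γ' A → Fam Γ A)
    (h : ∀ᶠ n in atTop, Entails (hyps Δ χ n) ((Tm.ex A φ).sub fun A x => (r A x).val n)) :
    ∃ a : Fam Γ A, Holds Δ χ (Fam.sub φ (Env.cons a r)) := by
  let p : ∀ n, Tm (A :: ctx Γ n) Ty.prop := fun n =>
    φ.sub (Sub.lift (fun A x => (r A x).val n) A)
  obtain ⟨N, hN⟩ := eventually_atTop.1 (h.and (eventually_var fun A x => (r A x).coh))
  have hp : ∀ n, N ≤ n → p (n + 1) = (p n).ren (Ren.lift (fun _ x => Var.succ x) A) := by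
    intro n hn
    simp only [p]
    rw [Tm.ren_sub, Sub.ren_lift]
    congr 2
    funext B x
    exact (hN n hn).2 B x
  obtain ⟨n, h, -, e⟩ := exists_cand (p N) 0
  rw [← coh_up p hp h] at e
  have key : ∀ q : Σ A, Fm (A :: ctx Γ n), q = ⟨ty n, cand Γ n⟩ →
      Entails (hyps Δ χ n) (.ex _ q.2) → ∃ t : Tm (ctx Γ (n + 1)) q.1,
        Entails (hyps Δ χ (n + 1)) ((q.2.ren (Ren.lift (fun _ x => Var.succ x) q.1)).inst t) := by
    rintro q rfl hq
    refine ⟨.var .zero, ?_⟩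
    rw [Tm.wk_lift_inst]
    exact cand_witness hχ hq
  obtain ⟨t, ht⟩ := key ⟨A, p n⟩ e.symm (hN n h).1
  change Entails _ (((p n).ren (Ren.lift (fun _ x => Var.succ x) A)).inst t) at ht
  rw [← hp n h, Tm.sub_lift_inst] at ht
  refine ⟨Fam.of t, eventually_atTop.2 ⟨n + 1, fun k hk => ?_⟩⟩
  have hc : ∀ k, n + 1 ≤ k → (Fam.of t).val (k + 1) = ((Fam.of t).val k).wk := by
    intro k hk
    rw [Fam.of]
    simp only
    rw [dif_pos hk, dif_pos (Nat.le_succ_of_le hk), up_succ hk, Tm.wk, Tm.ren_ren]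
  induction k, hk using Nat.le_induction with
  | base =>
    refine (congrArg (Entails _) ?_).mpr ht
    refine congrArg φ.sub ?_
    funext B x
    cases x with
    | zero => exact Fam.of_val t
    | succ x => rfl
  | succ k hk ih =>
    convert hyps_step ih using 1
    simp only [Fam.sub, Tm.wk, Tm.ren_sub]
    congr 1
    funext B x
    cases x with
    | zero => exact hc k hk
    | succ x => exact (hN k (h.trans (Nat.le_of_succ_le hk))).2 B x

theorem holds_hyps {φ : Fm Γ} (h : Entails Δ φ) :
    tr (eval φ (fun _ x => D.mk (Fam.of (m := 0) (.var x))) : D Δ χ .prop) := by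
  rw [eval_eq, tr_mk]
  refine Holds.of_frequently (Eventually.frequently ?_)
  refine eventually_atTop.2 ⟨0, fun n _ => ?_⟩
  have : (Fam.sub φ fun A x => Fam.of (m := 0) (.var x)).val n = φ.ren (up n.zero_le) := by
    simp only [Fam.sub, Fam.of, Nat.zero_le, dite_true, Tm.ren]
    exact (Tm.ren_eq_sub _ _).symm
  rw [this]
  induction n with
  | zero =>
    rw [up_refl, Tm.ren_eq_sub, Tm.sub_var]
    exact h
  | succ n ih =>
    have := hyps_step (ih (Nat.zero_le _) (by
      simp only [Fam.sub, Fam.of, Nat.zero_le, dite_true, Tm.ren]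
      exact (Tm.ren_eq_sub _ _).symm))
    rwa [Tm.wk, Tm.ren_ren] at this

theorem not_holds_goal (hχ : ¬ Entails Δ χ) :
    ¬ tr (eval χ (fun _ x => D.mk (Fam.of (m := 0) (.var x))) : D Δ χ .prop) := by
  intro h
  rw [eval_eq, tr_mk] at h
  obtain ⟨n, hn⟩ := h.exists
  refine not_goal hχ n ?_
  have : (Fam.sub χ fun A x => Fam.of (m := 0) (.var x)).val n = χ.ren (up n.zero_le) := by
    simp only [Fam.sub, Fam.of, Nat.zero_le, dite_true, Tm.ren]
    exact (Tm.ren_eq_sub _ _).symm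
  rwa [this] at hn

/-- The world that the sequence of hypotheses defines. -/
noncomputable def world (hχ : ¬ Entails Δ χ) (hΔ : Entails Δ markov) : World where
  D := D Δ χ
  ev := eval
  tr := tr
  ev_var x ρ := D.mk_rep (ρ _ x)
  ev_sub t σ ρ := by
    refine Eq.trans (congrArg D.mk (Fam.ext ?_)) (eval_eq t _).symm
    funext n
    exact Tm.sub_sub t σ _
  sound {Γ' Δ' φ} ρ h hψ := by
    rw [tr_eval]
    have : ∀ Δ'' ⊆ Δ', ∀ᶠ n in atTop, ∀ ψ ∈ Δ'',
        Entails (hyps Δ χ n) (ψ.sub fun A x => (ρ A x).rep.val n) := by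
      intro Δ''
      induction Δ'' with
      | nil => exact fun _ => Eventually.of_forall fun n ψ hψ => nomatch hψ
      | cons ψ Δ'' ih =>
        intro hs
        filter_upwards [ih fun _ h => hs (List.mem_cons_of_mem _ h),
          (tr_eval ψ ρ).1 (hψ ψ (hs List.mem_cons_self))] with n h1 h2 ψ' hψ'
        rcases List.mem_cons.1 hψ' with rfl | h
        exacts [h2, h1 _ h]
    filter_upwards [this Δ' (List.Subset.refl _)] with n hn
    refine (h.subst _).cuts fun ψ hψ => ?_
    obtain ⟨ψ', hψ', rfl⟩ := List.mem_map.1 hψ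
    exact hn ψ' hψ'
  of_or {Γ' φ ψ ρ} h := by
    rw [tr_eval] at h
    rcases tr_or_imp (Δ := Δ) (χ := χ) (Fam.sub φ fun A x => (ρ A x).rep) with h1 | h1
    · exact .inl ((tr_mk _).2 h1)
    rcases tr_or_imp (Δ := Δ) (χ := χ) (Fam.sub ψ fun A x => (ρ A x).rep) with h2 | h2
    · exact .inr ((tr_mk _).2 h2)
    obtain ⟨n, h, h1, h2⟩ := (h.and (h1.and h2)).exists
    exact absurd (h.orE (h1.tail.impE .head) (h2.tail.impE .head)) (not_goal hχ n)
  of_ex {Γ' A φ ρ} h := by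
    obtain ⟨a, ha⟩ := exists_witness hχ φ (fun A x => (ρ A x).rep) ((tr_eval _ _).1 h)
    refine ⟨D.mk a, ?_⟩
    have : (Env.cons (D.mk a) ρ : Env (D Δ χ) (A :: Γ')) =
        fun B x => D.mk ((Env.cons a fun A x => (ρ A x).rep : ∀ B, Var (A :: Γ') B → Fam Γ B)
          B x) := by
      funext B x
      cases x with
      | zero => rfl
      | succ x => exact (D.mk_rep _).symm
    rw [this, eval_eq, tr_mk]
    exact ha
  of_eq h := D.mk_eq.2 ((tr_eval _ _).1 h)
  not_bot h := by
    obtain ⟨n, hn⟩ := ((tr_eval _ _).1 h).exists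
    exact not_goal hχ n (.botE hn)
  of_markov := by
    refine (tr_eval _ _).2 ?_
    filter_upwards [(tr_eval _ _).1 (holds_hyps hΔ)] with n hn
    exact hn

end Henkin

/-- A formula that is true in all worlds that satisfy the hypotheses is provable. -/
theorem World.complete {Γ : Ctx} {Δ : List (Fm Γ)} {χ : Fm Γ}
    (h : ∀ (W : World) (ρ : Env W.D Γ), (∀ ψ ∈ Δ, W.sat ψ ρ) → W.sat χ ρ) :
    Entails (markov :: Δ) χ := by
  by_contra hχ
  refine Henkin.not_holds_goal hχ (h (Henkin.world hχ .head)
    (fun _ x => Henkin.D.mk (Henkin.Fam.of (m := 0) (.var x))) fun ψ hψ => ?_)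
  exact Henkin.holds_hyps (.hyp (List.mem_cons_of_mem _ hψ))

/-- Hypotheses that hold in no classical world are contradictory, because the construction for
`χ = ⊥` adds each formula or makes its negation provable. -/
theorem World.complete_classical {Γ : Ctx} {Δ : List (Fm Γ)}
    (h : ∀ (W : World) (ρ : Env W.D Γ), W.Classical → ¬ ∀ ψ ∈ Δ, W.sat ψ ρ) :
    Entails (markov :: Δ) .bot := by
  by_contra hχ
  refine h (Henkin.world hχ .head)
    (fun _ x => Henkin.D.mk (Henkin.Fam.of (m := 0) (.var x))) ?_ fun ψ hψ => ?_
  · intro Γ' φ ρ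
    rcases Henkin.tr_or_imp (Δ := markov :: Δ) (χ := .bot)
      (Henkin.Fam.sub φ fun A x => (ρ A x).rep) with h1 | h1
    · exact .inl ((Henkin.tr_mk _).2 h1)
    · exact .inr ((Henkin.tr_mk _).2 h1)
  · exact Henkin.holds_hyps (.hyp (List.mem_cons_of_mem _ hψ))


/-! ### Truth in worlds -/

@[simp] theorem Env.cons_zero {D : Ty → Type} {Γ : Ctx} {A : Ty} (a : D A) (ρ : Env D Γ) :
    (a ∷ ρ) A .zero = a := rfl

@[simp] theorem Env.cons_succ {D : Ty → Type} {Γ : Ctx} {A B : Ty} (a : D A) (ρ : Env D Γ)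
    (x : Var Γ B) : (a ∷ ρ) B (.succ x) = ρ B x := rfl

theorem Env.exists_cons {D : Ty → Type} {Γ : Ctx} {A : Ty} (ρ : Env D (A :: Γ)) :
    ∃ a ρ', ρ = a ∷ ρ' := by
  refine ⟨ρ _ .zero, fun _ x => ρ _ x.succ, ?_⟩
  funext B x
  cases x <;> rfl

theorem Env.eq_nil {D : Ty → Type} (ρ : Env D []) : ρ = Env.nil := by
  funext B x
  cases x

namespace World

variable {W : World} {Γ : Ctx} {A B : Ty}

/-- Membership of elements. -/
def Mem (W : World) {A : Ty} (a : W.D A) (u : W.D (.pow A)) : Prop :=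
  W.sat (.mem v0 v1) (a ∷ u ∷ Env.nil)

/-- Pairs of elements. -/
def P (W : World) {A B : Ty} (a : W.D A) (b : W.D B) : W.D (.prod A B) :=
  W.ev (.pair v0 v1) (a ∷ b ∷ Env.nil)

/-- The number zero in a world. -/
def Z (W : World) : W.D .nat := W.ev .zero Env.nil

/-- The successor function in a world. -/
def S (W : World) (n : W.D .nat) : W.D .nat := W.ev (.succ v0) (n ∷ Env.nil)

attribute [simp] ev_var

/-- Two variables are replaced by two terms. -/
theorem ev_two {C : Ty} (t : Tm [A, B] C) (s : Tm Γ A) (s' : Tm Γ B) (ρ : Env W.D Γ) :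
    W.ev (t.sub (Sub.cons s (Sub.cons s' fun _ x => nomatch x))) ρ =
      W.ev t (W.ev s ρ ∷ W.ev s' ρ ∷ Env.nil) := by
  rw [ev_sub]
  congr 1
  funext C x
  rcases x with _ | _ | x
  · rfl
  · rfl
  · cases x

theorem ev_one {C : Ty} (t : Tm [A] C) (s : Tm Γ A) (ρ : Env W.D Γ) :
    W.ev (t.sub (Sub.cons s fun _ x => nomatch x)) ρ = W.ev t (W.ev s ρ ∷ Env.nil) := by
  rw [ev_sub]
  congr 1
  funext C x
  rcases x with _ | x
  · rfl
  · cases x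

theorem sat_one (φ : Fm [A]) (s : Tm Γ A) (ρ : Env W.D Γ) :
    W.sat (φ.sub (Sub.cons s fun _ x => nomatch x)) ρ ↔ W.sat φ (W.ev s ρ ∷ Env.nil) :=
  iff_of_eq (congrArg W.tr (ev_one φ s ρ))

theorem ev_three {C E : Ty} (t : Tm [A, B, C] E) (s : Tm Γ A) (s' : Tm Γ B) (s'' : Tm Γ C)
    (ρ : Env W.D Γ) :
    W.ev (t.sub (Sub.cons s (Sub.cons s' (Sub.cons s'' fun _ x => nomatch x)))) ρ =
      W.ev t (W.ev s ρ ∷ W.ev s' ρ ∷ W.ev s'' ρ ∷ Env.nil) := by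
  rw [ev_sub]
  congr 1
  funext C x
  rcases x with _ | _ | _ | x
  · rfl
  · rfl
  · rfl
  · cases x

theorem sat_three {E : Ty} (φ : Fm [A, B, E]) (s : Tm Γ A) (s' : Tm Γ B) (s'' : Tm Γ E)
    (ρ : Env W.D Γ) :
    W.sat (φ.sub (Sub.cons s (Sub.cons s' (Sub.cons s'' fun _ x => nomatch x)))) ρ ↔
      W.sat φ (W.ev s ρ ∷ W.ev s' ρ ∷ W.ev s'' ρ ∷ Env.nil) :=
  iff_of_eq (congrArg W.tr (ev_three φ s s' s'' ρ))

theorem sat_four {C E : Ty} (φ : Fm [A, B, C, E]) (s : Tm Γ A) (s' : Tm Γ B) (t : Tm Γ C)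
    (t' : Tm Γ E) (ρ : Env W.D Γ) :
    W.sat (φ.sub (Sub.cons s (Sub.cons s' (Sub.cons t (Sub.cons t' fun _ x => nomatch x))))) ρ ↔
      W.sat φ (W.ev s ρ ∷ W.ev s' ρ ∷ W.ev t ρ ∷ W.ev t' ρ ∷ Env.nil) := by
  rw [sat, ev_sub]
  refine iff_of_eq (congrArg W.tr (congrArg (W.ev φ) ?_))
  funext C x
  rcases x with _ | _ | _ | _ | x
  · rfl
  · rfl
  · rfl
  · rfl
  · cases x

theorem ev_closed {C : Ty} (t : Tm [] C) (ρ : Env W.D Γ) :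
    W.ev (t.sub fun _ x => nomatch x) ρ = W.ev t Env.nil := by
  rw [ev_sub]
  congr 1
  funext C x
  cases x

@[simp] theorem ev_wk (t : Tm Γ A) (b : W.D B) (ρ : Env W.D Γ) :
    W.ev t.wk (b ∷ ρ) = W.ev t ρ := by
  rw [Tm.wk, Tm.ren_eq_sub, ev_sub]
  congr 1
  funext C x
  exact W.ev_var _ _

@[simp] theorem sat_wk (φ : Fm Γ) (b : W.D B) (ρ : Env W.D Γ) :
    W.sat φ.wk (b ∷ ρ) ↔ W.sat φ ρ := by
  rw [sat, sat, ev_wk]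

@[simp] theorem ev_pair (s : Tm Γ A) (t : Tm Γ B) (ρ : Env W.D Γ) :
    W.ev (.pair s t) ρ = W.P (W.ev s ρ) (W.ev t ρ) := ev_two (.pair v0 v1) s t ρ

@[simp] theorem ev_zero (ρ : Env W.D Γ) : W.ev .zero ρ = W.Z := ev_closed .zero ρ

@[simp] theorem ev_succ (t : Tm Γ .nat) (ρ : Env W.D Γ) :
    W.ev (.succ t) ρ = W.S (W.ev t ρ) := ev_one (.succ v0) t ρ

@[simp] theorem ev_numeral_one (ρ : Env W.D Γ) : W.ev one ρ = W.S W.Z := by simp [one]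

@[simp] theorem sat_mem (t : Tm Γ A) (u : Tm Γ (.pow A)) (ρ : Env W.D Γ) :
    W.sat (.mem t u) ρ ↔ W.Mem (W.ev t ρ) (W.ev u ρ) := by
  rw [sat, Mem, sat, ← ev_two (.mem v0 v1) t u ρ]
  rfl

theorem sat_of_entails {φ : Fm Γ} (ψ : Fm Γ) (h : Entails [ψ] φ) {ρ : Env W.D Γ}
    (hψ : W.sat ψ ρ) : W.sat φ ρ :=
  W.sound ρ h fun _ h => List.mem_singleton.1 h ▸ hψ

theorem sat_of_entails₂ {φ : Fm Γ} (ψ χ : Fm Γ) (h : Entails [ψ, χ] φ) {ρ : Env W.D Γ}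
    (hψ : W.sat ψ ρ) (hχ : W.sat χ ρ) : W.sat φ ρ :=
  W.sound ρ h (by simpa using ⟨hψ, hχ⟩)

theorem sat_of_valid {φ : Fm Γ} (h : Entails [] φ) (ρ : Env W.D Γ) : W.sat φ ρ :=
  W.sound ρ h (by simp)

@[simp] theorem sat_top (ρ : Env W.D Γ) : W.sat .top ρ := sat_of_valid .topI ρ

@[simp] theorem sat_and (φ ψ : Fm Γ) (ρ : Env W.D Γ) :
    W.sat (φ.and ψ) ρ ↔ W.sat φ ρ ∧ W.sat ψ ρ :=
  ⟨fun h => ⟨sat_of_entails _ (.andE₁ .head) h, sat_of_entails _ (.andE₂ .head) h⟩,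
    fun h => sat_of_entails₂ _ _ (.andI .head (.tail .head)) h.1 h.2⟩

@[simp] theorem sat_or (φ ψ : Fm Γ) (ρ : Env W.D Γ) :
    W.sat (φ.or ψ) ρ ↔ W.sat φ ρ ∨ W.sat ψ ρ :=
  ⟨W.of_or, fun h => h.elim (sat_of_entails _ (.orI₁ .head)) (sat_of_entails _ (.orI₂ .head))⟩

@[simp] theorem sat_ex (φ : Fm (A :: Γ)) (ρ : Env W.D Γ) :
    W.sat (.ex A φ) ρ ↔ ∃ a, W.sat φ (a ∷ ρ) := by
  refine ⟨W.of_ex, fun ⟨a, ha⟩ => ?_⟩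
  have : Entails [φ] (Tm.ex A φ).wk :=
    .exI (φ := φ.ren (Ren.lift (fun _ x => Var.succ x) A)) (.var .zero)
      (by rw [Tm.wk_lift_inst]; exact .head)
  exact (sat_wk _ a ρ).1 (sat_of_entails _ this ha)

@[simp] theorem sat_eq (s t : Tm Γ A) (ρ : Env W.D Γ) :
    W.sat (s.eq t) ρ ↔ W.ev s ρ = W.ev t ρ := by
  refine ⟨W.of_eq, fun h => ?_⟩
  have h1 := W.sat_of_valid (.eqI s) ρ
  rw [sat] at h1 ⊢
  have e : ∀ t : Tm Γ A, W.ev (s.eq t) ρ = W.ev (Tm.eq v0 v1) (W.ev s ρ ∷ W.ev t ρ ∷ Env.nil) :=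
    fun t => ev_two (Tm.eq v0 v1) s t ρ
  rw [e] at h1 ⊢
  rwa [← h]

theorem sat_imp {φ ψ : Fm Γ} {ρ : Env W.D Γ} (h : W.sat (φ.imp ψ) ρ) (h' : W.sat φ ρ) :
    W.sat ψ ρ :=
  sat_of_entails₂ _ _ (.impE .head (.tail .head)) h h'

theorem sat_neg {φ : Fm Γ} {ρ : Env W.D Γ} (h : W.sat (neg φ) ρ) : ¬ W.sat φ ρ :=
  fun h' => W.not_bot (sat_imp h h')

theorem sat_all {φ : Fm (A :: Γ)} {ρ : Env W.D Γ} (h : W.sat (.all A φ) ρ) (a : W.D A) :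
    W.sat φ (a ∷ ρ) :=
  sat_of_entails (.wk (.all A φ)) (Entails.all_sub_var (Δ := [.all A φ]) .head)
    ((sat_wk _ a ρ).2 h)

theorem sat_allIn {X : Tm Γ (.pow A)} {φ : Fm (A :: Γ)} {ρ : Env W.D Γ}
    (h : W.sat (allIn X φ) ρ) {a : W.D A} (ha : W.Mem a (W.ev X ρ)) : W.sat φ (a ∷ ρ) :=
  sat_imp (sat_all h a) (by simpa)

@[simp] theorem sat_exIn (X : Tm Γ (.pow A)) (φ : Fm (A :: Γ)) (ρ : Env W.D Γ) :
    W.sat (exIn X φ) ρ ↔ ∃ a, W.Mem a (W.ev X ρ) ∧ W.sat φ (a ∷ ρ) := by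
  simp [exIn]

@[simp] theorem mem_compr (φ : Fm (A :: Γ)) (a : W.D A) (ρ : Env W.D Γ) :
    W.Mem a (W.ev (.compr A φ) ρ) ↔ W.sat φ (a ∷ ρ) := by
  have e : W.Mem a (W.ev (.compr A φ) ρ) ↔
      W.sat (.mem v0 (Tm.wk (.compr A φ))) (a ∷ ρ) := by simp
  rw [e]
  have h : (φ.ren (Ren.lift (fun _ x => Var.succ x) A)).inst (.var .zero) = φ :=
    Tm.wk_lift_inst φ
  constructor
  · refine sat_of_entails _ ?_
    have := Entails.comprE (φ := φ.ren (Ren.lift (fun _ x => Var.succ x) A)) (t := v0)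
      (Entails.head (Δ := []))
    rwa [h] at this
  · refine sat_of_entails _ (.comprI (φ := φ.ren (Ren.lift (fun _ x => Var.succ x) A)) ?_)
    rw [h]
    exact .head

theorem exists_P (p : W.D (.prod A B)) : ∃ a b, p = W.P a b := by
  simpa using W.sat_of_valid (.pairEta v0) (p ∷ Env.nil)

@[simp] theorem P_inj {a a' : W.D A} {b b' : W.D B} :
    W.P a b = W.P a' b' ↔ a = a' ∧ b = b' := by
  refine ⟨fun h => ?_, fun ⟨h, h'⟩ => h ▸ h' ▸ rfl⟩
  have h1 : W.sat (.eq (.pair v0 v1) (.pair v2 v3)) (a ∷ b ∷ a' ∷ b' ∷ Env.nil) := by simpa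
  have h2 := sat_of_entails _ (Entails.pairInj₁ (Entails.head (Δ := []))) h1
  have h3 := sat_of_entails _ (Entails.pairInj₂ (Entails.head (Δ := []))) h1
  simp only [sat_eq, ev_var, Env.cons_zero, Env.cons_succ] at h2 h3
  exact ⟨h2, h3⟩

@[simp] theorem S_ne_Z (n : W.D .nat) : W.S n ≠ W.Z := by
  intro h
  have h1 : W.sat (.eq (.succ v0) .zero) (n ∷ Env.nil) := by simpa
  exact W.not_bot (sat_of_entails _ (Entails.succNeZero (Entails.head (Δ := []))) h1)

@[simp] theorem Z_ne_S (n : W.D .nat) : W.Z ≠ W.S n := (S_ne_Z n).symm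

@[simp] theorem S_inj {m n : W.D .nat} : W.S m = W.S n ↔ m = n := by
  refine ⟨fun h => ?_, fun h => h ▸ rfl⟩
  have h1 : W.sat (.eq (.succ v0) (.succ v1)) (m ∷ n ∷ Env.nil) := by simpa
  have h2 := sat_of_entails _ (Entails.succInj (Entails.head (Δ := []))) h1
  simpa using h2

theorem sat_markov (ρ : Env W.D Γ) : W.sat markov ρ :=
  (congrArg W.tr (ev_closed markov ρ)).mpr W.of_markov

/-! ### Introduction rules

An implication or a universal statement holds in a world if a formula `κ` holds there that entails
it, that is, if in all worlds where `κ` holds the statement is true in the sense of Lean. -/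

theorem imp_intro (κ : Fm Γ) {φ ψ : Fm Γ}
    (h : ∀ (W : World) (ρ : Env W.D Γ), W.sat κ ρ → W.sat φ ρ → W.sat ψ ρ)
    {ρ : Env W.D Γ} (hκ : W.sat κ ρ) : W.sat (φ.imp ψ) ρ := by
  have : Entails (markov :: [φ, κ]) ψ := complete fun W ρ hΔ => by
    simp only [List.mem_cons, List.not_mem_nil, or_false, forall_eq_or_imp, forall_eq] at hΔ
    exact h W ρ hΔ.2 hΔ.1
  refine sat_of_entails₂ _ _ (.impI (.weaken ?_ this)) (sat_markov ρ) hκ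
  intro χ hχ
  simp only [List.mem_cons] at hχ ⊢
  tauto

theorem neg_intro (κ : Fm Γ) {φ : Fm Γ}
    (h : ∀ (W : World) (ρ : Env W.D Γ), W.sat κ ρ → ¬ W.sat φ ρ)
    {ρ : Env W.D Γ} (hκ : W.sat κ ρ) : W.sat (neg φ) ρ :=
  imp_intro κ (fun W ρ hκ hφ => absurd hφ (h W ρ hκ)) hκ

theorem all_intro (κ : Fm Γ) {φ : Fm (A :: Γ)}
    (h : ∀ (W : World) (ρ : Env W.D Γ), W.sat κ ρ → ∀ a, W.sat φ (a ∷ ρ))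
    {ρ : Env W.D Γ} (hκ : W.sat κ ρ) : W.sat (.all A φ) ρ := by
  have : Entails (markov :: [κ.wk]) φ := complete fun W ρ hΔ => by
    simp only [List.mem_cons, List.not_mem_nil, or_false, forall_eq] at hΔ
    obtain ⟨a, ρ, rfl⟩ := ρ.exists_cons
    exact h W ρ ((sat_wk _ _ _).1 hΔ) a
  exact sat_of_entails₂ markov κ (.allI this) (sat_markov ρ) hκ

theorem allIn_intro (κ : Fm Γ) {X : Tm Γ (.pow A)} {φ : Fm (A :: Γ)}
    (h : ∀ (W : World) (ρ : Env W.D Γ), W.sat κ ρ → ∀ a, W.Mem a (W.ev X ρ) → W.sat φ (a ∷ ρ))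
    {ρ : Env W.D Γ} (hκ : W.sat κ ρ) : W.sat (allIn X φ) ρ :=
  all_intro κ (fun W ρ hκ a => imp_intro (κ.wk) (fun W ρ hκ ha => by
    obtain ⟨a, ρ, rfl⟩ := ρ.exists_cons
    exact h W ρ ((sat_wk _ _ _).1 hκ) a (by simpa using ha)) ((sat_wk _ _ _).2 hκ)) hκ

/-- Double negations of `χ` are proved in classical worlds. -/
theorem neg_neg_intro (κ : Fm Γ) {χ : Fm Γ}
    (h : ∀ (W : World) (ρ : Env W.D Γ), W.Classical → W.sat κ ρ → W.sat χ ρ)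
    {ρ : Env W.D Γ} (hκ : W.sat κ ρ) : W.sat (neg (neg χ)) ρ := by
  have : Entails (markov :: [neg χ, κ]) .bot := complete_classical fun W ρ hW hΔ => by
    simp only [List.mem_cons, List.not_mem_nil, or_false, forall_eq_or_imp, forall_eq] at hΔ
    exact sat_neg hΔ.1 (h W ρ hW hΔ.2)
  refine sat_of_entails₂ _ _ (.impI (.weaken ?_ this)) (sat_markov ρ) hκ
  intro χ hχ
  simp only [List.mem_cons] at hχ ⊢
  tauto

theorem neg_neg_mono {φ ψ : Fm Γ} (h : ∀ (W : World) (ρ : Env W.D Γ), W.sat φ ρ → W.sat ψ ρ)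
    {ρ : Env W.D Γ} (hφ : W.sat (neg (neg φ)) ρ) : W.sat (neg (neg ψ)) ρ :=
  neg_intro (neg (neg φ)) (fun _ _ h1 h2 => sat_neg h1
    (neg_intro (neg ψ) (fun _ _ h3 h4 => sat_neg h3 (h _ _ h4)) h2)) hφ

theorem Classical.sat_neg_iff (hW : W.Classical) {φ : Fm Γ} {ρ : Env W.D Γ} :
    W.sat (neg φ) ρ ↔ ¬ W.sat φ ρ :=
  ⟨sat_neg, fun h => (hW φ ρ).resolve_left h⟩

theorem Classical.sat_imp_iff (hW : W.Classical) {φ ψ : Fm Γ} {ρ : Env W.D Γ} :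
    W.sat (φ.imp ψ) ρ ↔ (W.sat φ ρ → W.sat ψ ρ) := by
  refine ⟨sat_imp, fun h => ?_⟩
  rcases hW φ ρ with h' | h'
  · exact sat_of_entails _ (.impI (.tail .head)) (h h')
  · exact sat_of_entails _ (.impI (.botE (.impE (.tail .head) .head))) h'

/-- A negation may be proved in classical worlds. -/
theorem neg_intro' (κ : Fm Γ) {φ : Fm Γ}
    (h : ∀ (W : World) (ρ : Env W.D Γ), W.Classical → W.sat κ ρ → ¬ W.sat φ ρ)
    {ρ : Env W.D Γ} (hκ : W.sat κ ρ) : W.sat (neg φ) ρ := by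
  have := neg_neg_intro (χ := neg φ) κ (fun W ρ hW hκ => hW.sat_neg_iff.2 (h W ρ hW hκ)) hκ
  exact sat_of_entails _ (.impI (.impE (.tail .head) (.impI (.impE .head (.tail .head))))) this

/-- Extensionality of sets. -/
theorem ext_intro (κ : Fm Γ) {u v : Tm Γ (.pow A)}
    (h : ∀ (W : World) (ρ : Env W.D Γ), W.sat κ ρ →
      ∀ a, W.Mem a (W.ev u ρ) ↔ W.Mem a (W.ev v ρ))
    {ρ : Env W.D Γ} (hκ : W.sat κ ρ) : W.ev u ρ = W.ev v ρ := by
  refine (sat_eq _ _ _).1 (sat_of_entails _ (.setExt .head) (all_intro κ ?_ hκ))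
  intro W ρ hκ a
  refine (sat_and _ _ _).2 ⟨imp_intro κ.wk ?_ ((sat_wk _ _ _).2 hκ),
    imp_intro κ.wk ?_ ((sat_wk _ _ _).2 hκ)⟩ <;>
  · intro W ρ hκ ha
    obtain ⟨a, ρ, rfl⟩ := ρ.exists_cons
    have := h W ρ ((sat_wk _ _ _).1 hκ) a
    simpa [this] using ha

/-- Induction on natural numbers. -/
theorem nat_ind (κ : Fm Γ) (φ : Fm (.nat :: Γ))
    (h0 : ∀ (W : World) (ρ : Env W.D Γ), W.sat κ ρ → W.sat φ (W.Z ∷ ρ))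
    (h1 : ∀ (W : World) (ρ : Env W.D Γ), W.sat κ ρ → ∀ n, W.sat φ (n ∷ ρ) →
      W.sat φ (W.S n ∷ ρ))
    {ρ : Env W.D Γ} (hκ : W.sat κ ρ) (n : W.D .nat) : W.sat φ (n ∷ ρ) := by
  have h : Entails [.mem .zero (Tm.wk (.compr .nat φ)),
      .all .nat ((Tm.mem v0 (Tm.wk (Tm.wk (.compr .nat φ)))).imp
        (Tm.mem (.succ v0) (Tm.wk (Tm.wk (.compr .nat φ)))))]
      (Tm.mem v0 (Tm.wk (.compr .nat φ))) := .natInd v0 .head (.tail .head)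
  have h2 := sat_of_entails₂ _ _ h (W := W) (ρ := n ∷ ρ) (by simpa using h0 W ρ hκ)
    (all_intro κ.wk (fun W ρ hκ m => ?_) ((sat_wk _ _ _).2 hκ))
  · simpa using h2
  · obtain ⟨n, ρ, rfl⟩ := ρ.exists_cons
    refine imp_intro κ.wk.wk (fun W ρ hκ hm => ?_) (by simpa using hκ)
    obtain ⟨m, ρ, rfl⟩ := ρ.exists_cons
    obtain ⟨n, ρ, rfl⟩ := ρ.exists_cons
    simp only [sat_wk, sat_mem, ev_wk, ev_var, Env.cons_zero, mem_compr, ev_succ] at *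
    exact h1 W ρ hκ m hm

end World
namespace World

variable {W : World} {Γ : Ctx} {A B : Ty}

/-! ### Natural numbers and decidability -/

theorem nat_cases (n : W.D .nat) : n = W.Z ∨ ∃ m, n = W.S m := by
  have := nat_ind (W := W) (Γ := []) .top (.or (.eq v0 .zero) (.ex .nat (.eq v1 (.succ v0))))
    (by simp) (fun W ρ _ n _ => by simp) (ρ := Env.nil) (sat_top _) n
  simpa using this

/-- Being different, as a statement of the object language. -/
def Ne (W : World) {A : Ty} (a b : W.D A) : Prop := W.sat (neg (.eq v0 v1)) (a ∷ b ∷ Env.nil)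

@[simp] theorem sat_neg_eq (s t : Tm Γ A) (ρ : Env W.D Γ) :
    W.sat (neg (.eq s t)) ρ ↔ W.Ne (W.ev s ρ) (W.ev t ρ) := by
  rw [Ne, sat, sat, ← ev_two (neg (.eq v0 v1)) s t ρ]
  rfl

theorem Ne.ne {a b : W.D A} (h : W.Ne a b) : a ≠ b := fun e => sat_neg h (by simpa using e)

theorem Ne.symm {a b : W.D A} (h : W.Ne a b) : W.Ne b a := by
  have := neg_intro (φ := .eq v1 v0) (neg (.eq v0 v1))
    (fun W ρ h h' => by simp at h h'; exact h.ne h'.symm) h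
  simpa using this

theorem S_Ne_Z (n : W.D .nat) : W.Ne (W.S n) W.Z := by
  have := neg_intro (W := W) (φ := .eq (.succ v0) .zero) (ρ := n ∷ Env.nil) .top
    (fun W ρ _ h => by simp at h) (sat_top _)
  simpa using this

theorem Ne.succ {m n : W.D .nat} (h : W.Ne m n) : W.Ne (W.S m) (W.S n) := by
  have := neg_intro (φ := .eq (.succ v0) (.succ v1)) (neg (.eq v0 v1))
    (fun W ρ h h' => by simp at h h'; exact h.ne h') h
  simpa using this

theorem nat_eq_or_Ne (m n : W.D .nat) : m = n ∨ W.Ne m n := by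
  have := nat_ind (W := W) (Γ := []) .top (.all .nat (.or (.eq v1 v0) (neg (.eq v1 v0))))
    ?_ ?_ (ρ := Env.nil) (sat_top _) m
  · simpa using sat_all this n
  · intro W ρ _
    refine all_intro (.eq v0 .zero) (fun W ρ h n => ?_) (by simp)
    obtain ⟨m, ρ, rfl⟩ := ρ.exists_cons
    obtain rfl : m = W.Z := by simpa using h
    rcases nat_cases n with rfl | ⟨n, rfl⟩
    · simp
    · simpa using (S_Ne_Z n).symm
  · intro W ρ _ n ih
    refine all_intro (.ex .nat (.and (.eq v1 (.succ v0)) (.all .nat (.or (.eq v1 v0)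
      (neg (.eq v1 v0)))))) (fun W ρ h n => ?_) ?_
    swap
    · simp only [sat_ex, sat_and, sat_eq, ev_var, ev_succ, Env.cons_zero, Env.cons_succ]
      obtain rfl := ρ.eq_nil
      exact ⟨n, rfl, (sat_one (Γ := [.nat, .nat])
        (.all .nat (.or (.eq v1 v0) (neg (.eq v1 v0)))) v0 (n ∷ W.S n ∷ Env.nil)).2
          (by simpa only [ev_var, Env.cons_zero] using ih)⟩
    obtain ⟨m, ρ, rfl⟩ := ρ.exists_cons
    simp only [sat_ex, sat_and, sat_eq, ev_var, ev_succ, Env.cons_zero, Env.cons_succ] at h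
    obtain ⟨m, rfl, ih⟩ := h
    rcases nat_cases n with rfl | ⟨n, rfl⟩
    · simpa using S_Ne_Z m
    · have h := sat_all ih n
      simp only [sat_or, sat_eq, sat_neg_eq, ev_var, Env.cons_zero, Env.cons_succ] at h ⊢
      exact h.imp (by rintro rfl; rfl) Ne.succ

theorem Ne_iff_ne {m n : W.D .nat} : W.Ne m n ↔ m ≠ n :=
  ⟨Ne.ne, fun h => (nat_eq_or_Ne m n).resolve_left h⟩

/-- A decidable formula. -/
def Dec (W : World) (φ : Fm Γ) (ρ : Env W.D Γ) : Prop := W.sat φ ρ ∨ W.sat (neg φ) ρ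

theorem Dec.and {φ ψ : Fm Γ} {ρ : Env W.D Γ} (h : W.Dec φ ρ) (h' : W.sat φ ρ → W.Dec ψ ρ) :
    W.Dec (.and φ ψ) ρ := by
  rcases h with h | h
  · rcases h' h with h' | h'
    · exact .inl ((sat_and _ _ _).2 ⟨h, h'⟩)
    · exact .inr (sat_of_entails _ (.impI (.impE (.tail .head) (.andE₂ .head))) h')
  · exact .inr (sat_of_entails _ (.impI (.impE (.tail .head) (.andE₁ .head))) h)

theorem Dec.not {φ : Fm Γ} {ρ : Env W.D Γ} (h : W.Dec φ ρ) : W.Dec (neg φ) ρ :=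
  h.symm.imp id fun h => sat_of_entails _ (.impI (.impE .head (.tail .head))) h

theorem Dec.or {φ ψ : Fm Γ} {ρ : Env W.D Γ} (h : W.Dec φ ρ) (h' : W.Dec ψ ρ) :
    W.Dec (.or φ ψ) ρ := by
  rcases h with h | h
  · exact .inl ((sat_or _ _ _).2 (.inl h))
  · rcases h' with h' | h'
    · exact .inl ((sat_or _ _ _).2 (.inr h'))
    · exact .inr (sat_of_entails₂ _ _ (.impI (.orE .head
        (.impE (.tail (.tail .head)) .head) (.impE (.tail (.tail (.tail .head))) .head))) h h')

/-! ### Relations -/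

theorem isFun_intro (κ : Fm Γ) {X : Tm Γ (.pow A)} {Y : Tm Γ (.pow B)} {F : Tm Γ (.rel A B)}
    (h1 : ∀ (W : World) (ρ : Env W.D Γ), W.sat κ ρ → ∀ a b, W.Mem (W.P a b) (W.ev F ρ) →
      W.Mem a (W.ev X ρ) ∧ W.Mem b (W.ev Y ρ))
    (h2 : ∀ (W : World) (ρ : Env W.D Γ), W.sat κ ρ → ∀ a, W.Mem a (W.ev X ρ) →
      ∃ b, W.Mem (W.P a b) (W.ev F ρ))
    (h3 : ∀ (W : World) (ρ : Env W.D Γ), W.sat κ ρ → ∀ a b b', W.Mem (W.P a b) (W.ev F ρ) →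
      W.Mem (W.P a b') (W.ev F ρ) → b = b')
    {ρ : Env W.D Γ} (hκ : W.sat κ ρ) : W.sat (isFun X Y F) ρ := by
  refine (sat_and _ _ _).2 ⟨?_, (sat_and _ _ _).2 ⟨?_, ?_⟩⟩
  · refine all_intro κ (fun W ρ hκ a => all_intro κ.wk (fun W ρ hκ b =>
      imp_intro κ.wk.wk (fun W ρ hκ h => ?_) (by simpa using hκ)) (by simpa using hκ)) hκ
    obtain ⟨b, ρ, rfl⟩ := ρ.exists_cons
    obtain ⟨a, ρ, rfl⟩ := ρ.exists_cons
    simp at hκ h ⊢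
    exact h1 W ρ hκ a b h
  · refine allIn_intro κ (fun W ρ hκ a ha => ?_) hκ
    simpa using h2 W ρ hκ a ha
  · refine all_intro κ (fun W ρ hκ a => all_intro κ.wk (fun W ρ hκ b =>
      all_intro κ.wk.wk (fun W ρ hκ b' => imp_intro κ.wk.wk.wk (fun W ρ hκ h =>
      imp_intro (.and κ.wk.wk.wk (.mem (.pair v2 v1) F.wk.wk.wk)) (fun W ρ hκ h' => ?_) ?_)
      (by simpa using hκ)) (by simpa using hκ)) (by simpa using hκ)) hκ
    · obtain ⟨b', ρ, rfl⟩ := ρ.exists_cons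
      obtain ⟨b, ρ, rfl⟩ := ρ.exists_cons
      obtain ⟨a, ρ, rfl⟩ := ρ.exists_cons
      simp at hκ h' ⊢
      exact h3 W ρ hκ.1 a b b' hκ.2 h'
    · exact (sat_and _ _ _).2 ⟨hκ, h⟩

section
variable {X : Tm Γ (.pow A)} {Y : Tm Γ (.pow B)} {F : Tm Γ (.rel A B)} {ρ : Env W.D Γ}

theorem isFun_dom (h : W.sat (isFun X Y F) ρ) {a b} (hab : W.Mem (W.P a b) (W.ev F ρ)) :
    W.Mem a (W.ev X ρ) ∧ W.Mem b (W.ev Y ρ) := by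
  have := sat_imp (sat_all (sat_all ((sat_and _ _ _).1 h).1 a) b) (by simpa)
  simpa using this

theorem isFun_total (h : W.sat (isFun X Y F) ρ) {a} (ha : W.Mem a (W.ev X ρ)) :
    ∃ b, W.Mem (W.P a b) (W.ev F ρ) := by
  have := sat_allIn ((sat_and _ _ _).1 ((sat_and _ _ _).1 h).2).1 ha
  simpa using this

theorem isFun_unique (h : W.sat (isFun X Y F) ρ) {a b b'} (hb : W.Mem (W.P a b) (W.ev F ρ))
    (hb' : W.Mem (W.P a b') (W.ev F ρ)) : b = b' := by
  have := sat_imp (sat_imp (sat_all (sat_all (sat_all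
    ((sat_and _ _ _).1 ((sat_and _ _ _).1 h).2).2 a) b) b') (by simpa)) (by simpa)
  simpa using this

end

/-! ### Conatural numbers -/

/-- The set of conatural numbers in a world. -/
def X (W : World) : W.D (.pow .seq) := W.ev conat Env.nil

/-- The point `∞`. -/
def inf (W : World) : W.D .seq := W.ev infty Env.nil

/-- The point of a natural number. -/
def nn (W : World) (k : W.D .nat) : W.D .seq := W.ev (ofNat v0) (k ∷ Env.nil)

/-- The set of bit sequences. -/
def C (W : World) : W.D (.pow .seq) := W.ev cantor Env.nil

@[simp] theorem ev_conat (ρ : Env W.D Γ) : W.ev conat ρ = W.X := ev_closed conat ρ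

@[simp] theorem ev_infty (ρ : Env W.D Γ) : W.ev infty ρ = W.inf := ev_closed infty ρ

@[simp] theorem ev_cantor (ρ : Env W.D Γ) : W.ev cantor ρ = W.C := ev_closed cantor ρ

@[simp] theorem ev_ofNat (t : Tm Γ .nat) (ρ : Env W.D Γ) :
    W.ev (ofNat t) ρ = W.nn (W.ev t ρ) := ev_one (ofNat v0) t ρ

theorem mem_inf {p : W.D (.prod .nat .nat)} : W.Mem p W.inf ↔ ∃ j, p = W.P j W.Z := by
  simp [inf, infty]

theorem mem_nn {k : W.D .nat} {p : W.D (.prod .nat .nat)} :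
    W.Mem p (W.nn k) ↔ p = W.P k (W.S W.Z) ∨ ∃ j, j ≠ k ∧ p = W.P j W.Z := by
  simp [nn, ofNat, Ne_iff_ne]

theorem mem_C {x : W.D .seq} : W.Mem x W.C ↔ W.sat (isFun natSet two v0) (x ∷ Env.nil) := by
  rw [C, cantor, mem_compr]

theorem exists_of_mem {x : W.D .seq} (hx : W.Mem x W.C) {p : W.D (.prod .nat .nat)}
    (hp : W.Mem p x) : ∃ k, p = W.P k W.Z ∨ p = W.P k (W.S W.Z) := by
  obtain ⟨a, b, rfl⟩ := exists_P p
  have := (isFun_dom (mem_C.1 hx) (by simpa using hp)).2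
  simp [two] at this
  exact ⟨a, by simpa using this⟩

theorem bit (k : W.D .nat) {x : W.D .seq} (hx : W.Mem x W.C) :
    W.Mem (W.P k W.Z) x ∨ W.Mem (W.P k (W.S W.Z)) x := by
  obtain ⟨b, hb⟩ := isFun_total (mem_C.1 hx) (a := k) (by simp [natSet])
  have := (isFun_dom (mem_C.1 hx) hb).2
  simp [two] at this hb
  rcases this with rfl | rfl
  exacts [.inl hb, .inr hb]

theorem bit_unique {k a b : W.D .nat} {x : W.D .seq} (hx : W.Mem x W.C)
    (ha : W.Mem (W.P k a) x) (hb : W.Mem (W.P k b) x) : a = b :=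
  isFun_unique (mem_C.1 hx) (by simpa using ha) (by simpa using hb)

theorem mem_C_of_mem_X {x : W.D .seq} (hx : W.Mem x W.X) : W.Mem x W.C := by
  rw [X, conat, mem_compr, sat_and] at hx
  simpa using hx.1

theorem one_unique {x : W.D .seq} (hx : W.Mem x W.X) {j k : W.D .nat}
    (hj : W.Mem (W.P j (W.S W.Z)) x) (hk : W.Mem (W.P k (W.S W.Z)) x) : j = k := by
  rw [X, conat, mem_compr, sat_and] at hx
  have := sat_imp (sat_imp (sat_all (sat_all hx.2 j) k) (by simpa)) (by simpa)
  simpa using this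

theorem mem_X_intro (κ : Fm Γ) {x : Tm Γ .seq}
    (H : ∀ (W : World) (ρ : Env W.D Γ), W.sat κ ρ → W.Mem (W.ev x ρ) W.C ∧
      ∀ j k, W.Mem (W.P j (W.S W.Z)) (W.ev x ρ) → W.Mem (W.P k (W.S W.Z)) (W.ev x ρ) → j = k)
    {ρ : Env W.D Γ} (hκ : W.sat κ ρ) : W.Mem (W.ev x ρ) W.X := by
  rw [X, conat, mem_compr, sat_and]
  refine ⟨by simpa using (H W ρ hκ).1, ?_⟩
  have := all_intro (φ := .all .nat (.imp (.mem (.pair v1 one) x.wk.wk)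
    (.imp (.mem (.pair v0 one) x.wk.wk) (.eq v1 v0)))) κ (fun W ρ hκ a => all_intro κ.wk
      (fun W ρ hκ b => imp_intro κ.wk.wk (fun W ρ hκ h => imp_intro
        (.and κ.wk.wk (.mem (.pair v1 one) x.wk.wk)) (fun W ρ hκ h' => ?_) ?_)
      (by simpa using hκ)) (by simpa using hκ)) hκ
  · rw [sat, ← ev_one _ x ρ]
    exact this
  · rename World => W
    obtain ⟨b, ρ, rfl⟩ := ρ.exists_cons
    obtain ⟨a, ρ, rfl⟩ := ρ.exists_cons
    simp at hκ h' ⊢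
    exact (H W ρ hκ.1).2 a b hκ.2 h'
  · exact (sat_and _ _ _).2 ⟨hκ, h⟩

end World

/-- The bit sequence of a decidable predicate on natural numbers, the predicate being given by a
formula. -/
def seqOf {Γ : Ctx} (φ : Fm (.nat :: Γ)) : Tm Γ .seq :=
  .compr (.prod .nat .nat) (.ex .nat
    (.or (.and (.eq v1 (.pair v0 one)) (φ.ren (Ren.lift (fun _ x => x.succ) .nat)))
      (.and (.eq v1 (.pair v0 .zero)) (neg (φ.ren (Ren.lift (fun _ x => x.succ) .nat))))))

namespace World

variable {W : World} {Γ : Ctx} {A B : Ty}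

theorem sat_ren_lift (φ : Fm (A :: Γ)) (a : W.D A) (b : W.D B) (ρ : Env W.D Γ) :
    W.sat (φ.ren (Ren.lift (fun _ x => x.succ) A)) (a ∷ b ∷ ρ) ↔ W.sat φ (a ∷ ρ) := by
  rw [sat, sat, Tm.ren_eq_sub, ev_sub]
  refine iff_of_eq (congrArg W.tr (congrArg (W.ev φ) ?_))
  funext C x
  cases x <;> simp [Ren.lift]

theorem mem_seqOf (φ : Fm (.nat :: Γ)) {p : W.D (.prod .nat .nat)} {ρ : Env W.D Γ} :
    W.Mem p (W.ev (seqOf φ) ρ) ↔ ∃ k, p = W.P k (W.S W.Z) ∧ W.sat φ (k ∷ ρ) ∨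
      p = W.P k W.Z ∧ W.sat (neg φ) (k ∷ ρ) := by
  have h (k) : W.sat (neg (φ.ren (Ren.lift (fun _ x => x.succ) .nat))) (k ∷ p ∷ ρ) ↔
      W.sat (neg φ) (k ∷ ρ) := sat_ren_lift (neg φ) k p ρ
  simp [seqOf, sat_ren_lift, h]

theorem one_mem_seqOf (φ : Fm (.nat :: Γ)) {k : W.D .nat} {ρ : Env W.D Γ} :
    W.Mem (W.P k (W.S W.Z)) (W.ev (seqOf φ) ρ) ↔ W.sat φ (k ∷ ρ) := by
  simp [mem_seqOf]

theorem ev_mem_C {x : Tm Γ .seq} {ρ : Env W.D Γ} :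
    W.Mem (W.ev x ρ) W.C ↔ W.sat (isFun natSet two x) ρ :=
  mem_C.trans (sat_one (isFun natSet two v0) x ρ).symm

theorem seqOf_mem_C (κ : Fm Γ) {φ : Fm (.nat :: Γ)}
    (hd : ∀ (W : World) (ρ : Env W.D Γ), W.sat κ ρ → ∀ k, W.Dec φ (k ∷ ρ))
    {ρ : Env W.D Γ} (hκ : W.sat κ ρ) : W.Mem (W.ev (seqOf φ) ρ) W.C := by
  have : W.sat (isFun natSet two (seqOf φ)) ρ := by
    refine isFun_intro κ ?_ ?_ ?_ hκ
    · intro W ρ hκ a b hab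
      simp only [mem_seqOf, P_inj] at hab
      simp [natSet, two]
      obtain ⟨k, ⟨⟨-, h⟩, -⟩ | ⟨⟨-, h⟩, -⟩⟩ := hab
      exacts [.inr h, .inl h]
    · intro W ρ hκ a _
      simp only [mem_seqOf, P_inj]
      rcases hd W ρ hκ a with h | h
      · exact ⟨W.S W.Z, a, .inl ⟨⟨rfl, rfl⟩, h⟩⟩
      · exact ⟨W.Z, a, .inr ⟨⟨rfl, rfl⟩, h⟩⟩
    · intro W ρ hκ a b b' hb hb'
      simp only [mem_seqOf, P_inj] at hb hb'
      obtain ⟨k, ⟨⟨rfl, h⟩, hk⟩ | ⟨⟨rfl, h⟩, hk⟩⟩ := hb <;>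
        obtain ⟨k, ⟨⟨rfl, h'⟩, hk'⟩ | ⟨⟨rfl, h'⟩, hk'⟩⟩ := hb'
      · rw [h, h']
      · exact absurd hk (sat_neg hk')
      · exact absurd hk' (sat_neg hk)
      · rw [h, h']
  exact ev_mem_C.2 this

/-- A decidable predicate that holds at most once defines a conatural number. -/
theorem seqOf_mem_X (κ : Fm Γ) {φ : Fm (.nat :: Γ)}
    (hd : ∀ (W : World) (ρ : Env W.D Γ), W.sat κ ρ → ∀ k, W.Dec φ (k ∷ ρ))
    (hu : ∀ (W : World) (ρ : Env W.D Γ), W.sat κ ρ → ∀ j k, W.sat φ (j ∷ ρ) →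
      W.sat φ (k ∷ ρ) → j = k)
    {ρ : Env W.D Γ} (hκ : W.sat κ ρ) : W.Mem (W.ev (seqOf φ) ρ) W.X := by
  refine mem_X_intro κ (fun W ρ hκ => ⟨seqOf_mem_C κ hd hκ, fun j k hj hk => ?_⟩) hκ
  exact hu W ρ hκ j k ((one_mem_seqOf φ).1 hj) ((one_mem_seqOf φ).1 hk)

theorem inf_mem_X : W.Mem W.inf W.X := by
  have := mem_X_intro (W := W) (Γ := []) (ρ := Env.nil) (x := infty) .top (fun W ρ _ => ?_)
    (sat_top _)
  · simpa using this
  · have : W.sat (isFun natSet two infty) ρ := by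
      refine isFun_intro .top ?_ ?_ ?_ (sat_top _) <;>
        simp only [ev_infty, mem_inf, P_inj]
      · rintro W ρ - a b ⟨j, rfl, rfl⟩
        simp [natSet, two]
      · rintro W ρ - a -
        exact ⟨W.Z, a, rfl, rfl⟩
      · rintro W ρ - a b b' ⟨j, rfl, rfl⟩ ⟨j', rfl, rfl⟩
        rfl
    refine ⟨ev_mem_C.2 this, fun j k hj => ?_⟩
    simp [mem_inf] at hj

theorem nn_mem_X (k : W.D .nat) : W.Mem (W.nn k) W.X := by
  have := mem_X_intro (W := W) (ρ := k ∷ Env.nil) (x := ofNat v0) .top (fun W ρ _ => ?_)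
    (sat_top _)
  · simpa using this
  · have : W.sat (isFun natSet two (ofNat v0)) ρ := by
      refine isFun_intro .top ?_ ?_ ?_ (sat_top _) <;>
        simp only [ev_ofNat, mem_nn, P_inj]
      · rintro W ρ - a b (⟨rfl, rfl⟩ | ⟨j, -, rfl, rfl⟩) <;> simp [natSet, two]
      · rintro W ρ - a -
        rcases nat_eq_or_Ne a (W.ev v0 ρ) with h | h
        · exact ⟨_, .inl ⟨h, rfl⟩⟩
        · exact ⟨W.Z, .inr ⟨a, h.ne, rfl, rfl⟩⟩
      · rintro W ρ - a b b' (⟨rfl, rfl⟩ | ⟨j, h, rfl, rfl⟩) (⟨h', rfl⟩ | ⟨j', h', rfl, rfl⟩)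
        · rfl
        · exact absurd rfl h'
        · exact absurd h' h
        · rfl
    refine ⟨ev_mem_C.2 this, fun j k hj hk => ?_⟩
    simp [mem_nn] at hj hk
    rw [hj, hk]

/-- The conatural number with the digit `1` at `k` is the natural number `k`. -/
theorem one_mem_iff {x : W.D .seq} (hx : W.Mem x W.X) {k : W.D .nat} :
    W.Mem (W.P k (W.S W.Z)) x ↔ x = W.nn k := by
  refine ⟨fun h => ?_, fun h => h ▸ mem_nn.2 (.inl rfl)⟩
  have := ext_intro (W := W) (u := v0) (v := ofNat v1) (ρ := x ∷ k ∷ Env.nil)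
    (.and (.mem v0 conat) (.mem (.pair v1 one) v0)) (fun W ρ h p => ?_) (by simpa using ⟨hx, h⟩)
  · simpa using this
  · obtain ⟨x, ρ, rfl⟩ := ρ.exists_cons
    obtain ⟨k, ρ, rfl⟩ := ρ.exists_cons
    simp at h ⊢
    obtain ⟨hx, h⟩ := h
    have hC := mem_C_of_mem_X hx
    rw [mem_nn]
    constructor
    · intro hp
      obtain ⟨j, rfl | rfl⟩ := exists_of_mem hC hp
      · refine .inr ⟨j, ?_, rfl⟩
        rintro rfl
        exact absurd (bit_unique hC hp h) (by simp)
      · exact .inl (by rw [one_unique hx hp h])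
    · rintro (rfl | ⟨j, hj, rfl⟩)
      · exact h
      · rcases bit j hC with h' | h'
        · exact h'
        · exact absurd (one_unique hx h' h) hj

@[simp] theorem nn_inj {j k : W.D .nat} : W.nn j = W.nn k ↔ j = k := by
  refine ⟨fun h => ?_, fun h => h ▸ rfl⟩
  have := mem_nn.2 (.inl rfl : W.P j (W.S W.Z) = W.P j (W.S W.Z) ∨ _)
  rw [h, mem_nn] at this
  simpa using this

/-- Points that have different digits at some place are different. -/
theorem Ne_of_bit {x y : W.D .seq} (hx : W.Mem x W.C) {k : W.D .nat}
    (h0 : W.Mem (W.P k W.Z) x) (h1 : W.Mem (W.P k (W.S W.Z)) y) : W.Ne x y := by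
  have := neg_intro (W := W) (φ := .eq v0 v1) (ρ := x ∷ y ∷ k ∷ Env.nil)
    (.and (.mem v0 cantor) (.and (.mem (.pair v2 .zero) v0) (.mem (.pair v2 one) v1)))
    (fun W ρ h h' => ?_) (by simpa using ⟨hx, h0, h1⟩)
  · simpa using this
  · simp at h h'
    rw [← h'] at h
    exact absurd (bit_unique h.1 h.2.1 h.2.2) (by simp)

theorem eq_nn_or_Ne {x : W.D .seq} (hx : W.Mem x W.X) (k : W.D .nat) :
    x = W.nn k ∨ W.Ne x (W.nn k) := by
  rcases bit k (mem_C_of_mem_X hx) with h | h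
  · exact .inr (Ne_of_bit (mem_C_of_mem_X hx) h (mem_nn.2 (.inl rfl)))
  · exact .inl ((one_mem_iff hx).1 h)

/-- Equality of conatural numbers is stable, so it may be proved in classical worlds. -/
theorem eq_intro (κ : Fm Γ) {x y : Tm Γ .seq}
    (hx : ∀ (W : World) (ρ : Env W.D Γ), W.sat κ ρ → W.Mem (W.ev x ρ) W.X)
    (hy : ∀ (W : World) (ρ : Env W.D Γ), W.sat κ ρ → W.Mem (W.ev y ρ) W.X)
    (h : ∀ (W : World) (ρ : Env W.D Γ), W.Classical → W.sat κ ρ → W.ev x ρ = W.ev y ρ)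
    {ρ : Env W.D Γ} (hκ : W.sat κ ρ) : W.ev x ρ = W.ev y ρ := by
  refine ext_intro κ (fun W ρ hκ p => ?_) hκ
  have key : ¬ W.Ne (W.ev x ρ) (W.ev y ρ) := by
    have := neg_neg_intro (χ := .eq x y) κ (fun W ρ hW hκ => by simpa using h W ρ hW hκ) hκ
    exact fun h => sat_neg this (by simpa using h)
  have hx := mem_C_of_mem_X (hx W ρ hκ)
  have hy := mem_C_of_mem_X (hy W ρ hκ)
  constructor
  · intro hp
    obtain ⟨k, rfl | rfl⟩ := exists_of_mem hx hp
    · exact (bit k hy).resolve_right fun h => key (Ne_of_bit hx hp h)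
    · exact (bit k hy).resolve_left fun h => key (Ne_of_bit hy h hp).symm
  · intro hp
    obtain ⟨k, rfl | rfl⟩ := exists_of_mem hy hp
    · exact (bit k hx).resolve_right fun h => key (Ne_of_bit hy hp h).symm
    · exact (bit k hx).resolve_left fun h => key (Ne_of_bit hx h hp)

/-! ### Markov's principle -/

/-- A conatural number different from `∞` is a natural number. -/
theorem exists_eq_nn {x : W.D .seq} (hx : W.Mem x W.X) (h : W.Ne x W.inf) :
    ∃ k, x = W.nn k := by
  have := sat_imp (sat_allIn W.of_markov (by simpa using mem_C_of_mem_X hx)) (by simpa using h)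
  simpa [one_mem_iff hx] using this

theorem Classical.eq_or (hW : W.Classical) {x : W.D .seq} (hx : W.Mem x W.X) :
    x = W.inf ∨ ∃ k, x = W.nn k := by
  rcases hW (.eq v0 infty) (x ∷ Env.nil) with h | h
  · exact .inl (by simpa using h)
  · exact .inr (exists_eq_nn hx (by simpa using h))

/-- Markov's principle for decidable predicates. -/
theorem exists_of_not_not (κ : Fm Γ) {φ : Fm (.nat :: Γ)}
    (hd : ∀ (W : World) (ρ : Env W.D Γ), W.sat κ ρ → ∀ k, W.Dec φ (k ∷ ρ))
    {ρ : Env W.D Γ} (hκ : W.sat κ ρ) (h : W.sat (neg (neg (.ex .nat φ))) ρ) :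
    ∃ k, W.sat φ (k ∷ ρ) := by
  have h1 : W.sat (neg (.eq (seqOf φ) infty)) ρ := by
    refine neg_intro (.and κ (neg (neg (.ex .nat φ)))) (fun W ρ hκ h => ?_)
      ((sat_and _ _ _).2 ⟨hκ, h⟩)
    refine sat_neg ((sat_and _ _ _).1 hκ).2 (neg_intro (.eq (seqOf φ) infty) ?_ h)
    intro W ρ h h'
    obtain ⟨k, hk⟩ := (sat_ex _ _).1 h'
    have := (one_mem_seqOf φ).2 hk
    rw [(sat_eq _ _ _).1 h, ev_infty, mem_inf] at this
    simp at this
  have := sat_imp (sat_allIn W.of_markov (a := W.ev (seqOf φ) ρ)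
    (by simpa using seqOf_mem_C κ hd hκ)) (by simpa using h1)
  simpa [one_mem_seqOf] using this

end World

/-- Equality with `u` is decidable on the conatural numbers. -/
def decPt {Γ : Ctx} (u : Tm Γ .seq) : Fm Γ :=
  allIn conat (.or (.eq v0 u.wk) (neg (.eq v0 u.wk)))

namespace World

variable {W : World} {Γ : Ctx} {A B : Ty}

/-! ### Decidable points -/

/-- Equality with `u` is decidable on the conatural numbers of a world. -/
def DecPt (W : World) (u : W.D .seq) : Prop := W.sat (decPt v0) (u ∷ Env.nil)

@[simp] theorem sat_decPt (u : Tm Γ .seq) (ρ : Env W.D Γ) :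
    W.sat (decPt u) ρ ↔ W.DecPt (W.ev u ρ) := sat_one (decPt v0) u ρ

theorem DecPt.eq_or {u : W.D .seq} (h : W.DecPt u) {z : W.D .seq} (hz : W.Mem z W.X) :
    z = u ∨ W.Ne z u := by
  simpa using sat_allIn h (a := z) (by simpa using hz)

theorem decPt_intro (κ : Fm Γ) {u : Tm Γ .seq}
    (h : ∀ (W : World) (ρ : Env W.D Γ), W.sat κ ρ → ∀ z, W.Mem z W.X →
      z = W.ev u ρ ∨ W.Ne z (W.ev u ρ))
    {ρ : Env W.D Γ} (hκ : W.sat κ ρ) : W.DecPt (W.ev u ρ) := by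
  rw [← sat_decPt]
  refine allIn_intro κ (fun W ρ hκ z hz => ?_) hκ
  simpa using h W ρ hκ z (by simpa using hz)

theorem decPt_nn (k : W.D .nat) : W.DecPt (W.nn k) := by
  have := decPt_intro (u := ofNat v0) .top (fun W ρ _ z hz => ?_) (sat_top (k ∷ Env.nil))
  · simpa using this
  · simpa using eq_nn_or_Ne hz _

/-- If `∞` is a decidable point, then all points are decidable. -/
theorem DecPt.of_inf (h : W.DecPt W.inf) {x : W.D .seq} (hx : W.Mem x W.X) : W.DecPt x := by
  have := decPt_intro (u := v0) (ρ := x ∷ Env.nil) (.and (decPt infty) (.mem v0 conat))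
    (fun W ρ h z hz => ?_) (by simpa using ⟨h, hx⟩)
  · simpa using this
  · simp at h ⊢
    rcases h.1.eq_or h.2 with h' | h'
    · exact h' ▸ h.1.eq_or hz
    · obtain ⟨k, hk⟩ := exists_eq_nn h.2 h'
      exact hk ▸ eq_nn_or_Ne hz k

/-- Equality of natural numbers is decidable, so it may be proved in classical worlds. -/
theorem nat_eq_intro (κ : Fm Γ) {m n : Tm Γ .nat}
    (h : ∀ (W : World) (ρ : Env W.D Γ), W.Classical → W.sat κ ρ → W.ev m ρ = W.ev n ρ)
    {ρ : Env W.D Γ} (hκ : W.sat κ ρ) : W.ev m ρ = W.ev n ρ := by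
  refine (nat_eq_or_Ne _ _).resolve_right fun h' => ?_
  have := neg_neg_intro (χ := .eq m n) κ (fun W ρ hW hκ => by simpa using h W ρ hW hκ) hκ
  exact sat_neg this (by simpa using h')

/-! ### Injections -/

/-- The element `f` is an injection of the conatural numbers. -/
def Inj (W : World) (f : W.D (.rel .seq .seq)) : Prop := W.sat (isInj conat v0) (f ∷ Env.nil)

@[simp] theorem sat_isInj (F : Tm Γ (.rel .seq .seq)) (ρ : Env W.D Γ) :
    W.sat (isInj conat F) ρ ↔ W.Inj (W.ev F ρ) := sat_one (isInj conat v0) F ρ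

section
variable {f : W.D (.rel .seq .seq)} {a a' b b' : W.D .seq}

theorem Inj.isFun (h : W.Inj f) : W.sat (isFun conat conat v0) (f ∷ Env.nil) :=
  ((sat_and _ _ _).1 h).1

theorem Inj.dom (h : W.Inj f) (hab : W.Mem (W.P a b) f) : W.Mem a W.X := by
  simpa using (isFun_dom h.isFun (by simpa using hab)).1

theorem Inj.ran (h : W.Inj f) (hab : W.Mem (W.P a b) f) : W.Mem b W.X := by
  simpa using (isFun_dom h.isFun (by simpa using hab)).2

theorem Inj.total (h : W.Inj f) (ha : W.Mem a W.X) : ∃ b, W.Mem (W.P a b) f := by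
  simpa using isFun_total h.isFun (by simpa using ha)

theorem Inj.unique (h : W.Inj f) (hb : W.Mem (W.P a b) f) (hb' : W.Mem (W.P a b') f) :
    b = b' :=
  isFun_unique h.isFun (by simpa using hb) (by simpa using hb')

theorem Inj.inj (h : W.Inj f) (hb : W.Mem (W.P a b) f) (hb' : W.Mem (W.P a' b) f) :
    a = a' := by
  have := sat_imp (sat_imp (sat_all (sat_all (sat_all ((sat_and _ _ _).1 h).2 a) a') b)
    (by simpa)) (by simpa)
  simpa using this

theorem Inj.ne_left (h : W.Inj f) (hb : W.Mem (W.P a b) f) (hb' : W.Mem (W.P a' b') f)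
    (hne : W.Ne b b') : W.Ne a a' := by
  have := neg_intro (W := W) (φ := .eq v0 v1) (ρ := a ∷ a' ∷ b ∷ b' ∷ f ∷ Env.nil)
    (.and (isInj conat (.var (.succ (.succ (.succ (.succ .zero))))))
      (.and (.mem (.pair v0 v2) (.var (.succ (.succ (.succ (.succ .zero))))))
      (.and (.mem (.pair v1 v3) (.var (.succ (.succ (.succ (.succ .zero))))))
        (neg (.eq v2 v3))))) (fun W ρ h h' => ?_) (by simpa using ⟨h, hb, hb', hne⟩)
  · simpa using this
  · simp at h h'
    obtain ⟨h, h1, h2, h3⟩ := h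
    rw [h'] at h1
    exact h3.ne (h.unique h1 h2)

theorem Inj.ne_right (h : W.Inj f) (hb : W.Mem (W.P a b) f) (hb' : W.Mem (W.P a' b') f)
    (hne : W.Ne a a') : W.Ne b b' := by
  have := neg_intro (W := W) (φ := .eq v2 v3) (ρ := a ∷ a' ∷ b ∷ b' ∷ f ∷ Env.nil)
    (.and (isInj conat (.var (.succ (.succ (.succ (.succ .zero))))))
      (.and (.mem (.pair v0 v2) (.var (.succ (.succ (.succ (.succ .zero))))))
      (.and (.mem (.pair v1 v3) (.var (.succ (.succ (.succ (.succ .zero))))))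
        (neg (.eq v0 v1))))) (fun W ρ h h' => ?_) (by simpa using ⟨h, hb, hb', hne⟩)
  · simpa using this
  · simp at h h'
    obtain ⟨h, h1, h2, h3⟩ := h
    rw [h'] at h1
    exact h3.ne (h.inj h1 h2)

theorem Inj.decPt_left (h : W.Inj f) (hab : W.Mem (W.P a b) f) (hb : W.DecPt b) :
    W.DecPt a := by
  have := decPt_intro (W := W) (u := v0) (ρ := a ∷ b ∷ f ∷ Env.nil)
    (.and (isInj conat v2) (.and (.mem (.pair v0 v1) v2) (decPt v1)))
    (fun W ρ h z hz => ?_) (by simpa using ⟨h, hab, hb⟩)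
  · simpa using this
  · simp at h ⊢
    obtain ⟨h, h1, h2⟩ := h
    obtain ⟨y, hy⟩ := h.total hz
    rcases h2.eq_or (h.ran hy) with rfl | h'
    · exact .inl (h.inj hy h1)
    · exact .inr (h.ne_left hy h1 h')

/-- An injection maps decidable points to decidable points: if `a` is a natural number, then its
image differs from that of `∞`, so one of these images is a natural number, by Markov's
principle. In the second case `∞` is decidable. -/
theorem Inj.decPt_right (h : W.Inj f) (hab : W.Mem (W.P a b) f) (ha : W.DecPt a) :
    W.DecPt b := by
  rcases ha.eq_or inf_mem_X with rfl | h'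
  · exact ha.of_inf (h.ran hab)
  obtain ⟨c, hc⟩ := h.total (inf_mem_X (W := W))
  obtain ⟨j, hj⟩ := exists_of_not_not (W := W) (ρ := b ∷ c ∷ Env.nil)
    (φ := .or (.eq v1 (ofNat v0)) (.eq v2 (ofNat v0)))
    (.and (.mem v0 conat) (.and (.mem v1 conat) (neg (.eq v0 v1))))
    (fun W ρ h k => by
      simp at h
      exact .or (by simpa [Dec] using eq_nn_or_Ne h.1 k)
        (by simpa [Dec] using eq_nn_or_Ne h.2.1 k))
    (by simpa using ⟨h.ran hab, h.ran hc, h.ne_right hab hc h'.symm⟩)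
    (neg_neg_intro (.and (.mem v0 conat) (.and (.mem v1 conat) (neg (.eq v0 v1))))
      (fun W ρ hW h => by
        simp at h ⊢
        obtain ⟨h1, h2, h3⟩ := h
        rcases hW.eq_or h1 with e | ⟨k, hk⟩
        · rcases hW.eq_or h2 with e' | ⟨k, hk⟩
          · exact absurd (e.trans e'.symm) h3.ne
          · exact ⟨k, .inr hk⟩
        · exact ⟨k, .inl hk⟩)
      (by simpa using ⟨h.ran hab, h.ran hc, h.ne_right hab hc h'.symm⟩))
  simp at hj
  rcases hj with rfl | rfl
  · exact decPt_nn j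
  · exact (h.decPt_left hc (decPt_nn j)).of_inf (h.ran hab)

end

/-- A relation on the conatural numbers is an injection if it is total, and if in classical worlds
it is injective and functional. -/
theorem inj_intro (κ : Fm Γ) {F : Tm Γ (.rel .seq .seq)}
    (h1 : ∀ (W : World) (ρ : Env W.D Γ), W.sat κ ρ → ∀ a b, W.Mem (W.P a b) (W.ev F ρ) →
      W.Mem a W.X ∧ W.Mem b W.X)
    (h2 : ∀ (W : World) (ρ : Env W.D Γ), W.sat κ ρ → ∀ a, W.Mem a W.X →
      ∃ b, W.Mem (W.P a b) (W.ev F ρ))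
    (h3 : ∀ (W : World) (ρ : Env W.D Γ), W.Classical → W.sat κ ρ → ∀ a b b',
      W.Mem (W.P a b) (W.ev F ρ) → W.Mem (W.P a b') (W.ev F ρ) → b = b')
    (h4 : ∀ (W : World) (ρ : Env W.D Γ), W.Classical → W.sat κ ρ → ∀ a a' b,
      W.Mem (W.P a b) (W.ev F ρ) → W.Mem (W.P a' b) (W.ev F ρ) → a = a')
    {ρ : Env W.D Γ} (hκ : W.sat κ ρ) : W.Inj (W.ev F ρ) := by
  rw [← sat_isInj]
  refine (sat_and _ _ _).2 ⟨isFun_intro κ (by simpa using h1) (by simpa using h2) ?_ hκ, ?_⟩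
  · intro W ρ hκ a b b' hb hb'
    have := eq_intro (W := W) (x := v1) (y := v2) (ρ := a ∷ b ∷ b' ∷ ρ)
      (.and κ.wk.wk.wk (.and (.mem (.pair v0 v1) F.wk.wk.wk) (.mem (.pair v0 v2) F.wk.wk.wk)))
      (fun W ρ h => ?_) (fun W ρ h => ?_) (fun W ρ hW h => ?_) (by simpa using ⟨hκ, hb, hb'⟩)
    · simpa using this
    all_goals
      obtain ⟨a, ρ, rfl⟩ := ρ.exists_cons
      obtain ⟨b, ρ, rfl⟩ := ρ.exists_cons
      obtain ⟨b', ρ, rfl⟩ := ρ.exists_cons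
      simp at h ⊢
    · exact (h1 W ρ h.1 a b h.2.1).2
    · exact (h1 W ρ h.1 a b' h.2.2).2
    · exact h3 W ρ hW h.1 a b b' h.2.1 h.2.2
  · refine all_intro κ (fun W ρ hκ a => all_intro κ.wk (fun W ρ hκ a' =>
      all_intro κ.wk.wk (fun W ρ hκ b => imp_intro κ.wk.wk.wk (fun W ρ hκ h =>
      imp_intro (.and κ.wk.wk.wk (.mem (.pair v2 v0) F.wk.wk.wk)) (fun W ρ hκ h' => ?_) ?_)
      (by simpa using hκ)) (by simpa using hκ)) (by simpa using hκ)) hκ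
    · rw [sat_eq]
      refine eq_intro (.and (.and κ.wk.wk.wk (.mem (.pair v2 v0) F.wk.wk.wk))
        (.mem (.pair v1 v0) F.wk.wk.wk)) (fun W ρ h => ?_) (fun W ρ h => ?_)
        (fun W ρ hW h => ?_) ((sat_and _ _ _).2 ⟨hκ, h'⟩)
      all_goals
        obtain ⟨b, ρ, rfl⟩ := ρ.exists_cons
        obtain ⟨a', ρ, rfl⟩ := ρ.exists_cons
        obtain ⟨a, ρ, rfl⟩ := ρ.exists_cons
        simp at h ⊢
      · exact (h1 W ρ h.1.1 a b h.1.2).1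
      · exact (h1 W ρ h.1.1 a' b h.2).1
      · exact h4 W ρ hW h.1.1 a a' b h.1.2 h.2
    · exact (sat_and _ _ _).2 ⟨hκ, h⟩

/-- A stable property `ψ` has a witness in the conatural numbers if in classical worlds it has
exactly one, and if it is decidable which natural number is the witness. -/
theorem exists_intro (κ : Fm Γ) (ψ : Fm (.seq :: Γ)) (φ : Fm (.nat :: Γ))
    (hd : ∀ (W : World) (ρ : Env W.D Γ), W.sat κ ρ → ∀ k, W.Dec φ (k ∷ ρ))
    (hs : ∀ (W : World) (ρ : Env W.D Γ), W.sat κ ρ → ∀ y, W.Mem y W.X →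
      W.sat (neg (neg ψ)) (y ∷ ρ) → W.sat ψ (y ∷ ρ))
    (hφ : ∀ (W : World) (ρ : Env W.D Γ), W.Classical → W.sat κ ρ → ∀ k,
      W.sat φ (k ∷ ρ) ↔ W.sat ψ (W.nn k ∷ ρ))
    (hu : ∀ (W : World) (ρ : Env W.D Γ), W.Classical → W.sat κ ρ → ∀ y y',
      W.sat ψ (y ∷ ρ) → W.sat ψ (y' ∷ ρ) → y = y')
    (he : ∀ (W : World) (ρ : Env W.D Γ), W.Classical → W.sat κ ρ →
      ∃ y, W.Mem y W.X ∧ W.sat ψ (y ∷ ρ))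
    {ρ : Env W.D Γ} (hκ : W.sat κ ρ) : ∃ y, W.Mem y W.X ∧ W.sat ψ (y ∷ ρ) := by
  have hX : ∀ (W : World) (ρ : Env W.D Γ), W.sat κ ρ → W.Mem (W.ev (seqOf φ) ρ) W.X := by
    refine fun W ρ hκ => seqOf_mem_X κ hd (fun W ρ hκ j k hj hk => ?_) hκ
    have := nat_eq_intro (W := W) (m := v0) (n := v1) (ρ := j ∷ k ∷ ρ)
      (.and κ.wk.wk (.and (φ.ren (Ren.lift (fun _ x => x.succ) .nat)) φ.wk))
      (fun W ρ hW h => ?_) (by simpa [sat_ren_lift] using ⟨hκ, hj, hk⟩)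
    · simpa using this
    · obtain ⟨j, ρ, rfl⟩ := ρ.exists_cons
      obtain ⟨k, ρ, rfl⟩ := ρ.exists_cons
      simp [sat_ren_lift] at h ⊢
      obtain ⟨hκ, hj, hk⟩ := h
      exact nn_inj.1 (hu W ρ hW hκ _ _ ((hφ W ρ hW hκ j).1 hj) ((hφ W ρ hW hκ k).1 hk))
  refine ⟨W.ev (seqOf φ) ρ, hX W ρ hκ, hs W ρ hκ _ (hX W ρ hκ) ?_⟩
  refine neg_neg_intro (.and κ.wk (.eq v0 (seqOf φ).wk)) (fun W ρ hW h => ?_) (by simpa using hκ)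
  obtain ⟨z, ρ, rfl⟩ := ρ.exists_cons
  simp at h ⊢
  obtain ⟨hκ, rfl⟩ := h
  obtain ⟨y, hy, hxy⟩ := he W ρ hW hκ
  have : W.ev (seqOf φ) ρ = y := by
    rcases hW.eq_or (hX W ρ hκ) with e | ⟨k, hk⟩
    · rcases hW.eq_or hy with e' | ⟨k, rfl⟩
      · rw [e, e']
      · rw [← one_mem_iff (hX W ρ hκ), one_mem_seqOf]
        exact (hφ W ρ hW hκ k).2 hxy
    · rw [hk]
      rw [← one_mem_iff (hX W ρ hκ), one_mem_seqOf] at hk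
      exact hu W ρ hW hκ _ _ ((hφ W ρ hW hκ k).1 hk) hxy
  rwa [this]

end World

/-- The variables with index 4, 5, 6 and 7. -/
abbrev v4 {Γ : Ctx} {A B C D E : Ty} : Tm (E :: D :: C :: B :: A :: Γ) A :=
  .var (.succ (.succ (.succ (.succ .zero))))
abbrev v5 {Γ : Ctx} {A B C D E F : Ty} : Tm (F :: E :: D :: C :: B :: A :: Γ) A :=
  .var (.succ (.succ (.succ (.succ (.succ .zero)))))
abbrev v6 {Γ : Ctx} {A B C D E F G : Ty} : Tm (G :: F :: E :: D :: C :: B :: A :: Γ) A :=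
  .var (.succ (.succ (.succ (.succ (.succ (.succ .zero))))))
abbrev v7 {Γ : Ctx} {A B C D E F G H : Ty} : Tm (H :: G :: F :: E :: D :: C :: B :: A :: Γ) A :=
  .var (.succ (.succ (.succ (.succ (.succ (.succ (.succ .zero)))))))

/-- The transposition of `u` and `v` maps `z` to `y`. This is a conjunction of implications, so
that it is stable. -/
def swapFm {Γ : Ctx} (u v z y : Tm Γ .seq) : Fm Γ :=
  .and (.imp (.eq z u) (.eq y v)) (.and (.imp (.eq z v) (.eq y u))
    (.imp (neg (.eq z u)) (.imp (neg (.eq z v)) (.eq y z))))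

/-- The relation `g`, followed by the transposition of `u` and `g (f u)`. -/
def step {Γ : Ctx} (u : Tm Γ .seq) (f g : Tm Γ (.rel .seq .seq)) :
    Tm Γ (.rel .seq .seq) :=
  .compr (.prod .seq .seq) (.ex .seq (.ex .seq (.ex .seq (.ex .seq (.ex .seq
    (.and (.eq v5 (.pair v4 v3))
    (.and (.mem (.pair u.wk.wk.wk.wk.wk.wk v2) f.wk.wk.wk.wk.wk.wk)
    (.and (.mem (.pair v2 v1) g.wk.wk.wk.wk.wk.wk)
    (.and (.mem (.pair v4 v0) g.wk.wk.wk.wk.wk.wk)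
    (.and (.mem v3 conat) (swapFm u.wk.wk.wk.wk.wk.wk v1 v0 v3)))))))))))

namespace World

variable {W : World} {Γ : Ctx} {A B : Ty}

/-! ### Transpositions -/

/-- The transposition of `u` and `v` maps `z` to `y`. -/
def Swap (W : World) (u v z y : W.D .seq) : Prop :=
  W.sat (swapFm v0 v1 v2 v3) (u ∷ v ∷ z ∷ y ∷ Env.nil)

@[simp] theorem sat_swapFm (u v z y : Tm Γ .seq) (ρ : Env W.D Γ) :
    W.sat (swapFm u v z y) ρ ↔ W.Swap (W.ev u ρ) (W.ev v ρ) (W.ev z ρ) (W.ev y ρ) :=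
  sat_four (swapFm v0 v1 v2 v3) u v z y ρ

theorem Classical.swap_iff (hW : W.Classical) {u v z y : W.D .seq} : W.Swap u v z y ↔
    (z = u → y = v) ∧ (z = v → y = u) ∧ (z ≠ u → z ≠ v → y = z) := by
  rw [Swap, swapFm]
  simp only [sat_and, hW.sat_imp_iff, hW.sat_neg_iff, sat_eq, ev_var, Env.cons_zero,
    Env.cons_succ, ne_eq]

theorem Classical.swap_unique (hW : W.Classical) {u v z y y' : W.D .seq} (h : W.Swap u v z y)
    (h' : W.Swap u v z y') : y = y' := by
  rw [hW.swap_iff] at h h'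
  by_cases e : z = u
  · rw [h.1 e, h'.1 e]
  · by_cases e' : z = v
    · rw [h.2.1 e', h'.2.1 e']
    · rw [h.2.2 e e', h'.2.2 e e']

theorem Classical.swap_symm (hW : W.Classical) {u v z y : W.D .seq} (h : W.Swap u v z y) :
    W.Swap u v y z := by
  rw [hW.swap_iff] at h ⊢
  by_cases e : z = u
  · obtain rfl := h.1 e
    exact ⟨fun e' => e.trans e'.symm, fun _ => e, fun _ h => absurd rfl h⟩
  · by_cases e' : z = v
    · obtain rfl := h.2.1 e'
      exact ⟨fun _ => e', fun e => e'.trans e.symm, fun h => absurd rfl h⟩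
    · obtain rfl := h.2.2 e e'
      exact h

/-- The graph of a transposition is stable, because equality of conatural numbers is. -/
theorem swap_stable {u v z y : W.D .seq} (hu : W.Mem u W.X) (hv : W.Mem v W.X)
    (hz : W.Mem z W.X) (hy : W.Mem y W.X)
    (h : W.sat (neg (neg (swapFm v0 v1 v2 v3))) (u ∷ v ∷ z ∷ y ∷ Env.nil)) :
    W.Swap u v z y := by
  have hκ : W.sat (.and (.mem v0 conat) (.and (.mem v1 conat) (.and (.mem v2 conat)
      (.and (.mem v3 conat) (neg (neg (swapFm v0 v1 v2 v3))))))) (u ∷ v ∷ z ∷ y ∷ Env.nil) := by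
    simpa using ⟨hu, hv, hz, hy, h⟩
  refine (sat_and _ _ _).2 ⟨?_, (sat_and _ _ _).2 ⟨?_, ?_⟩⟩
  · refine imp_intro _ (fun W ρ hκ h => (sat_eq _ _ _).2 (eq_intro (.and _ (.eq v2 v0)) ?_ ?_ ?_
      ((sat_and _ _ _).2 ⟨hκ, h⟩))) hκ
    · intro W ρ h; simp at h ⊢; tauto
    · intro W ρ h; simp at h ⊢; tauto
    · intro W ρ hW h
      simp [hW.sat_neg_iff, hW.swap_iff] at h ⊢
      tauto
  · refine imp_intro _ (fun W ρ hκ h => (sat_eq _ _ _).2 (eq_intro (.and _ (.eq v2 v1)) ?_ ?_ ?_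
      ((sat_and _ _ _).2 ⟨hκ, h⟩))) hκ
    · intro W ρ h; simp at h ⊢; tauto
    · intro W ρ h; simp at h ⊢; tauto
    · intro W ρ hW h
      simp [hW.sat_neg_iff, hW.swap_iff] at h ⊢
      tauto
  · refine imp_intro _ (fun W ρ hκ h => imp_intro (.and _ (neg (.eq v2 v0))) (fun W ρ hκ h =>
      (sat_eq _ _ _).2 (eq_intro (.and (.and _ (neg (.eq v2 v0))) (neg (.eq v2 v1))) ?_ ?_ ?_
      ((sat_and _ _ _).2 ⟨hκ, h⟩))) ((sat_and _ _ _).2 ⟨hκ, h⟩)) hκ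
    · intro W ρ h; simp at h ⊢; tauto
    · intro W ρ h; simp at h ⊢; tauto
    · intro W ρ hW h
      simp only [sat_and, hW.sat_neg_iff, sat_swapFm, hW.swap_iff, sat_eq] at h ⊢
      tauto

/-- The transposition of `u` and `g (f u)` is defined everywhere, because one of these points is
decidable if the other one is. -/
theorem exists_swap {f g : W.D (.rel .seq .seq)} (hf : W.Inj f) (hg : W.Inj g)
    {u p v z : W.D .seq} (hp : W.Mem (W.P u p) f) (hv : W.Mem (W.P p v) g) (hz : W.Mem z W.X) :
    ∃ y, W.Mem y W.X ∧ W.Swap u v z y := by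
  have := exists_intro (W := W) (ρ := u ∷ v ∷ z ∷ p ∷ f ∷ g ∷ Env.nil)
    (.and (isInj conat v4) (.and (isInj conat v5) (.and (.mem (.pair v0 v3) v4)
      (.and (.mem (.pair v3 v1) v5) (.mem v2 conat)))))
    (swapFm v1 v2 v3 v0)
    -- The natural number `k` is the image of `z` if and only if `u = k` and `z = v`, or `v = k` and
    -- `z = u`, or both `u` and `v` differ from `k` and `z = k`.
    (.or (.and (.eq v1 (ofNat v0)) (.eq v3 v2)) (.or (.and (.eq v2 (ofNat v0)) (.eq v3 v1))
      (.and (neg (.eq v1 (ofNat v0))) (.and (neg (.eq v2 (ofNat v0))) (.eq v3 (ofNat v0))))))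
    ?_ ?_ ?_ ?_ ?_ (by simpa using ⟨hf, hg, hp, hv, hz⟩)
  · simpa using this
  · intro W ρ h k
    simp at h
    obtain ⟨hf, hg, hp, hv, hz⟩ := h
    have hu := eq_nn_or_Ne (hf.dom hp) k
    have hv' := eq_nn_or_Ne (hg.ran hv) k
    have hz' := eq_nn_or_Ne hz k
    refine .or (.and (by simpa [Dec] using hu) fun e => ?_)
      (.or (.and (by simpa [Dec] using hv') fun e => ?_) (.and (.not (by simpa [Dec] using hu))
        fun _ => .and (.not (by simpa [Dec] using hv')) fun _ => by simpa [Dec] using hz'))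
    · simp at e
      have : W.DecPt (ρ _ .zero) := e ▸ decPt_nn k
      simpa [Dec] using (hg.decPt_right hv (hf.decPt_right hp this)).eq_or hz
    · simp at e
      have : W.DecPt (ρ _ (.succ .zero)) := e ▸ decPt_nn k
      simpa [Dec] using (hf.decPt_left hp (hg.decPt_left hv this)).eq_or hz
  · intro W ρ h y hy hn
    simp at h
    obtain ⟨hf, hg, hp, hv, hz⟩ := h
    have := (sat_four (neg (neg (swapFm v0 v1 v2 v3))) v1 v2 v3 v0 (y ∷ ρ)).1 hn
    simp only [ev_var, Env.cons_zero, Env.cons_succ] at this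
    simpa using swap_stable (hf.dom hp) (hg.ran hv) hz hy this
  · intro W ρ hW h k
    simp [hW.sat_neg_iff, hW.swap_iff]
    grind
  · intro W ρ hW h y y' hy hy'
    obtain ⟨u, ρ, rfl⟩ := ρ.exists_cons
    obtain ⟨v, ρ, rfl⟩ := ρ.exists_cons
    obtain ⟨z, ρ, rfl⟩ := ρ.exists_cons
    simp only [sat_swapFm, ev_var, Env.cons_zero, Env.cons_succ] at hy hy'
    exact hW.swap_unique hy hy'
  · intro W ρ hW h
    obtain ⟨u, ρ, rfl⟩ := ρ.exists_cons
    obtain ⟨v, ρ, rfl⟩ := ρ.exists_cons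
    obtain ⟨z, ρ, rfl⟩ := ρ.exists_cons
    simp [hW.swap_iff] at h ⊢
    obtain ⟨hf, hg, hp, hv, hz⟩ := h
    have hu := hf.dom hp
    have hv := hg.ran hv
    by_cases e : z = u
    · exact ⟨v, hv, by grind⟩
    · by_cases e' : z = v
      · exact ⟨u, hu, by grind⟩
      · exact ⟨z, hz, by grind⟩

/-! ### The modification step -/

/-- The relation `step`, for elements. -/
def stp (W : World) (u : W.D .seq) (f g : W.D (.rel .seq .seq)) : W.D (.rel .seq .seq) :=
  W.ev (step v0 v1 v2) (u ∷ f ∷ g ∷ Env.nil)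

@[simp] theorem ev_step (u : Tm Γ .seq) (f g : Tm Γ (.rel .seq .seq)) (ρ : Env W.D Γ) :
    W.ev (step u f g) ρ = W.stp (W.ev u ρ) (W.ev f ρ) (W.ev g ρ) :=
  ev_three (step v0 v1 v2) u f g ρ

theorem mem_stp {u y x : W.D .seq} {f g : W.D (.rel .seq .seq)} :
    W.Mem (W.P y x) (W.stp u f g) ↔ ∃ p v q, W.Mem (W.P u p) f ∧ W.Mem (W.P p v) g ∧
      W.Mem (W.P y q) g ∧ W.Mem x W.X ∧ W.Swap u v q x := by
  simp only [stp, step, mem_compr, sat_ex, sat_and, sat_eq, sat_mem, ev_pair, ev_wk, ev_var,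
    Env.cons_zero, Env.cons_succ, ev_conat, sat_swapFm, P_inj]
  constructor
  · rintro ⟨_, _, p, v, q, ⟨rfl, rfl⟩, h⟩
    exact ⟨p, v, q, h⟩
  · rintro ⟨p, v, q, h⟩
    exact ⟨_, _, p, v, q, ⟨rfl, rfl⟩, h⟩

/-- A modified injection is an injection. -/
theorem Inj.stp {u : W.D .seq} {f g : W.D (.rel .seq .seq)} (hu : W.Mem u W.X) (hf : W.Inj f)
    (hg : W.Inj g) : W.Inj (W.stp u f g) := by
  refine inj_intro (F := step v0 v1 v2) (.and (.mem v0 conat) (.and (isInj conat v1)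
    (isInj conat v2))) ?_ ?_ ?_ ?_ (by simpa using ⟨hu, hf, hg⟩) <;>
    simp only [sat_and, sat_isInj, sat_mem, ev_step, mem_stp, ev_var, ev_conat]
  · rintro W ρ ⟨hu, hf, hg⟩ y x ⟨p, v, q, hp, hv, hq, hx, h⟩
    exact ⟨hg.dom hq, hx⟩
  · rintro W ρ ⟨hu, hf, hg⟩ y hy
    obtain ⟨p, hp⟩ := hf.total hu
    obtain ⟨v, hv⟩ := hg.total (hf.ran hp)
    obtain ⟨q, hq⟩ := hg.total hy
    obtain ⟨x, hx, h⟩ := exists_swap hf hg hp hv (hg.ran hq)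
    exact ⟨x, p, v, q, hp, hv, hq, hx, h⟩
  · rintro W ρ hW ⟨hu, hf, hg⟩ y x x' ⟨p, v, q, hp, hv, hq, hx, h⟩
      ⟨p', v', q', hp', hv', hq', hx', h'⟩
    obtain rfl := hf.unique hp hp'
    obtain rfl := hg.unique hv hv'
    obtain rfl := hg.unique hq hq'
    exact hW.swap_unique h h'
  · rintro W ρ hW ⟨hu, hf, hg⟩ y y' x ⟨p, v, q, hp, hv, hq, hx, h⟩
      ⟨p', v', q', hp', hv', hq', hx', h'⟩
    obtain rfl := hf.unique hp hp'
    obtain rfl := hg.unique hv hv'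
    obtain rfl := hW.swap_unique (hW.swap_symm h) (hW.swap_symm h')
    exact hg.inj hq hq'

section
variable {f g : W.D (.rel .seq .seq)} {u p a b : W.D .seq}

/-- After the modification, `g` is inverse to `f` at `u`. -/
theorem Classical.mem_stp_self (hW : W.Classical) (hf : W.Inj f) (hg : W.Inj g)
    (hp : W.Mem (W.P u p) f) : W.Mem (W.P p u) (W.stp u f g) := by
  obtain ⟨v, hv⟩ := hg.total (hf.ran hp)
  refine mem_stp.2 ⟨p, v, v, hp, hv, hv, hf.dom hp, ?_⟩
  rw [hW.swap_iff]
  grind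

/-- The modification of `g` does not change it where it is inverse to `f`. -/
theorem Classical.mem_stp_of_mem (hW : W.Classical) (hf : W.Inj f) (hg : W.Inj g)
    (hu : W.Mem u W.X) (hab : W.Mem (W.P a b) f) (hba : W.Mem (W.P b a) g) :
    W.Mem (W.P b a) (W.stp u f g) := by
  obtain ⟨p, hp⟩ := hf.total hu
  obtain ⟨v, hv⟩ := hg.total (hf.ran hp)
  refine mem_stp.2 ⟨p, v, a, hp, hv, hba, hf.dom hab, ?_⟩
  rw [hW.swap_iff]
  refine ⟨?_, ?_, fun _ _ => rfl⟩
  · rintro rfl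
    obtain rfl := hf.unique hp hab
    exact hg.unique hba hv
  · rintro rfl
    obtain rfl := hg.inj hv hba
    exact hf.inj hab hp

/-- A pair of sets that is respected by `f` and `g` is respected by the modification of `g`. -/
theorem Classical.stp_color (hW : W.Classical) {U V : W.D (.pow .seq)}
    (hf : ∀ a b, W.Mem (W.P a b) f → (W.Mem a U ↔ W.Mem b V))
    (hg : ∀ a b, W.Mem (W.P b a) g → (W.Mem a U ↔ W.Mem b V))
    (h : W.Mem (W.P b a) (W.stp u f g)) : W.Mem a U ↔ W.Mem b V := by
  obtain ⟨p, v, q, hp, hv, hq, hx, h⟩ := mem_stp.1 h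
  rw [hW.swap_iff] at h
  have h1 := hf _ _ hp
  have h2 := hg _ _ hv
  have h3 := hg _ _ hq
  by_cases e : q = u
  · obtain rfl := e
    rw [h.1 rfl, h2, ← h1, h3]
  · by_cases e' : q = v
    · obtain rfl := e'
      rw [h.2.1 rfl, h1, ← h2, h3]
    · rw [h.2.2 e e', h3]

end

end World

/-- The set `w` satisfies the premises in the definition of `iter`. -/
def closedFm {Γ : Ctx} {A : Ty} (X : Tm Γ (.pow A)) (R : Tm Γ (.rel A A))
    (w : Tm Γ (.rel .nat (.prod A A))) : Fm Γ :=
  .and (allIn X (.mem (.pair .zero (.pair v0 v0)) w.wk))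
    (.all .nat (.all A (.all A (.all A
      (.imp (.mem (.pair v3 (.pair v2 v1)) w.wk.wk.wk.wk)
        (.imp (.mem (.pair v1 v0) R.wk.wk.wk.wk)
          (.mem (.pair (.succ v3) (.pair v2 v0)) w.wk.wk.wk.wk)))))))

namespace World

variable {W : World} {Γ : Ctx} {A B C : Ty}

/-! ### Composition, converses and iterates of relations -/

/-- The composite of two relations in a world. -/
def cmp (W : World) (S : W.D (.rel B C)) (R : W.D (.rel A B)) : W.D (.rel A C) :=
  W.ev (comp v0 v1) (S ∷ R ∷ Env.nil)

@[simp] theorem ev_comp (S : Tm Γ (.rel B C)) (R : Tm Γ (.rel A B)) (ρ : Env W.D Γ) :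
    W.ev (comp S R) ρ = W.cmp (W.ev S ρ) (W.ev R ρ) := ev_two (comp v0 v1) S R ρ

@[simp] theorem mem_cmp {S : W.D (.rel B C)} {R : W.D (.rel A B)} {x : W.D A} {z : W.D C} :
    W.Mem (W.P x z) (W.cmp S R) ↔ ∃ y, W.Mem (W.P x y) R ∧ W.Mem (W.P y z) S := by
  simp only [cmp, comp, mem_compr, sat_ex, sat_and, sat_eq, sat_mem, ev_pair, ev_wk, ev_var,
    Env.cons_zero, Env.cons_succ, P_inj]
  constructor
  · rintro ⟨_, y, _, ⟨rfl, rfl⟩, h⟩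
    exact ⟨y, h⟩
  · rintro ⟨y, h⟩
    exact ⟨_, y, _, ⟨rfl, rfl⟩, h⟩

/-- The converse of a relation in a world. -/
def cnv (W : World) (R : W.D (.rel A B)) : W.D (.rel B A) :=
  W.ev (converse v0) (R ∷ Env.nil)

@[simp] theorem ev_converse (R : Tm Γ (.rel A B)) (ρ : Env W.D Γ) :
    W.ev (converse R) ρ = W.cnv (W.ev R ρ) := ev_one (converse v0) R ρ

@[simp] theorem mem_cnv {R : W.D (.rel A B)} {x : W.D A} {y : W.D B} :
    W.Mem (W.P y x) (W.cnv R) ↔ W.Mem (W.P x y) R := by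
  simp only [cnv, converse, mem_compr, sat_ex, sat_and, sat_eq, sat_mem, ev_pair, ev_wk, ev_var,
    Env.cons_zero, Env.cons_succ, P_inj]
  constructor
  · rintro ⟨_, _, ⟨rfl, rfl⟩, h⟩
    exact h
  · intro h
    exact ⟨_, _, ⟨rfl, rfl⟩, h⟩

/-- The iterates of a relation in a world. -/
def itr (W : World) (X : W.D (.pow A)) (R : W.D (.rel A A)) (k : W.D .nat) : W.D (.rel A A) :=
  W.ev (iter v0 v1 v2) (X ∷ R ∷ k ∷ Env.nil)

@[simp] theorem ev_iter (X : Tm Γ (.pow A)) (R : Tm Γ (.rel A A)) (k : Tm Γ .nat)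
    (ρ : Env W.D Γ) : W.ev (iter X R k) ρ = W.itr (W.ev X ρ) (W.ev R ρ) (W.ev k ρ) :=
  ev_three (iter v0 v1 v2) X R k ρ

/-- The set `w` is among those whose intersection is the graph of the iterates of `R`. -/
def Closed (W : World) (X : W.D (.pow A)) (R : W.D (.rel A A)) (w : W.D (.rel .nat (.prod A A))) :
    Prop :=
  W.sat (closedFm v0 v1 v2) (X ∷ R ∷ w ∷ Env.nil)

@[simp] theorem sat_closedFm (X : Tm Γ (.pow A)) (R : Tm Γ (.rel A A))
    (w : Tm Γ (.rel .nat (.prod A A))) (ρ : Env W.D Γ) :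
    W.sat (closedFm X R w) ρ ↔ W.Closed (W.ev X ρ) (W.ev R ρ) (W.ev w ρ) :=
  sat_three (closedFm v0 v1 v2) X R w ρ

section
variable {X : W.D (.pow A)} {R : W.D (.rel A A)} {w : W.D (.rel .nat (.prod A A))} {x y z : W.D A}
  {k : W.D .nat}

theorem Closed.zero (h : W.Closed X R w) (hx : W.Mem x X) : W.Mem (W.P W.Z (W.P x x)) w := by
  simpa using sat_allIn ((sat_and _ _ _).1 h).1 (by simpa using hx)

theorem Closed.succ (h : W.Closed X R w) (hxy : W.Mem (W.P k (W.P x y)) w)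
    (hyz : W.Mem (W.P y z) R) : W.Mem (W.P (W.S k) (W.P x z)) w := by
  have := sat_imp (sat_imp (sat_all (sat_all (sat_all (sat_all ((sat_and _ _ _).1 h).2 k) x) y) z)
    (by simpa)) (by simpa)
  simpa using this

/-- The graph of the iterates is contained in each closed set. -/
theorem itr_elim {p : W.D (.prod A A)} (h : W.Mem p (W.itr X R k)) (hw : W.Closed X R w) :
    W.Mem (W.P k p) w := by
  rw [itr, iter, mem_compr] at h
  obtain ⟨h1, h2⟩ := (sat_and _ _ _).1
    ((sat_closedFm (Tm.wk (Tm.wk v0)) (Tm.wk (Tm.wk v1)) v0 (w ∷ p ∷ X ∷ R ∷ k ∷ Env.nil)).2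
      (by simpa using hw))
  simpa using sat_imp (sat_imp (sat_all h w) h1) h2

end

theorem closed_intro (κ : Fm Γ) {X : Tm Γ (.pow A)} {R : Tm Γ (.rel A A)}
    {w : Tm Γ (.rel .nat (.prod A A))}
    (h1 : ∀ (W : World) (ρ : Env W.D Γ), W.sat κ ρ → ∀ a, W.Mem a (W.ev X ρ) →
      W.Mem (W.P W.Z (W.P a a)) (W.ev w ρ))
    (h2 : ∀ (W : World) (ρ : Env W.D Γ), W.sat κ ρ → ∀ n a b c,
      W.Mem (W.P n (W.P a b)) (W.ev w ρ) → W.Mem (W.P b c) (W.ev R ρ) →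
      W.Mem (W.P (W.S n) (W.P a c)) (W.ev w ρ))
    {ρ : Env W.D Γ} (hκ : W.sat κ ρ) : W.Closed (W.ev X ρ) (W.ev R ρ) (W.ev w ρ) := by
  rw [← sat_closedFm]
  refine (sat_and _ _ _).2 ⟨allIn_intro κ (fun W ρ hκ a ha => by simpa using h1 W ρ hκ a ha) hκ,
    all_intro κ (fun W ρ hκ n => all_intro κ.wk (fun W ρ hκ a => all_intro κ.wk.wk
    (fun W ρ hκ b => all_intro κ.wk.wk.wk (fun W ρ hκ c => imp_intro κ.wk.wk.wk.wk
    (fun W ρ hκ hab => imp_intro (.and κ.wk.wk.wk.wk (.mem (.pair v3 (.pair v2 v1)) w.wk.wk.wk.wk))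
      (fun W ρ hκ hbc => ?_) ((sat_and _ _ _).2 ⟨hκ, hab⟩)) ((sat_wk _ _ _).2 hκ))
      ((sat_wk _ _ _).2 hκ)) ((sat_wk _ _ _).2 hκ)) ((sat_wk _ _ _).2 hκ)) hκ⟩
  obtain ⟨c, ρ, rfl⟩ := ρ.exists_cons
  obtain ⟨b, ρ, rfl⟩ := ρ.exists_cons
  obtain ⟨a, ρ, rfl⟩ := ρ.exists_cons
  obtain ⟨n, ρ, rfl⟩ := ρ.exists_cons
  simp only [sat_and, sat_wk, sat_mem, ev_pair, ev_var, Env.cons_zero, Env.cons_succ,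
    ev_wk] at hκ hbc
  simpa using h2 W ρ hκ.1 n a b c hκ.2 hbc

/-- What is in all closed sets is in the graph of the iterates. -/
theorem mem_itr_intro (κ : Fm Γ) {X : Tm Γ (.pow A)} {R : Tm Γ (.rel A A)} {k : Tm Γ .nat}
    {p : Tm Γ (.prod A A)}
    (h : ∀ (W : World) (ρ : Env W.D Γ), W.sat κ ρ → ∀ w, W.Closed (W.ev X ρ) (W.ev R ρ) w →
      W.Mem (W.P (W.ev k ρ) (W.ev p ρ)) w)
    {ρ : Env W.D Γ} (hκ : W.sat κ ρ) :
    W.Mem (W.ev p ρ) (W.itr (W.ev X ρ) (W.ev R ρ) (W.ev k ρ)) := by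
  rw [← ev_iter, iter, mem_compr]
  refine all_intro (.and κ.wk (.eq v0 p.wk)) (fun W ρ hκ w => imp_intro
    (Tm.wk (.and κ.wk (.eq v0 p.wk))) (fun W ρ hκ h1 => imp_intro
    (.and (Tm.wk (.and κ.wk (.eq v0 p.wk)))
      (allIn X.wk.wk (.mem (.pair .zero (.pair v0 v0)) v1)))
    (fun W ρ hκ h2 => ?_) ((sat_and _ _ _).2 ⟨hκ, h1⟩)) ((sat_wk _ _ _).2 hκ)) (by simpa using hκ)
  rw [sat_and] at hκ
  obtain ⟨hκ, h1⟩ := hκ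
  have hw : W.sat (closedFm X.wk.wk R.wk.wk v0) ρ := (sat_and _ _ _).2 ⟨h1, h2⟩
  clear h1 h2
  revert hκ hw
  obtain ⟨w, ρ, rfl⟩ := ρ.exists_cons
  obtain ⟨p, ρ, rfl⟩ := ρ.exists_cons
  intro hκ hw
  simp only [sat_and, sat_wk, sat_eq, ev_var, Env.cons_zero, ev_wk, sat_closedFm] at hκ hw
  obtain ⟨hκ, rfl⟩ := hκ
  simpa using h W ρ hκ w hw

theorem itr_zero {X : W.D (.pow A)} (R : W.D (.rel A A)) {x : W.D A} (hx : W.Mem x X) :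
    W.Mem (W.P x x) (W.itr X R W.Z) := by
  have := mem_itr_intro (W := W) (X := v1) (R := v2) (k := .zero) (p := .pair v0 v0)
    (ρ := x ∷ X ∷ R ∷ Env.nil) (.mem v0 v1) (fun W ρ hκ w hw => ?_) (by simpa using hx)
  · simpa using this
  · simpa using hw.zero (by simpa using hκ)

theorem itr_succ {X : W.D (.pow A)} {R : W.D (.rel A A)} {k : W.D .nat} {x y z : W.D A}
    (h : W.Mem (W.P x y) (W.itr X R k)) (h' : W.Mem (W.P y z) R) :
    W.Mem (W.P x z) (W.itr X R (W.S k)) := by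
  have := mem_itr_intro (W := W) (X := v3) (R := v4) (k := .succ v5) (p := .pair v0 v2)
    (ρ := x ∷ y ∷ z ∷ X ∷ R ∷ k ∷ Env.nil) (.and (.mem (.pair v0 v1) (iter v3 v4 v5))
      (.mem (.pair v1 v2) v4)) (fun W ρ hκ w hw => ?_) (by simpa using ⟨h, h'⟩)
  · simpa using this
  · simp at hκ
    simpa using hw.succ (itr_elim (by simpa using hκ.1) hw) (by simpa using hκ.2)

/-- Induction for the iterates of a relation, with a fixed first point. -/
theorem itr_ind (κ : Fm Γ) {X : Tm Γ (.pow A)} {R : Tm Γ (.rel A A)} (x : Tm Γ A)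
    (φ : Fm (A :: .nat :: Γ))
    (hzero : ∀ (W : World) (ρ : Env W.D Γ), W.sat κ ρ → W.Mem (W.ev x ρ) (W.ev X ρ) →
      W.sat φ (W.ev x ρ ∷ W.Z ∷ ρ))
    (hsucc : ∀ (W : World) (ρ : Env W.D Γ), W.sat κ ρ → ∀ k y z,
      W.Mem (W.P (W.ev x ρ) y) (W.itr (W.ev X ρ) (W.ev R ρ) k) → W.sat φ (y ∷ k ∷ ρ) →
      W.Mem (W.P y z) (W.ev R ρ) → W.sat φ (z ∷ W.S k ∷ ρ))
    {ρ : Env W.D Γ} (hκ : W.sat κ ρ) {k : W.D .nat} {z : W.D A}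
    (h : W.Mem (W.P (W.ev x ρ) z) (W.itr (W.ev X ρ) (W.ev R ρ) k)) : W.sat φ (z ∷ k ∷ ρ) := by
  -- The set of all `(k, (a, b))` such that `(k, b)` has the property if `a = x`.
  let φ' : Fm (A :: A :: .nat :: .prod .nat (.prod A A) :: Γ) :=
    φ.sub (Sub.cons v0 (Sub.cons v2 fun _ x => .var x.succ.succ.succ.succ))
  have hφ' (W : World) (ρ : Env W.D Γ) (b a k p) :
      W.sat φ' (b ∷ a ∷ k ∷ p ∷ ρ) ↔ W.sat φ (b ∷ k ∷ ρ) := by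
    refine iff_of_eq (congrArg W.tr ((W.ev_sub _ _ _).trans ?_))
    congr 1
    funext C x
    rcases x with _ | _ | x <;> simp [Sub.cons]
  let χ : Fm (A :: A :: .nat :: .prod .nat (.prod A A) :: Γ) :=
    .and (.eq v3 (.pair v2 (.pair v1 v0)))
      (.and (.mem (.pair v1 v0) (iter X.wk.wk.wk.wk R.wk.wk.wk.wk v2))
        (.imp (.eq v1 x.wk.wk.wk.wk) φ'))
  have hw := closed_intro (W := W) (X := X) (R := R) (ρ := ρ)
    (w := .compr _ (.ex .nat (.ex A (.ex A χ)))) κ ?_ ?_ hκ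
  · have := itr_elim h hw
    simp only [mem_compr, sat_ex, χ, sat_and, sat_eq, ev_pair, ev_var, Env.cons_zero,
      Env.cons_succ, P_inj] at this
    obtain ⟨_, _, _, ⟨rfl, rfl, rfl⟩, -, h⟩ := this
    exact (hφ' _ _ _ _ _ _).1 (sat_imp h (by simp))
  · intro W ρ hκ a ha
    simp only [mem_compr, sat_ex, χ, sat_and, sat_eq, ev_pair, ev_var, Env.cons_zero,
      Env.cons_succ, P_inj, sat_mem, ev_iter, ev_wk]
    refine ⟨_, _, _, ⟨rfl, rfl, rfl⟩, itr_zero _ ha, ?_⟩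
    refine imp_intro (.and κ.wk.wk.wk.wk (.and (.mem v1 X.wk.wk.wk.wk)
      (.and (.eq v0 v1) (.eq v2 .zero)))) (fun W ρ hκ h => ?_) (by simpa using ⟨hκ, ha⟩)
    obtain ⟨b, ρ, rfl⟩ := ρ.exists_cons
    obtain ⟨a, ρ, rfl⟩ := ρ.exists_cons
    obtain ⟨k, ρ, rfl⟩ := ρ.exists_cons
    obtain ⟨p, ρ, rfl⟩ := ρ.exists_cons
    simp at hκ h
    obtain ⟨hκ, ha, rfl, rfl⟩ := hκ
    obtain rfl := h
    exact (hφ' _ _ _ _ _ _).2 (hzero W ρ hκ ha)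
  · intro W ρ hκ n a b c hab hbc
    simp only [mem_compr, sat_ex, χ, sat_and, sat_eq, ev_pair, ev_var, Env.cons_zero,
      Env.cons_succ, P_inj, sat_mem, ev_iter, ev_wk] at hab ⊢
    obtain ⟨_, _, _, ⟨rfl, rfl, rfl⟩, h, h'⟩ := hab
    refine ⟨_, _, _, ⟨rfl, rfl, rfl⟩, itr_succ h hbc, ?_⟩
    -- The implications for `(n + 1, (a, c))` and `(n, (a, b))` are stated in a common context.
    let σ : Sub (A :: A :: .nat :: .prod .nat (.prod A A) :: Γ) (A :: A :: A :: .nat :: Γ) :=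
      Sub.cons v0 (Sub.cons v2 (Sub.cons (.succ v3) (Sub.cons (.pair (.succ v3) (.pair v2 v0))
        fun _ x => .var x.succ.succ.succ.succ)))
    let τ : Sub (A :: A :: .nat :: .prod .nat (.prod A A) :: Γ) (A :: A :: A :: .nat :: Γ) :=
      Sub.cons v1 (Sub.cons v2 (Sub.cons v3 (Sub.cons (.pair v3 (.pair v2 v1))
        fun _ x => .var x.succ.succ.succ.succ)))
    have hσ (W : World) (ρ : Env W.D Γ) (a b c n) (ψ : Fm _) : W.sat (ψ.sub σ)
        (c ∷ b ∷ a ∷ n ∷ ρ) ↔ W.sat ψ (c ∷ a ∷ W.S n ∷ W.P (W.S n) (W.P a c) ∷ ρ) := by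
      refine iff_of_eq (congrArg W.tr ((W.ev_sub _ _ _).trans ?_))
      congr 1
      funext C x
      rcases x with _ | _ | _ | _ | x <;> simp [Sub.cons, σ]
    have hτ (W : World) (ρ : Env W.D Γ) (a b c n) (ψ : Fm _) : W.sat (ψ.sub τ)
        (c ∷ b ∷ a ∷ n ∷ ρ) ↔ W.sat ψ (b ∷ a ∷ n ∷ W.P n (W.P a b) ∷ ρ) := by
      refine iff_of_eq (congrArg W.tr ((W.ev_sub _ _ _).trans ?_))
      congr 1
      funext C x
      rcases x with _ | _ | _ | _ | x <;> simp [Sub.cons, τ]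
    rw [← hσ W ρ a b c n]
    rw [← hτ W ρ a b c n] at h'
    refine imp_intro (.and κ.wk.wk.wk.wk (.and (.mem (.pair v1 v0) R.wk.wk.wk.wk)
      (.and (.mem (.pair v2 v1) (iter X.wk.wk.wk.wk R.wk.wk.wk.wk v3)) _)))
      (fun W ρ hκ e => ?_) ((sat_and _ _ _).2 ⟨by simpa using hκ, (sat_and _ _ _).2
        ⟨by simpa using hbc, (sat_and _ _ _).2 ⟨by simpa using h, h'⟩⟩⟩)
    obtain ⟨c, ρ, rfl⟩ := ρ.exists_cons
    obtain ⟨b, ρ, rfl⟩ := ρ.exists_cons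
    obtain ⟨a, ρ, rfl⟩ := ρ.exists_cons
    obtain ⟨n, ρ, rfl⟩ := ρ.exists_cons
    have e' : a = W.ev x ρ := by simpa using (hσ W ρ a b c n (.eq v1 x.wk.wk.wk.wk)).1 e
    simp only [sat_and, sat_wk, sat_mem, ev_pair, ev_var, Env.cons_zero, Env.cons_succ, ev_wk,
      ev_iter, hτ] at hκ
    obtain ⟨hκ, h1, h2, h3⟩ := hκ
    refine (hσ W ρ a b c n _).2 ((hφ' _ _ _ _ _ _).2 ?_)
    exact hsucc W ρ hκ n b c (e' ▸ h2) ((hφ' _ _ _ _ _ _).1 (sat_imp h3 (by simpa using e'))) h1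

end World

/-- The set of all `y` with `(x, y) ∈ R`. -/
def img {Γ : Ctx} {A B : Ty} (R : Tm Γ (.rel A B)) (x : Tm Γ A) : Tm Γ (.pow B) :=
  .compr B (.mem (.pair x.wk v0) R.wk)

/-- The set `{x}`. -/
def sgl {Γ : Ctx} {A : Ty} (x : Tm Γ A) : Tm Γ (.pow A) := .compr A (.eq v0 x.wk)

namespace World

variable {W : World} {Γ : Ctx} {A B C : Ty}

/-! ### Functions and their iterates -/

section
variable {X : W.D (.pow A)} {R : W.D (.rel A A)} {x y z : W.D A} {k : W.D .nat}

theorem itr_cases (h : W.Mem (W.P x z) (W.itr X R k)) : k = W.Z ∧ x = z ∧ W.Mem x X ∨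
    ∃ j y, k = W.S j ∧ W.Mem (W.P x y) (W.itr X R j) ∧ W.Mem (W.P y z) R := by
  have := itr_ind (W := W) (ρ := x ∷ X ∷ R ∷ Env.nil) (X := v1) (R := v2) .top v0
    (.or (.and (.eq v1 .zero) (.and (.eq v2 v0) (.mem v2 v3)))
      (.ex .nat (.ex A (.and (.eq v3 (.succ v1)) (.and (.mem (.pair v4 v0) (iter v5 v6 v1))
        (.mem (.pair v0 v2) v6)))))) (fun W ρ _ h => ?_) (fun W ρ _ k y z h1 _ h2 => ?_)
    (sat_top _) (k := k) (z := z) (by simpa using h)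
  · simpa using this
  · simp at h
    simp [h]
  · simp at h1 h2
    simpa using ⟨y, h1, h2⟩

theorem itr_zero_iff : W.Mem (W.P x z) (W.itr X R W.Z) ↔ x = z ∧ W.Mem x X := by
  constructor
  · intro h
    rcases itr_cases h with h | ⟨j, y, h, -⟩
    · exact h.2
    · simp at h
  · rintro ⟨rfl, h⟩
    exact itr_zero R h

theorem itr_succ_iff : W.Mem (W.P x z) (W.itr X R (W.S k)) ↔
    ∃ y, W.Mem (W.P x y) (W.itr X R k) ∧ W.Mem (W.P y z) R := by
  constructor
  · intro h
    rcases itr_cases h with h | ⟨j, y, h, h'⟩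
    · simp at h
    · rw [S_inj] at h
      exact ⟨y, h ▸ h'⟩
  · rintro ⟨y, h, h'⟩
    exact itr_succ h h'

/-- The first step of a path may be split off on the left. -/
theorem itr_succ_left (hx : W.Mem x X) (h : W.Mem (W.P x y) R)
    (h' : W.Mem (W.P y z) (W.itr X R k)) : W.Mem (W.P x z) (W.itr X R (W.S k)) := by
  have := itr_ind (W := W) (ρ := y ∷ x ∷ X ∷ R ∷ Env.nil) (X := v2) (R := v3)
    (.and (.mem v1 v2) (.mem (.pair v1 v0) v3)) v0 (.mem (.pair v3 v0) (iter v4 v5 (.succ v1)))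
    (fun W ρ hκ h => ?_) (fun W ρ hκ k y z h1 h2 h3 => ?_) (by simpa using ⟨hx, h⟩)
    (k := k) (z := z) (by simpa using h')
  · simpa using this
  · simp at hκ ⊢
    exact itr_succ (itr_zero _ hκ.1) hκ.2
  · simp at h2 h3 ⊢
    exact itr_succ h2 h3

end

theorem ev_img_eq {Γ' : Ctx} {R : Tm Γ (.rel A B)} {x : Tm Γ A} {ρ : Env W.D Γ}
    {R' : Tm Γ' (.rel A B)} {x' : Tm Γ' A} {ρ' : Env W.D Γ'} (h : W.ev R ρ = W.ev R' ρ')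
    (h' : W.ev x ρ = W.ev x' ρ') : W.ev (img R x) ρ = W.ev (img R' x') ρ' := by
  have h1 := ev_two (img v0 v1) R x ρ
  have h2 := ev_two (img v0 v1) R' x' ρ'
  rw [← h, ← h'] at h2
  exact h1.trans h2.symm

theorem ev_sgl_eq {Γ' : Ctx} {x : Tm Γ A} {ρ : Env W.D Γ} {x' : Tm Γ' A} {ρ' : Env W.D Γ'}
    (h : W.ev x ρ = W.ev x' ρ') : W.ev (sgl x) ρ = W.ev (sgl x') ρ' := by
  have h1 := ev_one (sgl v0) x ρ
  have h2 := ev_one (sgl v0) x' ρ'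
  rw [← h] at h2
  exact h1.trans h2.symm

theorem isFun_comp {X : Tm Γ (.pow A)} {Y : Tm Γ (.pow B)} {Z : Tm Γ (.pow C)}
    {F : Tm Γ (.rel A B)} {G : Tm Γ (.rel B C)} {ρ : Env W.D Γ} (hF : W.sat (isFun X Y F) ρ)
    (hG : W.sat (isFun Y Z G) ρ) : W.sat (isFun X Z (comp G F)) ρ := by
  refine isFun_intro (.and (isFun X Y F) (isFun Y Z G)) ?_ ?_ ?_ ((sat_and _ _ _).2 ⟨hF, hG⟩) <;>
    (intro W ρ h; obtain ⟨hF, hG⟩ := (sat_and _ _ _).1 h; simp only [ev_comp, mem_cmp])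
  · rintro a b ⟨c, h, h'⟩
    exact ⟨(isFun_dom hF h).1, (isFun_dom hG h').2⟩
  · intro a ha
    obtain ⟨b, hb⟩ := isFun_total hF ha
    obtain ⟨c, hc⟩ := isFun_total hG (isFun_dom hF hb).2
    exact ⟨c, b, hb, hc⟩
  · rintro a b b' ⟨c, h1, h2⟩ ⟨c', h1', h2'⟩
    obtain rfl := isFun_unique hF h1 h1'
    exact isFun_unique hG h2 h2'

section
variable {X : Tm Γ (.pow A)} {F : Tm Γ (.rel A A)} {ρ : Env W.D Γ}

theorem isFun_itr_mem (hF : W.sat (isFun X X F) ρ) {x y : W.D A} {k : W.D .nat}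
    (h : W.Mem (W.P x y) (W.itr (W.ev X ρ) (W.ev F ρ) k)) :
    W.Mem x (W.ev X ρ) ∧ W.Mem y (W.ev X ρ) := by
  have := itr_ind (W := W) (ρ := x ∷ ρ) (X := X.wk) (R := F.wk) (Tm.wk (isFun X X F)) v0
    (.and (.mem v2 X.wk.wk.wk) (.mem v0 X.wk.wk.wk)) (fun W ρ hκ h => ?_)
    (fun W ρ hκ k y z h1 h2 h3 => ?_) (by simpa using hF) (by simpa using h)
  · simpa using this
  · simpa using h
  · obtain ⟨x, ρ, rfl⟩ := ρ.exists_cons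
    simp at hκ h2 h3 ⊢
    exact ⟨h2.1, (isFun_dom hκ h3).2⟩

/-- The iterates of a function are functions. The set of values of the iterate at a fixed point is a
singleton, by induction: unlike the uniqueness statement, the equation of sets is available in Lean
as an induction hypothesis. -/
theorem isFun_iter {k : Tm Γ .nat} (hF : W.sat (isFun X X F) ρ) :
    W.sat (isFun X X (iter X F k)) ρ := by
  refine isFun_intro (isFun X X F) (fun W ρ hκ a b h => isFun_itr_mem hκ (by simpa using h))
    (fun W ρ hκ a ha => ?_) (fun W ρ hκ a b b' h h' => ?_) hF
  · have := nat_ind (W := W) (ρ := a ∷ ρ) (.and (Tm.wk (isFun X X F)) (.mem v0 X.wk))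
      (.ex A (.mem (.pair v2 v0) (iter X.wk.wk.wk F.wk.wk.wk v1))) (fun W ρ hκ => ?_)
      (fun W ρ hκ n h => ?_) (by simpa using ⟨hκ, ha⟩) (W.ev k ρ)
    · simpa using this
    all_goals
      obtain ⟨a, ρ, rfl⟩ := ρ.exists_cons
      simp at hκ
      simp
    · exact ⟨a, itr_zero _ hκ.2⟩
    · simp at h
      obtain ⟨b, h⟩ := h
      obtain ⟨c, h'⟩ := isFun_total hκ.1 (isFun_itr_mem hκ.1 h).2
      exact ⟨c, itr_succ h h'⟩
  · have := itr_ind (W := W) (ρ := a ∷ ρ) (X := X.wk) (R := F.wk) (Tm.wk (isFun X X F)) v0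
      (.eq (img (iter X.wk.wk.wk F.wk.wk.wk v1) v2) (sgl v0))
      (fun W ρ hκ h => ?_) (fun W ρ hκ k y z h1 h2 h3 => ?_) (by simpa using hκ)
      (k := W.ev k ρ) (z := b) (by simpa using h)
    · rw [sat_eq] at this
      have h2 : W.Mem b' (W.ev (sgl v0) (b ∷ W.ev k ρ ∷ a ∷ ρ)) := this ▸ by simpa [img] using h'
      have : b' = b := by simpa [sgl] using h2
      exact this.symm
    · have := ext_intro (W := W) (ρ := ρ) (u := img (iter X.wk F.wk .zero) v0) (v := sgl v0)
        (.mem v0 X.wk) (fun W ρ hκ b => ?_) (by simpa using h)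
      · obtain ⟨x, ρ, rfl⟩ := ρ.exists_cons
        rw [sat_eq]
        exact (ev_img_eq (by simp) (by simp)).trans (this.trans (ev_sgl_eq (by simp)))
      · obtain ⟨x, ρ, rfl⟩ := ρ.exists_cons
        simp at hκ
        simp [itr_zero_iff, img, sgl, hκ, eq_comm]
    · have := ext_intro (W := W) (ρ := z ∷ y ∷ k ∷ ρ)
        (u := img (iter X.wk.wk.wk.wk F.wk.wk.wk.wk (.succ v2)) v3)
        (v := sgl v0) (.and (Tm.wk (Tm.wk (Tm.wk (Tm.wk (isFun X X F))))) (.and (.mem (.pair v1 v0)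
        F.wk.wk.wk.wk) (.eq (img (iter X.wk.wk.wk.wk F.wk.wk.wk.wk v2) v3) (sgl v1))))
        (fun W ρ hκ b => ?_) ?_
      · rw [sat_eq]
        exact (ev_img_eq (by simp) (by simp)).trans (this.trans (ev_sgl_eq (by simp)))
      · obtain ⟨z, ρ, rfl⟩ := ρ.exists_cons
        obtain ⟨y, ρ, rfl⟩ := ρ.exists_cons
        obtain ⟨k, ρ, rfl⟩ := ρ.exists_cons
        obtain ⟨x, ρ, rfl⟩ := ρ.exists_cons
        simp only [sat_and, sat_eq, sat_wk, sat_mem, ev_pair, ev_var, Env.cons_zero,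
          Env.cons_succ, ev_wk] at hκ
        obtain ⟨hκ, h, e⟩ := hκ
        have hy (c) : W.Mem (W.P x c) (W.itr (W.ev X ρ) (W.ev F ρ) k) ↔ c = y := by
          have : W.Mem c (W.ev (img (iter X.wk.wk.wk.wk F.wk.wk.wk.wk v2) v3)
            (z ∷ y ∷ k ∷ x ∷ ρ)) ↔ W.Mem c (W.ev (sgl v1) (z ∷ y ∷ k ∷ x ∷ ρ)) := by rw [e]
          simpa [img, sgl] using this
        simp [img, sgl, itr_succ_iff, hy]
        exact ⟨fun h' => isFun_unique hκ h' h, fun h' => h' ▸ h⟩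
      · rw [sat_eq] at h2
        simp only [sat_and, sat_eq, sat_wk, sat_mem, ev_pair, ev_var, Env.cons_zero,
          Env.cons_succ, ev_wk]
        exact ⟨by obtain ⟨x, ρ, rfl⟩ := ρ.exists_cons; simpa using hκ, by simpa using h3,
          (ev_img_eq (by simp) (by simp)).trans (h2.trans (ev_sgl_eq (by simp)))⟩

end

/-- The element `F` is a function from `X` to `Y`. -/
def Fun (W : World) (X : W.D (.pow A)) (Y : W.D (.pow B)) (F : W.D (.rel A B)) : Prop :=
  W.sat (isFun v0 v1 v2) (X ∷ Y ∷ F ∷ Env.nil)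

theorem sat_isFun (X : Tm Γ (.pow A)) (Y : Tm Γ (.pow B)) (F : Tm Γ (.rel A B))
    (ρ : Env W.D Γ) :
    W.sat (isFun X Y F) ρ ↔ W.Fun (W.ev X ρ) (W.ev Y ρ) (W.ev F ρ) :=
  sat_three (isFun v0 v1 v2) X Y F ρ

section
variable {X : W.D (.pow A)} {Y : W.D (.pow B)} {F : W.D (.rel A B)} {a : W.D A} {b b' : W.D B}

theorem Fun.dom (h : W.Fun X Y F) (hab : W.Mem (W.P a b) F) : W.Mem a X ∧ W.Mem b Y := by
  simpa using isFun_dom h (by simpa using hab)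

theorem Fun.total (h : W.Fun X Y F) (ha : W.Mem a X) : ∃ b, W.Mem (W.P a b) F := by
  simpa using isFun_total h (by simpa using ha)

theorem Fun.unique (h : W.Fun X Y F) (hb : W.Mem (W.P a b) F) (hb' : W.Mem (W.P a b') F) :
    b = b' :=
  isFun_unique h (by simpa using hb) (by simpa using hb')

theorem Fun.cmp {Z : W.D (.pow C)} {G : W.D (.rel B C)} (hF : W.Fun X Y F) (hG : W.Fun Y Z G) :
    W.Fun X Z (W.cmp G F) := by
  have := isFun_comp (W := W) (ρ := X ∷ Y ∷ Z ∷ F ∷ G ∷ Env.nil) (X := v0) (Y := v1) (Z := v2)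
    (F := v3) (G := v4) (by simpa [sat_isFun] using hF) (by simpa [sat_isFun] using hG)
  simpa [sat_isFun] using this

end

section
variable {X : W.D (.pow A)} {F : W.D (.rel A A)} {x y z : W.D A} {j k : W.D .nat}

theorem Fun.itr (hF : W.Fun X X F) (k : W.D .nat) : W.Fun X X (W.itr X F k) := by
  have := isFun_iter (W := W) (ρ := X ∷ F ∷ k ∷ Env.nil) (X := v0) (F := v1) (k := v2)
    (by simpa [sat_isFun] using hF)
  simpa [sat_isFun] using this

theorem Fun.itr_cases_left (hF : W.Fun X X F) (h : W.Mem (W.P x z) (W.itr X F k)) :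
    k = W.Z ∧ x = z ∨
      ∃ j y, k = W.S j ∧ W.Mem (W.P x y) F ∧ W.Mem (W.P y z) (W.itr X F j) := by
  have := itr_ind (W := W) (ρ := x ∷ X ∷ F ∷ Env.nil) (X := v1) (R := v2) (isFun v1 v1 v2) v0
    (.or (.and (.eq v1 .zero) (.eq v2 v0))
      (.ex .nat (.ex A (.and (.eq v3 (.succ v1)) (.and (.mem (.pair v4 v0) v6)
        (.mem (.pair v0 v2) (iter v5 v6 v1))))))) (fun W ρ _ h => ?_)
    (fun W ρ hκ k y z h1 h2 h3 => ?_) (by simpa [sat_isFun] using hF) (k := k) (z := z)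
    (by simpa using h)
  · simpa using this
  · simp
  · simp [sat_isFun] at hκ h2 h3
    simp
    rcases h2 with ⟨rfl, h2⟩ | ⟨j, rfl, w, h2, h4⟩
    · exact ⟨_, h2 ▸ h3, itr_zero _ (hκ.dom h3).2⟩
    · exact ⟨_, h2, itr_succ h4 h3⟩

/-- Of two points in the orbit of `x`, one is in the orbit of the other. -/
theorem Fun.itr_compare (hF : W.Fun X X F) (h : W.Mem (W.P x y) (W.itr X F j))
    (h' : W.Mem (W.P x z) (W.itr X F k)) :
    (∃ i, W.Mem (W.P y z) (W.itr X F i)) ∨ ∃ i, W.Mem (W.P z y) (W.itr X F i) := by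
  have := itr_ind (W := W) (ρ := x ∷ y ∷ j ∷ X ∷ F ∷ Env.nil) (X := v3) (R := v4)
    (.and (isFun v3 v3 v4) (.mem (.pair v0 v1) (iter v3 v4 v2))) v0
    (.or (.ex .nat (.mem (.pair v4 v1) (iter v6 v7 v0)))
      (.ex .nat (.mem (.pair v1 v4) (iter v6 v7 v0)))) (fun W ρ hκ h => ?_)
    (fun W ρ hκ k w z h1 h2 h3 => ?_) (by simpa [sat_isFun] using ⟨hF, h⟩) (k := k) (z := z)
    (by simpa using h')
  · simpa using this
  · simp at hκ ⊢
    exact .inr ⟨_, hκ.2⟩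
  · simp [sat_isFun] at hκ h2 h3 ⊢
    rcases h2 with ⟨i, h2⟩ | ⟨i, h2⟩
    · exact .inl ⟨_, itr_succ h2 h3⟩
    · rcases hκ.1.itr_cases_left h2 with ⟨rfl, rfl⟩ | ⟨i, v, rfl, h4, h5⟩
      · exact .inl ⟨_, itr_succ (itr_zero _ (hκ.1.dom h3).1) h3⟩
      · exact .inr ⟨i, hκ.1.unique h4 h3 ▸ h5⟩

/-- Induction for the iterates of a relation, in classical worlds. The double negation of `φ` is
proved by induction in all worlds. -/
theorem Classical.itr_ind (hW : W.Classical) (κ : Fm Γ) {X : Tm Γ (.pow A)} {R : Tm Γ (.rel A A)}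
    (x : Tm Γ A) (φ : Fm (A :: .nat :: Γ))
    (hzero : ∀ (W : World) (ρ : Env W.D Γ), W.Classical → W.sat κ ρ →
      W.Mem (W.ev x ρ) (W.ev X ρ) → W.sat φ (W.ev x ρ ∷ W.Z ∷ ρ))
    (hsucc : ∀ (W : World) (ρ : Env W.D Γ), W.Classical → W.sat κ ρ → ∀ k y z,
      W.Mem (W.P (W.ev x ρ) y) (W.itr (W.ev X ρ) (W.ev R ρ) k) → W.sat φ (y ∷ k ∷ ρ) →
      W.Mem (W.P y z) (W.ev R ρ) → W.sat φ (z ∷ W.S k ∷ ρ))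
    {ρ : Env W.D Γ} (hκ : W.sat κ ρ) {k : W.D .nat} {z : W.D A}
    (h : W.Mem (W.P (W.ev x ρ) z) (W.itr (W.ev X ρ) (W.ev R ρ) k)) : W.sat φ (z ∷ k ∷ ρ) := by
  have := World.itr_ind κ x (neg (neg φ)) (fun W ρ hκ hx => ?_) (fun W ρ hκ k y z h1 h2 h3 => ?_)
    hκ h
  · rwa [hW.sat_neg_iff, hW.sat_neg_iff, not_not] at this
  · have := neg_neg_intro (W := W) (ρ := W.ev x ρ ∷ W.Z ∷ ρ) (χ := φ) (.and κ.wk.wk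
      (.and (.mem x.wk.wk X.wk.wk) (.and (.eq v0 x.wk.wk) (.eq v1 .zero)))) (fun W ρ hW hκ => ?_)
      (by simpa using ⟨hκ, hx⟩)
    · exact this
    · obtain ⟨y, ρ, rfl⟩ := ρ.exists_cons
      obtain ⟨k, ρ, rfl⟩ := ρ.exists_cons
      simp at hκ
      obtain ⟨h1, h2, rfl, rfl⟩ := hκ
      exact hzero W ρ hW h1 h2
  · -- The statements for `z` and `y` are stated in a common context.
    let σ : Sub (A :: .nat :: Γ) (A :: A :: .nat :: Γ) :=
      Sub.cons v0 (Sub.cons (.succ v2) fun _ x => .var x.succ.succ.succ)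
    let τ : Sub (A :: .nat :: Γ) (A :: A :: .nat :: Γ) :=
      Sub.cons v1 (Sub.cons v2 fun _ x => .var x.succ.succ.succ)
    have hσ (W : World) (ρ : Env W.D Γ) (k y z) (ψ : Fm _) : W.sat (ψ.sub σ)
        (z ∷ y ∷ k ∷ ρ) ↔ W.sat ψ (z ∷ W.S k ∷ ρ) := by
      refine iff_of_eq (congrArg W.tr ((W.ev_sub _ _ _).trans ?_))
      congr 1
      funext C x
      rcases x with _ | _ | x <;> simp [Sub.cons, σ]
    have hτ (W : World) (ρ : Env W.D Γ) (k y z) (ψ : Fm _) : W.sat (ψ.sub τ)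
        (z ∷ y ∷ k ∷ ρ) ↔ W.sat ψ (y ∷ k ∷ ρ) := by
      refine iff_of_eq (congrArg W.tr ((W.ev_sub _ _ _).trans ?_))
      congr 1
      funext C x
      rcases x with _ | _ | x <;> simp [Sub.cons, τ]
    rw [← hσ W ρ k y z]
    rw [← hτ W ρ k y z] at h2
    refine neg_neg_intro (.and κ.wk.wk.wk (.and (.mem (.pair v1 v0) R.wk.wk.wk)
      (.and (.mem (.pair x.wk.wk.wk v1) (iter X.wk.wk.wk R.wk.wk.wk v2)) _)))
      (fun W ρ hW hκ => ?_) ((sat_and _ _ _).2 ⟨by simpa using hκ, (sat_and _ _ _).2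
        ⟨by simpa using h3, (sat_and _ _ _).2 ⟨by simpa using h1, h2⟩⟩⟩)
    obtain ⟨z, ρ, rfl⟩ := ρ.exists_cons
    obtain ⟨y, ρ, rfl⟩ := ρ.exists_cons
    obtain ⟨k, ρ, rfl⟩ := ρ.exists_cons
    simp only [sat_and, sat_wk, sat_mem, ev_pair, ev_var, Env.cons_zero, Env.cons_succ, ev_wk,
      ev_iter] at hκ
    obtain ⟨hκ, h1, h2, h3⟩ := hκ
    have h3 := (hτ W ρ k y z _).1 h3
    rw [hW.sat_neg_iff, hW.sat_neg_iff, not_not] at h3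
    exact (hσ W ρ k y z _).2 (hsucc W ρ hW hκ k y z h2 h3 h1)

end

end World

/-! ### The sequence of modifications -/

/-- The set of all elements. -/
def full {Γ : Ctx} {A : Ty} : Tm Γ (.pow A) := .compr A .top

/-- A stage `(n, (F, G))` of the construction: its number and the current relations. -/
abbrev Ty.stage : Ty := .prod .nat (.prod (.rel .seq .seq) (.rel .seq .seq))

/-- The function from each stage to the next one. At stage `n`, first `G` and then `F` is modified
at the point `n`. -/
def next {Γ : Ctx} : Tm Γ (.rel .stage .stage) :=
  .compr (.prod .stage .stage) (.ex .nat (.ex (.rel .seq .seq) (.ex (.rel .seq .seq)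
    (.eq v3 (.pair (.pair v2 (.pair v1 v0)) (.pair (.succ v2)
      (.pair (step (ofNat v2) (step (ofNat v2) v1 v0) v1) (step (ofNat v2) v1 v0))))))))

/-- The formula saying that `F` and `G` are the relations at stage `k`. At the initial stage, `f`
and `g` have already been modified at the point `∞`. -/
def stageFm {Γ : Ctx} (f g : Tm Γ (.rel .seq .seq)) (k : Tm Γ .nat) (F G : Tm Γ (.rel .seq .seq)) :
    Fm Γ :=
  .mem (.pair (.pair .zero (.pair (step infty (step infty f g) f) (step infty f g)))
    (.pair k (.pair F G))) (iter full next k)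

/-- At some stage, `F a = b` and `G b = a`. -/
def matchedFm {Γ : Ctx} (f g : Tm Γ (.rel .seq .seq)) (a b : Tm Γ .seq) : Fm Γ :=
  .ex .nat (.ex (.rel .seq .seq) (.ex (.rel .seq .seq)
    (.and (stageFm f.wk.wk.wk g.wk.wk.wk v2 v1 v0) (.and (.mem (.pair a.wk.wk.wk b.wk.wk.wk) v1)
      (.mem (.pair b.wk.wk.wk a.wk.wk.wk) v0)))))

/-- The double negation of `matchedFm`. -/
def linkedFm {Γ : Ctx} (f g : Tm Γ (.rel .seq .seq)) (a b : Tm Γ .seq) : Fm Γ :=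
  neg (neg (matchedFm f g a b))

namespace World

variable {W : World} {Γ : Ctx} {A B C : Ty}

@[simp] theorem mem_full (a : W.D A) (ρ : Env W.D Γ) : W.Mem a (W.ev full ρ) := by simp [full]

/-- The function `next` in a world. -/
def nxt (W : World) : W.D (.rel .stage .stage) := W.ev next Env.nil

@[simp] theorem ev_next (ρ : Env W.D Γ) : W.ev next ρ = W.nxt := by
  -- Both sides have the same elements. This avoids the computation of a large substitution.
  let σ : Sub [] Γ := fun _ x => nomatch x
  have h (W : World) (ρ : Env W.D Γ) : W.ev (next.sub σ) ρ = W.ev next Env.nil :=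
    (W.ev_sub _ _ _).trans (congrArg _ (Env.eq_nil _))
  refine (ext_intro (v := next.sub σ) .top (fun W ρ _ p => ?_) (sat_top ρ)).trans (h W ρ)
  rw [h]
  simp [next]

/-- The set of all elements of a world. -/
def Full (W : World) {A : Ty} : W.D (.pow A) := W.ev full Env.nil

@[simp] theorem ev_full (ρ : Env W.D Γ) : W.ev (full (A := A)) ρ = W.Full :=
  ev_closed (full (A := A)) ρ

@[simp] theorem mem_Full (a : W.D A) : W.Mem a W.Full := mem_full a Env.nil

theorem mem_nxt {s t : W.D .stage} : W.Mem (W.P s t) W.nxt ↔ ∃ n F G, s = W.P n (W.P F G) ∧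
    t = W.P (W.S n) (W.P (W.stp (W.nn n) (W.stp (W.nn n) F G) F) (W.stp (W.nn n) F G)) := by
  simp [nxt, next]

theorem fun_nxt : W.Fun W.Full W.Full W.nxt := by
  have := isFun_intro (W := W) (X := full) (Y := full) (F := next) (ρ := Env.nil) .top
    (by simp) (fun W ρ _ s _ => ?_) (fun W ρ _ s t t' h h' => ?_) (sat_top _)
  · simpa [sat_isFun] using this
  · obtain ⟨n, p, rfl⟩ := exists_P s
    obtain ⟨F, G, rfl⟩ := exists_P p
    exact ⟨_, by rw [ev_next, mem_nxt]; exact ⟨_, _, _, rfl, rfl⟩⟩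
  · rw [ev_next, mem_nxt] at h h'
    obtain ⟨n, F, G, rfl, rfl⟩ := h
    obtain ⟨n', F', G', e, rfl⟩ := h'
    simp only [P_inj] at e
    obtain ⟨rfl, rfl, rfl⟩ := e
    rfl

/-- The initial stage. -/
def start (W : World) (f g : W.D (.rel .seq .seq)) : W.D .stage :=
  W.P W.Z (W.P (W.stp W.inf (W.stp W.inf f g) f) (W.stp W.inf f g))

/-- The relations at stage `k` are `F` and `G`. -/
def Stage (W : World) (f g : W.D (.rel .seq .seq)) (k : W.D .nat) (F G : W.D (.rel .seq .seq)) :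
    Prop :=
  W.Mem (W.P (W.start f g) (W.P k (W.P F G))) (W.itr W.Full W.nxt k)

@[simp] theorem sat_stageFm (f g : Tm Γ (.rel .seq .seq)) (k : Tm Γ .nat)
    (F G : Tm Γ (.rel .seq .seq)) (ρ : Env W.D Γ) :
    W.sat (stageFm f g k F G) ρ ↔
      W.Stage (W.ev f ρ) (W.ev g ρ) (W.ev k ρ) (W.ev F ρ) (W.ev G ρ) := by
  simp [stageFm, Stage, start]

/-- The points `a` and `b` are matched by the relations at some stage. -/
def Matched (W : World) (f g : W.D (.rel .seq .seq)) (a b : W.D .seq) : Prop :=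
  ∃ k F G, W.Stage f g k F G ∧ W.Mem (W.P a b) F ∧ W.Mem (W.P b a) G

@[simp] theorem sat_matchedFm (f g : Tm Γ (.rel .seq .seq)) (a b : Tm Γ .seq) (ρ : Env W.D Γ) :
    W.sat (matchedFm f g a b) ρ ↔
      W.Matched (W.ev f ρ) (W.ev g ρ) (W.ev a ρ) (W.ev b ρ) := by
  simp [matchedFm, Matched]

/-- The double negation of `Matched` in the object language. -/
def Linked (W : World) (f g : W.D (.rel .seq .seq)) (a b : W.D .seq) : Prop :=
  W.sat (linkedFm v0 v1 v2 v3) (f ∷ g ∷ a ∷ b ∷ Env.nil)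

@[simp] theorem sat_linkedFm (f g : Tm Γ (.rel .seq .seq)) (a b : Tm Γ .seq) (ρ : Env W.D Γ) :
    W.sat (linkedFm f g a b) ρ ↔ W.Linked (W.ev f ρ) (W.ev g ρ) (W.ev a ρ) (W.ev b ρ) := by
  let σ : Sub [.rel .seq .seq, .rel .seq .seq, .seq, .seq] Γ :=
    Sub.cons f (Sub.cons g (Sub.cons a (Sub.cons b fun _ x => nomatch x)))
  have h (W : World) (ρ : Env W.D Γ) : W.sat (matchedFm f g a b) ρ ↔
      W.sat ((matchedFm v0 v1 v2 v3).sub σ) ρ :=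
    .trans (by simp) (sat_four (matchedFm v0 v1 v2 v3) f g a b ρ).symm
  have h' := sat_four (neg (neg (matchedFm v0 v1 v2 v3))) f g a b ρ
  refine Iff.trans ?_ h'
  exact ⟨neg_neg_mono fun W ρ => (h W ρ).1, neg_neg_mono fun W ρ => (h W ρ).2⟩

section
variable {f g F G F' G' : W.D (.rel .seq .seq)} {a a' b b' p u : W.D .seq} {j k : W.D .nat}

theorem Classical.linked_iff (hW : W.Classical) : W.Linked f g a b ↔ W.Matched f g a b := by
  rw [Linked, linkedFm, hW.sat_neg_iff, hW.sat_neg_iff, not_not]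
  simp

theorem Stage.unique (h : W.Stage f g k F G) (h' : W.Stage f g k F' G') : F = F' ∧ G = G' := by
  simpa using (fun_nxt.itr k).unique h h'

theorem stage_zero : W.Stage f g W.Z (W.stp W.inf (W.stp W.inf f g) f) (W.stp W.inf f g) :=
  itr_zero _ (by simp)

theorem Stage.succ (h : W.Stage f g k F G) : W.Stage f g (W.S k)
    (W.stp (W.nn k) (W.stp (W.nn k) F G) F) (W.stp (W.nn k) F G) :=
  itr_succ h (mem_nxt.2 ⟨_, _, _, rfl, rfl⟩)

/-- The relations at each stage are injections. -/
theorem inj_of_mem_itr (hf : W.Inj f) (hg : W.Inj g) {s : W.D .stage}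
    (h : W.Mem (W.P (W.start f g) s) (W.itr W.Full W.nxt k)) :
    ∃ F G, s = W.P k (W.P F G) ∧ W.Inj F ∧ W.Inj G := by
  have := itr_ind (W := W) (ρ := W.start f g ∷ f ∷ g ∷ Env.nil) (X := full) (R := next)
    (.and (.eq v0 (.pair .zero (.pair (step infty (step infty v1 v2) v1) (step infty v1 v2))))
      (.and (isInj conat v1) (isInj conat v2))) v0
    (.ex (.rel .seq .seq) (.ex (.rel .seq .seq) (.and (.eq v2 (.pair v3 (.pair v1 v0)))
      (.and (isInj conat v1) (isInj conat v0))))) (fun W ρ hκ h => ?_)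
    (fun W ρ hκ k s t h1 h2 h3 => ?_) (by simpa [start] using ⟨hf, hg⟩) (k := k) (z := s)
    (by simpa using h)
  · simpa using this
  · simp at hκ ⊢
    obtain ⟨h, hf, hg⟩ := hκ
    exact ⟨_, _, h, .stp inf_mem_X (.stp inf_mem_X hf hg) hf, .stp inf_mem_X hf hg⟩
  · simp at h2
    rw [ev_next, mem_nxt] at h3
    obtain ⟨F, G, rfl, hF, hG⟩ := h2
    obtain ⟨_, _, _, e, rfl⟩ := h3
    simp only [P_inj] at e
    obtain ⟨rfl, rfl, rfl⟩ := e
    simp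
    exact ⟨.stp (nn_mem_X _) (.stp (nn_mem_X _) hF hG) hF, .stp (nn_mem_X _) hF hG⟩

theorem Stage.inj (h : W.Stage f g k F G) (hf : W.Inj f) (hg : W.Inj g) :
    W.Inj F ∧ W.Inj G := by
  obtain ⟨F', G', e, h⟩ := inj_of_mem_itr hf hg h
  simp at e
  exact e.1 ▸ e.2 ▸ h

theorem exists_stage (hf : W.Inj f) (hg : W.Inj g) (k : W.D .nat) : ∃ F G, W.Stage f g k F G := by
  obtain ⟨s, h⟩ := (fun_nxt.itr k).total (mem_Full (W.start f g))
  obtain ⟨F, G, rfl, -⟩ := inj_of_mem_itr hf hg h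
  exact ⟨F, G, h⟩

/-! ### Matched points -/

/-- The modification at `u` matches `u` with its image. -/
theorem Classical.matched_step_left (hW : W.Classical) (hF : W.Inj F) (hG : W.Inj G)
    (hp : W.Mem (W.P u p) F) : W.Mem (W.P u p) (W.stp u (W.stp u F G) F) ∧
      W.Mem (W.P p u) (W.stp u F G) := by
  have h := hW.mem_stp_self hF hG hp
  exact ⟨hW.mem_stp_of_mem (.stp (hF.dom hp) hF hG) hF (hF.dom hp) h hp, h⟩

/-- The modification at `u` matches some point with `u`. -/
theorem Classical.matched_step_right (hW : W.Classical) (hF : W.Inj F) (hG : W.Inj G)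
    (hu : W.Mem u W.X) : ∃ q, W.Mem (W.P q u) (W.stp u (W.stp u F G) F) ∧
      W.Mem (W.P u q) (W.stp u F G) := by
  have h := Inj.stp hu hF hG
  obtain ⟨q, hq⟩ := h.total hu
  exact ⟨q, hW.mem_stp_self h hF hq, hq⟩

/-- The point `n` is matched, on both sides, at the stage after `n`. -/
theorem Classical.matched_nn (hW : W.Classical) (hf : W.Inj f) (hg : W.Inj g)
    (h : W.Stage f g (W.S k) F G) :
    (∃ p, W.Mem (W.P (W.nn k) p) F ∧ W.Mem (W.P p (W.nn k)) G) ∧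
      ∃ q, W.Mem (W.P q (W.nn k)) F ∧ W.Mem (W.P (W.nn k) q) G := by
  obtain ⟨F', G', h'⟩ := exists_stage hf hg k
  obtain ⟨hF, hG⟩ := h'.inj hf hg
  obtain ⟨rfl, rfl⟩ := h.unique h'.succ
  obtain ⟨p, hp⟩ := hF.total (nn_mem_X k)
  exact ⟨⟨p, hW.matched_step_left hF hG hp⟩, hW.matched_step_right hF hG (nn_mem_X k)⟩

/-- Matched points stay matched at later stages. -/
theorem Classical.matched_of_itr (hW : W.Classical) (hF : W.Inj F) (hG : W.Inj G)
    (hab : W.Mem (W.P a b) F) (hba : W.Mem (W.P b a) G) {i : W.D .nat}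
    (h : W.Mem (W.P (W.P j (W.P F G)) (W.P k (W.P F' G'))) (W.itr W.Full W.nxt i)) :
    W.Mem (W.P a b) F' ∧ W.Mem (W.P b a) G' := by
  have := hW.itr_ind (ρ := W.P j (W.P F G) ∷ j ∷ F ∷ G ∷ a ∷ b ∷ Env.nil) (X := full) (R := next)
    (.and (.eq v0 (.pair v1 (.pair v2 v3))) (.and (.and (isInj conat v2) (isInj conat v3))
      (.and (.mem (.pair v4 v5) v2) (.mem (.pair v5 v4) v3)))) v0
    (.ex .nat (.ex (.rel .seq .seq) (.ex (.rel .seq .seq) (.and (.eq v3 (.pair v2 (.pair v1 v0)))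
      (.and (.and (isInj conat v1) (isInj conat v0))
        (.and (.mem (.pair v4.wk.wk.wk.wk.wk v5.wk.wk.wk.wk.wk) v1)
          (.mem (.pair v5.wk.wk.wk.wk.wk v4.wk.wk.wk.wk.wk) v0))))))) (fun W ρ hW hκ h => ?_)
    (fun W ρ hW hκ k s t h1 h2 h3 => ?_) (by simpa using ⟨⟨hF, hG⟩, hab, hba⟩) (k := i)
    (z := W.P k (W.P F' G')) (by simpa using h)
  · simp at this
    exact this.2
  · simp at hκ ⊢
    exact ⟨_, _, _, hκ⟩
  · simp at h2
    rw [ev_next, mem_nxt] at h3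
    obtain ⟨n, F, G, rfl, ⟨hF, hG⟩, h4, h5⟩ := h2
    obtain ⟨_, _, _, e, rfl⟩ := h3
    simp only [P_inj] at e
    obtain ⟨rfl, rfl, rfl⟩ := e
    simp
    have h6 := Inj.stp (nn_mem_X n) hF hG
    have h7 := hW.mem_stp_of_mem hF hG (nn_mem_X n) h4 h5
    exact ⟨⟨.stp (nn_mem_X n) h6 hF, h6⟩,
      hW.mem_stp_of_mem h6 hF (nn_mem_X n) h7 h4, h7⟩

/-- Two pairs of matched points are matched at a common stage. -/
theorem Classical.matched_common (hW : W.Classical) (hf : W.Inj f) (hg : W.Inj g)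
    (h : W.Matched f g a b) (h' : W.Matched f g a' b') : ∃ F G, W.Inj F ∧ W.Inj G ∧
      (W.Mem (W.P a b) F ∧ W.Mem (W.P b a) G) ∧ W.Mem (W.P a' b') F ∧ W.Mem (W.P b' a') G := by
  obtain ⟨j, F, G, h, hab, hba⟩ := h
  obtain ⟨k, F', G', h', hab', hba'⟩ := h'
  obtain ⟨hF, hG⟩ := h.inj hf hg
  obtain ⟨hF', hG'⟩ := h'.inj hf hg
  rcases fun_nxt.itr_compare h h' with ⟨i, hi⟩ | ⟨i, hi⟩
  · exact ⟨F', G', hF', hG', hW.matched_of_itr hF hG hab hba hi, hab', hba'⟩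
  · exact ⟨F, G, hF, hG, ⟨hab, hba⟩, hW.matched_of_itr hF' hG' hab' hba' hi⟩

theorem Classical.matched_unique (hW : W.Classical) (hf : W.Inj f) (hg : W.Inj g)
    (h : W.Matched f g a b) (h' : W.Matched f g a b') : b = b' := by
  obtain ⟨F, G, hF, hG, h, h'⟩ := hW.matched_common hf hg h h'
  exact hF.unique h.1 h'.1

theorem Classical.matched_inj (hW : W.Classical) (hf : W.Inj f) (hg : W.Inj g)
    (h : W.Matched f g a b) (h' : W.Matched f g a' b) : a = a' := by
  obtain ⟨F, G, hF, hG, h, h'⟩ := hW.matched_common hf hg h h'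
  exact hF.inj h.1 h'.1

theorem Classical.matched_inf (hW : W.Classical) (hf : W.Inj f) (hg : W.Inj g)
    (h : W.Mem (W.P W.inf b) f) : W.Matched f g W.inf b :=
  ⟨_, _, _, stage_zero, hW.matched_step_left hf hg h⟩

theorem Classical.exists_matched_left (hW : W.Classical) (hf : W.Inj f) (hg : W.Inj g)
    (ha : W.Mem a W.X) : ∃ b, W.Mem b W.X ∧ W.Matched f g a b := by
  rcases hW.eq_or ha with rfl | ⟨k, rfl⟩
  · obtain ⟨b, hb⟩ := hf.total ha
    exact ⟨b, hf.ran hb, hW.matched_inf hf hg hb⟩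
  · obtain ⟨F, G, h⟩ := exists_stage hf hg (W.S k)
    obtain ⟨b, hb⟩ := (hW.matched_nn hf hg h).1
    exact ⟨b, (h.inj hf hg).1.ran hb.1, _, _, _, h, hb⟩

theorem Classical.exists_matched_right (hW : W.Classical) (hf : W.Inj f) (hg : W.Inj g)
    (hb : W.Mem b W.X) : ∃ a, W.Mem a W.X ∧ W.Matched f g a b := by
  rcases hW.eq_or hb with rfl | ⟨k, rfl⟩
  · obtain ⟨a, ha⟩ := hW.matched_step_right hf hg hb
    exact ⟨a, (Inj.stp hb hf hg).ran ha.2, _, _, _, stage_zero, ha⟩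
  · obtain ⟨F, G, h⟩ := exists_stage hf hg (W.S k)
    obtain ⟨a, ha⟩ := (hW.matched_nn hf hg h).2
    exact ⟨a, (h.inj hf hg).1.dom ha.1, _, _, _, h, ha⟩

end

end World

/-! ### The bijection -/

/-- The bijection of the strong Myhill property: it relates the points that are not not matched at
some stage. -/
def myhill {Γ : Ctx} (f g : Tm Γ (.rel .seq .seq)) : Tm Γ (.rel .seq .seq) :=
  .compr (.prod .seq .seq) (.ex .seq (.ex .seq (.and (.eq v2 (.pair v1 v0))
    (.and (.mem v1 conat) (.and (.mem v0 conat) (linkedFm f.wk.wk.wk g.wk.wk.wk v1 v0))))))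

namespace World

variable {W : World} {Γ : Ctx} {A B C : Ty}

/-- The relation `myhill` in a world. -/
def Myhill (W : World) (f g : W.D (.rel .seq .seq)) : W.D (.rel .seq .seq) :=
  W.ev (myhill v0 v1) (f ∷ g ∷ Env.nil)

@[simp] theorem mem_Myhill {f g : W.D (.rel .seq .seq)} {a b : W.D .seq} :
    W.Mem (W.P a b) (W.Myhill f g) ↔ W.Mem a W.X ∧ W.Mem b W.X ∧ W.Linked f g a b := by
  simp only [Myhill, myhill, mem_compr, sat_ex, sat_and, sat_eq, sat_mem, ev_pair, ev_wk, ev_var,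
    Env.cons_zero, Env.cons_succ, P_inj, ev_conat, sat_linkedFm]
  constructor
  · rintro ⟨_, _, ⟨rfl, rfl⟩, h⟩
    exact h
  · intro h
    exact ⟨_, _, ⟨rfl, rfl⟩, h⟩

@[simp] theorem ev_myhill (f g : Tm Γ (.rel .seq .seq)) (ρ : Env W.D Γ) :
    W.ev (myhill f g) ρ = W.Myhill (W.ev f ρ) (W.ev g ρ) := by
  have h (W : World) (ρ : Env W.D Γ) := ev_two (W := W) (myhill v0 v1) f g ρ
  refine (ext_intro .top (fun W ρ _ p => ?_) (sat_top ρ)).trans (h W ρ)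
  rw [h]
  simp [myhill]

theorem linked_stable {f g : Tm Γ (.rel .seq .seq)} {a b : Tm Γ .seq} {ρ : Env W.D Γ}
    (h : W.sat (neg (neg (linkedFm f g a b))) ρ) : W.sat (linkedFm f g a b) ρ :=
  sat_of_entails _ (.impI (.impE (.tail .head) (.impI (.impE .head (.tail .head))))) h

section
variable {f g F G F' G' : W.D (.rel .seq .seq)} {a a' b b' p u : W.D .seq} {j k : W.D .nat}

/-- At the stage after `k`, it is decidable whether the point `a` is matched with `k`. -/
theorem Stage.dec_left (h : W.Stage f g (W.S k) F G) (hf : W.Inj f) (hg : W.Inj g)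
    (ha : W.Mem a W.X) : W.Dec (.ex (.rel .seq .seq) (.ex (.rel .seq .seq) (.and
      (stageFm v4 v5 (.succ v2) v1 v0) (.mem (.pair (ofNat v2) v3) v0))))
      (k ∷ a ∷ f ∷ g ∷ Env.nil) := by
  obtain ⟨hF, hG⟩ := h.inj hf hg
  obtain ⟨x, hx⟩ := hG.total (nn_mem_X k)
  rcases (hG.decPt_right hx (decPt_nn k)).eq_or ha with rfl | hne
  · exact .inl (by simpa using ⟨_, _, h, hx⟩)
  · right
    refine neg_intro' (.ex .seq (.ex (.rel .seq .seq) (.ex (.rel .seq .seq)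
      (.and (stageFm v5 v6 (.succ v3) v1 v0) (.and (isInj conat v0)
      (.and (.mem (.pair (ofNat v3) v2) v0) (neg (.eq v4 v2)))))))) ?_
      (by simpa using ⟨_, _, _, h, hG, hx, hne⟩)
    intro W ρ hW h h'
    simp at h h'
    obtain ⟨x, F, G, h, hG, hx, hne⟩ := h
    obtain ⟨F', G', h', hx'⟩ := h'
    obtain ⟨rfl, rfl⟩ := h.unique h'
    exact hne.ne (hG.unique hx' hx)

/-- At the stage after `k`, it is decidable whether `k` is matched with the point `b`. -/
theorem Stage.dec_right (h : W.Stage f g (W.S k) F G) (hf : W.Inj f) (hg : W.Inj g)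
    (hb : W.Mem b W.X) : W.Dec (.ex (.rel .seq .seq) (.ex (.rel .seq .seq) (.and
      (stageFm v4 v5 (.succ v2) v1 v0) (.mem (.pair (ofNat v2) v3) v1))))
      (k ∷ b ∷ f ∷ g ∷ Env.nil) := by
  obtain ⟨hF, hG⟩ := h.inj hf hg
  obtain ⟨x, hx⟩ := hF.total (nn_mem_X k)
  rcases (hF.decPt_right hx (decPt_nn k)).eq_or hb with rfl | hne
  · exact .inl (by simpa using ⟨_, ⟨_, h⟩, hx⟩)
  · right
    refine neg_intro' (.ex .seq (.ex (.rel .seq .seq) (.ex (.rel .seq .seq)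
      (.and (stageFm v5 v6 (.succ v3) v1 v0) (.and (isInj conat v1)
      (.and (.mem (.pair (ofNat v3) v2) v1) (neg (.eq v4 v2)))))))) ?_
      (by simpa using ⟨_, _, ⟨_, h⟩, hF, hx, hne⟩)
    intro W ρ hW h h'
    simp at h h'
    obtain ⟨x, F, ⟨G, h⟩, hF, hx, hne⟩ := h
    obtain ⟨F', ⟨G', h'⟩, hx'⟩ := h'
    obtain ⟨rfl, rfl⟩ := h.unique h'
    exact hne.ne (hF.unique hx' hx)

/-- The relation `G` at the stage after `k` finds the point that is matched with `k`. -/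
theorem Classical.stage_left_iff (hW : W.Classical) (hf : W.Inj f) (hg : W.Inj g) :
    (∃ F G, W.Stage f g (W.S k) F G ∧ W.Mem (W.P (W.nn k) a) G) ↔
      W.Matched f g a (W.nn k) := by
  constructor
  · rintro ⟨F, G, h, ha⟩
    obtain ⟨q, hq⟩ := (hW.matched_nn hf hg h).2
    obtain rfl := (h.inj hf hg).2.unique ha hq.2
    exact ⟨_, _, _, h, hq⟩
  · intro h'
    obtain ⟨F, G, h⟩ := exists_stage hf hg (W.S k)
    obtain ⟨q, hq⟩ := (hW.matched_nn hf hg h).2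
    obtain rfl := hW.matched_inj hf hg h' ⟨_, _, _, h, hq⟩
    exact ⟨_, _, h, hq.2⟩

/-- The relation `F` at the stage after `k` finds the point that `k` is matched with. -/
theorem Classical.stage_right_iff (hW : W.Classical) (hf : W.Inj f) (hg : W.Inj g) :
    (∃ F G, W.Stage f g (W.S k) F G ∧ W.Mem (W.P (W.nn k) b) F) ↔
      W.Matched f g (W.nn k) b := by
  constructor
  · rintro ⟨F, G, h, hb⟩
    obtain ⟨p, hp⟩ := (hW.matched_nn hf hg h).1
    obtain rfl := (h.inj hf hg).1.unique hb hp.1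
    exact ⟨_, _, _, h, hp⟩
  · intro h'
    obtain ⟨F, G, h⟩ := exists_stage hf hg (W.S k)
    obtain ⟨p, hp⟩ := (hW.matched_nn hf hg h).1
    obtain rfl := hW.matched_unique hf hg h' ⟨_, _, _, h, hp⟩
    exact ⟨_, _, h, hp.1⟩

theorem exists_linked_left (hf : W.Inj f) (hg : W.Inj g) (ha : W.Mem a W.X) :
    ∃ b, W.Mem b W.X ∧ W.Linked f g a b := by
  have := exists_intro (W := W) (ρ := a ∷ f ∷ g ∷ Env.nil)
    (.and (isInj conat v1) (.and (isInj conat v2) (.mem v0 conat))) (linkedFm v2 v3 v1 v0)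
    (.ex (.rel .seq .seq) (.ex (.rel .seq .seq) (.and
      (stageFm v4 v5 (.succ v2) v1 v0) (.mem (.pair (ofNat v2) v3) v0))))
    ?_ (fun _ _ _ _ _ => linked_stable) ?_ ?_ ?_ (by simpa using ⟨hf, hg, ha⟩)
  · simpa using this
  all_goals
    intro W ρ
    obtain ⟨a, ρ, rfl⟩ := ρ.exists_cons
    obtain ⟨f, ρ, rfl⟩ := ρ.exists_cons
    obtain ⟨g, ρ, rfl⟩ := ρ.exists_cons
    obtain rfl := ρ.eq_nil
    simp only [sat_and, sat_isInj, sat_mem, ev_var, Env.cons_zero, Env.cons_succ, ev_conat,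
      sat_linkedFm]
  · rintro ⟨hf, hg, ha⟩ k
    obtain ⟨F, G, h⟩ := exists_stage hf hg (W.S k)
    exact h.dec_left hf hg ha
  · rintro hW ⟨hf, hg, ha⟩ k
    rw [hW.linked_iff, ← hW.stage_left_iff hf hg]
    simp
  · rintro hW ⟨hf, hg, ha⟩ y y' h h'
    exact hW.matched_unique hf hg (hW.linked_iff.1 h) (hW.linked_iff.1 h')
  · rintro hW ⟨hf, hg, ha⟩
    simpa only [hW.linked_iff] using hW.exists_matched_left hf hg ha

theorem exists_linked_right (hf : W.Inj f) (hg : W.Inj g) (hb : W.Mem b W.X) :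
    ∃ a, W.Mem a W.X ∧ W.Linked f g a b := by
  have := exists_intro (W := W) (ρ := b ∷ f ∷ g ∷ Env.nil)
    (.and (isInj conat v1) (.and (isInj conat v2) (.mem v0 conat))) (linkedFm v2 v3 v0 v1)
    (.ex (.rel .seq .seq) (.ex (.rel .seq .seq) (.and
      (stageFm v4 v5 (.succ v2) v1 v0) (.mem (.pair (ofNat v2) v3) v1))))
    ?_ (fun _ _ _ _ _ => linked_stable) ?_ ?_ ?_ (by simpa using ⟨hf, hg, hb⟩)
  · simpa using this
  all_goals
    intro W ρ
    obtain ⟨b, ρ, rfl⟩ := ρ.exists_cons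
    obtain ⟨f, ρ, rfl⟩ := ρ.exists_cons
    obtain ⟨g, ρ, rfl⟩ := ρ.exists_cons
    obtain rfl := ρ.eq_nil
    simp only [sat_and, sat_isInj, sat_mem, ev_var, Env.cons_zero, Env.cons_succ, ev_conat,
      sat_linkedFm]
  · rintro ⟨hf, hg, hb⟩ k
    obtain ⟨F, G, h⟩ := exists_stage hf hg (W.S k)
    exact h.dec_right hf hg hb
  · rintro hW ⟨hf, hg, hb⟩ k
    rw [hW.linked_iff, ← hW.stage_right_iff hf hg]
    simp
  · rintro hW ⟨hf, hg, hb⟩ y y' h h'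
    exact hW.matched_inj hf hg (hW.linked_iff.1 h) (hW.linked_iff.1 h')
  · rintro hW ⟨hf, hg, hb⟩
    simpa only [hW.linked_iff] using hW.exists_matched_right hf hg hb

end

theorem sat_isBij_myhill {f g : Tm Γ (.rel .seq .seq)} {ρ : Env W.D Γ} (hf : W.Inj (W.ev f ρ))
    (hg : W.Inj (W.ev g ρ)) : W.sat (isBij conat (myhill f g)) ρ := by
  have hκ : W.sat (.and (isInj conat f) (isInj conat g)) ρ := by simpa using ⟨hf, hg⟩
  refine (sat_and _ _ _).2 ⟨?_, allIn_intro _ (fun W ρ hκ b hb => ?_) hκ⟩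
  · rw [sat_isInj]
    refine inj_intro _ ?_ ?_ ?_ ?_ hκ <;> intro W ρ <;> simp
    · tauto
    · intro hf hg a ha
      obtain ⟨b, hb⟩ := exists_linked_left hf hg ha
      exact ⟨ha, b, hb⟩
    · intro hW hf hg a b b' _ _ h _ _ h'
      exact hW.matched_unique hf hg (hW.linked_iff.1 h) (hW.linked_iff.1 h')
    · intro hW hf hg a a' b _ _ h _ _ h'
      exact hW.matched_inj hf hg (hW.linked_iff.1 h) (hW.linked_iff.1 h')
  · simp at hκ hb
    obtain ⟨a, ha, h⟩ := exists_linked_right hκ.1 hκ.2 hb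
    rw [sat_ex]
    refine ⟨a, ?_⟩
    simpa using ⟨ha, hb, h⟩

end World

/-- The sets `U` and `V` agree along the graph of `F`. -/
def colorFm {Γ : Ctx} (U V : Tm Γ (.pow .seq)) (F : Tm Γ (.rel .seq .seq)) : Fm Γ :=
  .all .seq (.all .seq (neg (.and (.mem (.pair v1 v0) F.wk.wk)
    (.or (.and (.mem v1 U.wk.wk) (neg (.mem v0 V.wk.wk)))
      (.and (neg (.mem v1 U.wk.wk)) (.mem v0 V.wk.wk))))))

namespace World

variable {W : World} {Γ : Ctx} {A B C : Ty}

/-! ### Invariant sets -/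

/-- The sets `U` and `V` agree along the graph of `F`. -/
def Color (W : World) (U V : W.D (.pow .seq)) (F : W.D (.rel .seq .seq)) : Prop :=
  W.sat (colorFm v0 v1 v2) (U ∷ V ∷ F ∷ Env.nil)

@[simp] theorem sat_colorFm (U V : Tm Γ (.pow .seq)) (F : Tm Γ (.rel .seq .seq))
    (ρ : Env W.D Γ) :
    W.sat (colorFm U V F) ρ ↔ W.Color (W.ev U ρ) (W.ev V ρ) (W.ev F ρ) :=
  sat_three (colorFm v0 v1 v2) U V F ρ

theorem Color.iff {U V : W.D (.pow .seq)} {F : W.D (.rel .seq .seq)} (h : W.Color U V F)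
    (hW : W.Classical) {a b : W.D .seq} (hab : W.Mem (W.P a b) F) :
    W.Mem a U ↔ W.Mem b V := by
  have := sat_all (sat_all h a) b
  rw [hW.sat_neg_iff] at this
  simp [hW.sat_neg_iff] at this
  tauto

theorem color_intro (κ : Fm Γ) {U V : Tm Γ (.pow .seq)} {F : Tm Γ (.rel .seq .seq)}
    (h : ∀ (W : World) (ρ : Env W.D Γ), W.Classical → W.sat κ ρ → ∀ a b,
      W.Mem (W.P a b) (W.ev F ρ) → (W.Mem a (W.ev U ρ) ↔ W.Mem b (W.ev V ρ)))
    {ρ : Env W.D Γ} (hκ : W.sat κ ρ) : W.Color (W.ev U ρ) (W.ev V ρ) (W.ev F ρ) := by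
  rw [← sat_colorFm]
  refine all_intro κ (fun W ρ hκ a => all_intro κ.wk (fun W ρ hκ b => neg_intro' κ.wk.wk
    (fun W ρ hW hκ => ?_) (by simpa using hκ)) (by simpa using hκ)) hκ
  obtain ⟨b, ρ, rfl⟩ := ρ.exists_cons
  obtain ⟨a, ρ, rfl⟩ := ρ.exists_cons
  simp only [sat_wk] at hκ
  simp [hW.sat_neg_iff]
  intro hab
  rw [h W ρ hW hκ a b hab]
  tauto

section
variable {U V : W.D (.pow .seq)} {f g F G : W.D (.rel .seq .seq)} {k : W.D .nat}
  {x y u : W.D .seq}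

theorem Color.stp (hf : W.Color U V f) (hg : W.Color V U g) : W.Color V U (W.stp u f g) := by
  have := color_intro (W := W) (ρ := U ∷ V ∷ f ∷ g ∷ u ∷ Env.nil) (U := v1) (V := v0)
    (F := step v4 v2 v3) (.and (colorFm v0 v1 v2) (colorFm v1 v0 v3))
    (fun W ρ hW h b a hba => ?_) (by simpa using ⟨hf, hg⟩)
  · simpa using this
  · simp at h hba ⊢
    exact (hW.stp_color (fun a b hab => h.1.iff hW hab) (fun a b hab => (h.2.iff hW hab).symm)
      hba).symm

/-- A pair of sets that agree along `f` and `g` agree along the relations at each stage. -/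
theorem Stage.color (h : W.Stage f g k F G) (hf : W.Color U V f) (hg : W.Color V U g) :
    W.Color U V F := by
  have := itr_ind (W := W) (ρ := W.start f g ∷ f ∷ g ∷ U ∷ V ∷ Env.nil) (X := full) (R := next)
    (.and (.eq v0 (.pair .zero (.pair (step infty (step infty v1 v2) v1) (step infty v1 v2))))
      (.and (colorFm v3 v4 v1) (colorFm v4 v3 v2))) v0
    (.ex (.rel .seq .seq) (.ex (.rel .seq .seq) (.and (.eq v2 (.pair v3 (.pair v1 v0)))
      (.and (colorFm v3.wk.wk.wk.wk v4.wk.wk.wk.wk v1)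
        (colorFm v4.wk.wk.wk.wk v3.wk.wk.wk.wk v0))))) (fun W ρ hκ h => ?_)
    (fun W ρ hκ k s t h1 h2 h3 => ?_) (by simpa [start] using ⟨hf, hg⟩) (k := k)
    (z := W.P k (W.P F G)) (by simpa [Stage] using h)
  · simp at this
    exact this.1
  · simp at hκ ⊢
    obtain ⟨h, hf, hg⟩ := hκ
    exact ⟨_, _, h, (hf.stp hg).stp hf, hf.stp hg⟩
  · simp at h2
    rw [ev_next, mem_nxt] at h3
    obtain ⟨F, G, rfl, hF, hG⟩ := h2
    obtain ⟨_, _, _, e, rfl⟩ := h3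
    simp only [P_inj] at e
    obtain ⟨rfl, rfl, rfl⟩ := e
    simp
    exact ⟨(hF.stp hG).stp hF, hF.stp hG⟩

/-! ### Paths -/

/-- The points `x` and `y` are on the same path, as in the definition of `path`. -/
def OnPath (W : World) (f g : W.D (.rel .seq .seq)) (x y : W.D .seq) : Prop :=
  ∃ k, (∃ z, W.Mem (W.P x z) (W.itr W.X (W.cmp g f) k) ∧ W.Mem (W.P z y) f) ∨
    ∃ z, W.Mem (W.P y z) (W.itr W.X (W.cmp f g) k) ∧ W.Mem (W.P z x) g

theorem mem_path {X : Tm Γ (.pow .seq)} {f g : Tm Γ (.rel .seq .seq)} {ρ : Env W.D Γ}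
    (hX : W.ev X ρ = W.X) {x y : W.D .seq} :
    W.Mem (W.P x y) (W.ev (path X f g) ρ) ↔ W.OnPath (W.ev f ρ) (W.ev g ρ) x y := by
  simp [path, OnPath, hX]

theorem onPath_of_mem (hf : W.Inj f) (h : W.Mem (W.P x y) f) : W.OnPath f g x y :=
  ⟨W.Z, .inl ⟨x, itr_zero _ (hf.dom h), h⟩⟩

theorem Inj.fun (hf : W.Inj f) : W.Fun W.X W.X f := by
  simpa [sat_isFun] using hf.isFun

/-- The path through `x` contains `b` if and only if it contains `f (g b)`. -/
theorem onPath_iff (hf : W.Inj f) (hg : W.Inj g) {a b c : W.D .seq} (hba : W.Mem (W.P b a) g)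
    (hac : W.Mem (W.P a c) f) : W.OnPath f g x b ↔ W.OnPath f g x c := by
  have hbc : W.Mem (W.P b c) (W.cmp f g) := mem_cmp.2 ⟨a, hba, hac⟩
  constructor
  · rintro ⟨k, ⟨z, h, h'⟩ | ⟨z, h, h'⟩⟩
    · exact ⟨W.S k, .inl ⟨a, itr_succ h (mem_cmp.2 ⟨b, h', hba⟩), hac⟩⟩
    · rcases (hg.fun.cmp hf.fun).itr_cases_left h with ⟨rfl, rfl⟩ | ⟨j, y, rfl, h1, h2⟩
      · obtain rfl := hg.unique h' hba
        exact onPath_of_mem hf hac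
      · obtain rfl := (hg.fun.cmp hf.fun).unique h1 hbc
        exact ⟨j, .inr ⟨z, h2, h'⟩⟩
  · rintro ⟨k, ⟨z, h, h'⟩ | ⟨z, h, h'⟩⟩
    · obtain rfl := hf.inj h' hac
      rcases itr_cases h with ⟨rfl, rfl, h⟩ | ⟨j, y, rfl, h1, h2⟩
      · exact ⟨W.Z, .inr ⟨b, itr_zero _ (hg.dom hba), hba⟩⟩
      · obtain ⟨y', h2, h3⟩ := mem_cmp.1 h2
        obtain rfl := hg.inj h3 hba
        exact ⟨j, .inl ⟨y, h1, h2⟩⟩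
    · exact ⟨W.S k, .inr ⟨z, itr_succ_left (hg.dom hba) hbc h, h'⟩⟩

/-- Matched points are on the same path, because the set of points on a path is respected by all
the modifications of `f` and `g`. -/
theorem Classical.onPath_of_matched (hW : W.Classical) (hf : W.Inj f) (hg : W.Inj g)
    (h : W.Matched f g x y) : W.OnPath f g x y := by
  obtain ⟨k, F, G, h, hxy, -⟩ := h
  let V : Tm [.seq, .rel .seq .seq, .rel .seq .seq] (.pow .seq) :=
    .compr .seq (.mem (.pair v1 v0) (path conat v2 v3))
  let U : Tm [.seq, .rel .seq .seq, .rel .seq .seq] (.pow .seq) :=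
    .compr .seq (.ex .seq (.and (.mem (.pair v1 v0) v3) (.mem (.pair v2 v0) (path conat v3 v4))))
  have hU (W : World) (ρ : Env W.D [.seq, .rel .seq .seq, .rel .seq .seq]) (a) :
      W.Mem a (W.ev U ρ) ↔ ∃ b, W.Mem (W.P a b) (W.ev v1 ρ) ∧
        W.OnPath (W.ev v1 ρ) (W.ev v2 ρ) (W.ev v0 ρ) b := by simp [U, mem_path]
  have hV (W : World) (ρ : Env W.D [.seq, .rel .seq .seq, .rel .seq .seq]) (b) :
      W.Mem b (W.ev V ρ) ↔ W.OnPath (W.ev v1 ρ) (W.ev v2 ρ) (W.ev v0 ρ) b := by simp [V, mem_path]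
  have h1 := color_intro (W := W) (U := U) (V := V) (F := v1) (ρ := x ∷ f ∷ g ∷ Env.nil)
    (.and (isInj conat v1) (isInj conat v2)) (fun W ρ hW h a b hab => ?_) (by simpa using ⟨hf, hg⟩)
  have h2 := color_intro (W := W) (U := V) (V := U) (F := v2) (ρ := x ∷ f ∷ g ∷ Env.nil)
    (.and (isInj conat v1) (isInj conat v2)) (fun W ρ hW h b a hba => ?_) (by simpa using ⟨hf, hg⟩)
  · simp only [ev_var, Env.cons_zero, Env.cons_succ] at h1 h2
    have := ((h.color h1 h2).iff hW hxy).1 ?_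
    · simpa [hV] using this
    · obtain ⟨z, hz⟩ := hf.total ((h.inj hf hg).1.dom hxy)
      simpa [hU] using ⟨z, hz, onPath_of_mem hf hz⟩
  · rw [hU, hV]
    simp only [sat_and, sat_isInj] at h
    constructor
    · intro h'
      obtain ⟨c, hc⟩ := h.1.total (h.2.ran hba)
      exact ⟨c, hc, (onPath_iff h.1 h.2 hba hc).1 h'⟩
    · rintro ⟨c, hc, h'⟩
      exact (onPath_iff h.1 h.2 hba hc).2 h'
  · rw [hU, hV]
    simp only [sat_and, sat_isInj] at h
    exact ⟨fun ⟨c, hc, h'⟩ => h.1.unique hc hab ▸ h', fun h' => ⟨b, hab, h'⟩⟩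

end

/-- It is decidable whether a function maps `a` to a decidable point. -/
theorem dec_mem_of_fun {a b : Tm Γ .seq} {F : Tm Γ (.rel .seq .seq)} {ρ : Env W.D Γ}
    (hF : W.Fun W.X W.X (W.ev F ρ)) (ha : W.Mem (W.ev a ρ) W.X) (hb : W.DecPt (W.ev b ρ)) :
    W.Dec (.mem (.pair a b) F) ρ := by
  obtain ⟨y, hy⟩ := hF.total ha
  rcases hb.eq_or (hF.dom hy).2 with e | hne
  · exact .inl (by simpa [← e] using hy)
  · refine .inr (neg_intro (.ex .seq (.and (isFun conat conat F.wk)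
      (.and (.mem (.pair a.wk v0) F.wk) (neg (.eq v0 b.wk))))) (fun W ρ h h' => ?_)
      (by simpa [sat_isFun] using ⟨hF, y, hy, hne⟩))
    simp [sat_isFun] at h h'
    obtain ⟨hF, y, hy, hne⟩ := h
    exact hne.ne (hF.unique hy h')

end World
namespace World

variable {W : World} {Γ : Ctx} {A B C : Ty}

/-! ### The strong Myhill property -/

section
variable {f g F G : W.D (.rel .seq .seq)} {k : W.D .nat} {x y : W.D .seq}

/-- The bijection maps decidable natural numbers to decidable points. -/
theorem decPt_of_linked_nn (hf : W.Inj f) (hg : W.Inj g) (hy : W.Mem y W.X)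
    (h : W.Linked f g (W.nn k) y) : W.DecPt y := by
  obtain ⟨F, G, h'⟩ := exists_stage hf hg (W.S k)
  obtain ⟨hF, hG⟩ := h'.inj hf hg
  obtain ⟨p, hp⟩ := hF.total (nn_mem_X k)
  have := eq_intro (W := W) (x := v0) (y := v1) (ρ := y ∷ p ∷ k ∷ F ∷ G ∷ f ∷ g ∷ Env.nil)
    (.and (.and (isInj conat v5) (isInj conat v6)) (.and (.and (.mem v0 conat) (.mem v1 conat))
      (.and (linkedFm v5 v6 (ofNat v2) v0) (.and (stageFm v5 v6 (.succ v2) v3 v4)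
        (.mem (.pair (ofNat v2) v1) v3))))) (fun W ρ h => ?_) (fun W ρ h => ?_)
    (fun W ρ hW h => ?_) (by simpa using ⟨⟨hf, hg⟩, ⟨hy, hF.ran hp⟩, h, h', hp⟩)
  · obtain rfl : y = p := by simpa using this
    exact hF.decPt_right hp (decPt_nn k)
  · simp at h
    simpa using h.2.1.1
  · simp at h
    simpa using h.2.1.2
  · simp at h ⊢
    obtain ⟨⟨hf, hg⟩, -, h, h', hp⟩ := h
    rw [hW.linked_iff] at h
    obtain ⟨q, hq⟩ := (hW.matched_nn hf hg h').1
    obtain rfl := hW.matched_unique hf hg h ⟨_, _, _, h', hq⟩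
    exact (h'.inj hf hg).1.unique hq.1 hp

/-- The bijection agrees with `f` at `∞`. -/
theorem mem_of_linked_inf (hf : W.Inj f) (hg : W.Inj g) (hy : W.Mem y W.X)
    (h : W.Linked f g W.inf y) : W.Mem (W.P W.inf y) f := by
  obtain ⟨p, hp⟩ := hf.total inf_mem_X
  have := eq_intro (W := W) (x := v0) (y := v1) (ρ := y ∷ p ∷ f ∷ g ∷ Env.nil)
    (.and (.and (isInj conat v2) (isInj conat v3)) (.and (.and (.mem v0 conat) (.mem v1 conat))
      (.and (linkedFm v2 v3 infty v0) (.mem (.pair infty v1) v2)))) (fun W ρ h => ?_)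
    (fun W ρ h => ?_) (fun W ρ hW h => ?_) (by simpa using ⟨⟨hf, hg⟩, ⟨hy, hf.ran hp⟩, h, hp⟩)
  · obtain rfl : y = p := by simpa using this
    exact hp
  · simp at h
    simpa using h.2.1.1
  · simp at h
    simpa using h.2.1.2
  · simp at h ⊢
    obtain ⟨⟨hf, hg⟩, -, h, hp⟩ := h
    exact hW.matched_unique hf hg (hW.linked_iff.1 h) (hW.matched_inf hf hg hp)

/-- For natural numbers `x`, the path from `x` to `y` is found by Markov's principle. -/
theorem onPath_of_linked (hf : W.Inj f) (hg : W.Inj g) (hx : W.Mem x W.X) (hy : W.Mem y W.X)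
    (hdx : W.DecPt x) (hdy : W.DecPt y) (h : W.Linked f g x y) : W.OnPath f g x y := by
  have := exists_of_not_not (W := W) (ρ := x ∷ y ∷ f ∷ g ∷ Env.nil)
    (.and (.and (isInj conat v2) (isInj conat v3)) (.and (.and (.mem v0 conat) (.mem v1 conat))
      (.and (.and (decPt v0) (decPt v1)) (linkedFm v2 v3 v0 v1))))
    (φ := .or (.mem (.pair v1 v2) (comp v3 (iter conat (comp v4 v3) v0)))
      (.mem (.pair v2 v1) (comp v4 (iter conat (comp v3 v4) v0))))
    (fun W ρ h k => ?_) (by simpa using ⟨⟨hf, hg⟩, ⟨hx, hy⟩, ⟨hdx, hdy⟩, h⟩)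
    (neg_neg_intro (.and (.and (isInj conat v2) (isInj conat v3)) (.and (.and (.mem v0 conat)
      (.mem v1 conat)) (.and (.and (decPt v0) (decPt v1)) (linkedFm v2 v3 v0 v1))))
      (fun W ρ hW h => ?_) (by simpa using ⟨⟨hf, hg⟩, ⟨hx, hy⟩, ⟨hdx, hdy⟩, h⟩))
  · simpa [OnPath] using this
  · simp at h
    obtain ⟨⟨hf, hg⟩, ⟨hx, hy⟩, ⟨hdx, hdy⟩, -⟩ := h
    exact .or (dec_mem_of_fun (by simpa using ((hf.fun.cmp hg.fun).itr k).cmp hf.fun)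
      (by simpa using hx) (by simpa using hdy))
      (dec_mem_of_fun (by simpa using ((hg.fun.cmp hf.fun).itr k).cmp hg.fun)
        (by simpa using hy) (by simpa using hdx))
  · simp at h
    obtain ⟨⟨hf, hg⟩, -, -, h⟩ := h
    simpa [OnPath] using hW.onPath_of_matched hf hg (hW.linked_iff.1 h)

/-- The modality holds, with the point `x` itself as the witness. -/
theorem onPath_of_linked_of_or (hf : W.Inj f) (hg : W.Inj g) (hy : W.Mem y W.X)
    (h : W.Linked f g x y) (hx : (∃ k, x = W.nn k) ∨ x = W.inf) : W.OnPath f g x y := by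
  rcases hx with ⟨k, rfl⟩ | rfl
  · exact onPath_of_linked hf hg (nn_mem_X k) hy (decPt_nn k) (decPt_of_linked_nn hf hg hy h) h
  · exact onPath_of_mem hf (mem_of_linked_inf hf hg hy h)

end

/-- The element `F` is a bijection of the conatural numbers. -/
def Bij (W : World) (F : W.D (.rel .seq .seq)) : Prop := W.sat (isBij conat v0) (F ∷ Env.nil)

@[simp] theorem sat_isBij (F : Tm Γ (.rel .seq .seq)) (ρ : Env W.D Γ) :
    W.sat (isBij conat F) ρ ↔ W.Bij (W.ev F ρ) := sat_one (isBij conat v0) F ρ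

@[simp] theorem mem_finConat {x : W.D .seq} {ρ : Env W.D Γ} :
    W.Mem x (W.ev finConat ρ) ↔ ∃ k, x = W.nn k := by simp [finConat]

/-- The set `modLPO` in a world. -/
def LPO (W : World) : W.D (.pow .prop) := W.ev modLPO Env.nil

@[simp] theorem ev_modLPO (ρ : Env W.D Γ) : W.ev modLPO ρ = W.LPO := ev_closed modLPO ρ

/-- A truth value is in `modLPO` if it is true whenever `x` is a natural number or `∞`. -/
theorem mem_modLPO_intro (κ : Fm Γ) {φ : Fm Γ} {x : Tm Γ .seq}
    (h : ∀ (W : World) (ρ : Env W.D Γ), W.sat κ ρ →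
      (∃ k, W.ev x ρ = W.nn k) ∨ W.ev x ρ = W.inf → W.sat φ ρ)
    {ρ : Env W.D Γ} (hκ : W.sat κ ρ) (hx : W.Mem (W.ev x ρ) W.X) :
    W.Mem (W.ev φ ρ) W.LPO := by
  rw [← ev_modLPO ρ]
  simp only [modLPO, mem_compr, sat_exIn, ev_conat]
  refine ⟨_, hx, imp_intro (.and κ.wk.wk (.and (.eq v0 x.wk.wk) (.eq v1 φ.wk.wk)))
    (fun W ρ hκ h' => ?_) (by simpa using hκ)⟩
  obtain ⟨y, ρ, rfl⟩ := ρ.exists_cons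
  obtain ⟨p, ρ, rfl⟩ := ρ.exists_cons
  simp at hκ h'
  obtain ⟨hκ, rfl, rfl⟩ := hκ
  have := h W ρ hκ h'
  rw [sat] at this ⊢
  simpa using this

theorem sat_strongMyhill (ρ : Env W.D Γ) : W.sat (strongMyhill modLPO conat) ρ := by
  refine all_intro .top (fun W ρ _ f => all_intro .top (fun W ρ _ g => imp_intro .top
    (fun W ρ _ hf => imp_intro (isInj conat v1) (fun W ρ hf hg => ?_) hf) (sat_top _))
    (sat_top _)) (sat_top _)
  have hf := (sat_isInj v1 ρ).1 hf
  have hg := (sat_isInj v0 ρ).1 hg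
  refine (sat_ex _ _).2 ⟨W.ev (myhill v1 v0) ρ, (sat_and _ _ _).2 ⟨(sat_isBij v0 _).2 ?_, ?_⟩⟩
  · have := sat_isBij_myhill hf hg
    simpa using this
  refine allIn_intro (.and (.eq v0 (myhill v2 v1)) (.and (isInj conat v2) (isInj conat v1)))
    (fun W ρ hκ x hx => all_intro (.and (.mem v0 conat)
      (.and (.eq v1 (myhill v3 v2)) (.and (isInj conat v3) (isInj conat v2))))
    (fun W ρ hκ y => imp_intro (.and (.mem v1 conat)
      (.and (.eq v2 (myhill v4 v3)) (.and (isInj conat v4) (isInj conat v3))))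
      (fun W ρ hκ h => ?_) ?_) ?_) ?_
  · simp only [sat_and, sat_eq, sat_isInj, sat_mem, ev_conat] at hκ
    obtain ⟨hx, e, hf, hg⟩ := hκ
    have h : W.Mem (W.P (W.ev v1 ρ) (W.ev v0 ρ)) (W.ev v2 ρ) := by simpa using h
    rw [e, ev_myhill, mem_Myhill] at h
    rw [sat_mem]
    have := mem_modLPO_intro (W := W) (x := v1) (ρ := ρ)
      (φ := .mem (.pair v1 v0) (path conat.wk.wk.wk.wk.wk v4 v3)) (.and (.and (isInj conat v4)
      (isInj conat v3)) (.and (.mem v0 conat) (linkedFm v4 v3 v1 v0))) (fun W ρ hκ h => ?_) ?_ hx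
    · revert this
      obtain ⟨y, ρ, rfl⟩ := ρ.exists_cons
      obtain ⟨x, ρ, rfl⟩ := ρ.exists_cons
      obtain ⟨h, ρ, rfl⟩ := ρ.exists_cons
      obtain ⟨g, ρ, rfl⟩ := ρ.exists_cons
      obtain ⟨f, ρ, rfl⟩ := ρ.exists_cons
      simp only [ev_wk, ev_modLPO]
      exact id
    · simp only [sat_and, sat_isInj, sat_mem, ev_conat, sat_linkedFm] at hκ
      obtain ⟨⟨hf, hg⟩, hy, h'⟩ := hκ
      have := onPath_of_linked_of_or hf hg hy h' h
      obtain ⟨y, ρ, rfl⟩ := ρ.exists_cons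
      obtain ⟨x, ρ, rfl⟩ := ρ.exists_cons
      obtain ⟨h, ρ, rfl⟩ := ρ.exists_cons
      obtain ⟨g, ρ, rfl⟩ := ρ.exists_cons
      obtain ⟨f, ρ, rfl⟩ := ρ.exists_cons
      rwa [sat_mem, ev_pair, mem_path (by simp)]
    · simp only [ev_var] at hf hg h
      simpa using ⟨⟨hf, hg⟩, h.2⟩
  · simpa using hκ
  · simp at hκ
    have hx : W.Mem x W.X := by
      obtain ⟨h, ρ, rfl⟩ := ρ.exists_cons
      obtain ⟨g, ρ, rfl⟩ := ρ.exists_cons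
      obtain ⟨f, ρ, rfl⟩ := ρ.exists_cons
      simpa using hx
    simpa using ⟨hx, hκ⟩
  · simp only [ev_var] at hf hg
    simpa using ⟨hf, hg⟩

end World
end IHOL

/-- In intuitionistic higher-order logic with natural numbers, Markov's principle proves that the
set of conatural numbers has the strong Myhill property relative to the mindchange modality. -/
theorem mainTheorem1 :
    IHOL.Entails (Γ := []) [IHOL.markov] (IHOL.strongMyhill IHOL.modLPO IHOL.conat) :=
  IHOL.World.complete fun _ ρ _ => IHOL.World.sat_strongMyhill ρ
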